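/- Let $\beta\in(1,2)$ and let $T_\beta:[0,1)\to[0,1)$, $T_\beta(x)=\beta x \pmod 1$. For $t\in[0,1)$ put $$K_\beta(t)=\{x\in[0,1): T_\beta^n(x)\notin(0,t)\ \text{for all } n\ge 0\},\qquad E_\beta^+=\{t\in[0,1): T_\beta^n(t)\ge t\ \text{for all } n\ge 0\}.$$ *Farey intervals.* Let $F_0=(0,1)$ (an ordered list of two one-letter words) and let $F_{n+1}$ arise from $F_n$ by inserting between any two neighbouring words $u,v$ the concatenation $uv$. Let $\mathcal F=\bigcup_{n\ge0}F_n\setminus\{0,1\}$. For $\gamma\in(1,2]$ let $\alpha(\gamma)\in\{0,1\}^{\mathbb N}$ be the quasi-greedy $\gamma$-expansion of $1$: its $i$-th digit ($i\ge1$) is $0$ if $\widetilde T_\gamma^{\,i-1}(1)\le 1/\gamma$ and $1$ otherwise, where $\widetilde T_\gamma(x)=\gamma x$ for $x\in(0,1/\gamma]$ and $\widetilde T_\gamma(x)=\gamma x-1$ for $x\in(1/\gamma,1]$. For a word $a_1\ldots a_m$ whose reflection $(1-a_1)\ldots(1-a_m)$ belongs to $\mathcal F$ (so $a_m=0$), the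 Farey interval generated by $a_1\ldots a_m$ is $(\gamma_L,\gamma_R]$, where $\gamma_L,\gamma_R\in(1,2]$ are determined by $$\alpha(\gamma_L)=(a_1\ldots a_m)^\infty,\qquad \alpha(\gamma_R)=a_1\ldots a_{m-1}1\,(a_ma_{m-1}\ldots a_1)^\infty .$$ **Theorem.** For every $\beta\in(1,2)$ there is a unique real number $\tau_\beta$ such that, for all $t\in[0,1)$, $\dim_H K_\beta(t)>0$ if and only if $t<\tau_\beta$. It satisfies $\tau_\beta\le 1-\frac1\beta$. Moreover, the following are equivalent: 1. $\tau_\beta=1-\frac1\beta$; 2. the closure $\overline{E_\beta^+}$ is a Cantor set (nonempty, compact, perfect and totally disconnected); 3. $\beta$ belongs to no Farey interval $(\gamma_L,\gamma_R]$. -/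

import Mathlib

namespace BetaHole

/-- The map `x ↦ β x (mod 1)`; on `[0, 1)` it is the `β`-transformation. -/
noncomputable def betaMap (β x : ℝ) : ℝ := Int.fract (β * x)

/-- The survivor set: points of `[0, 1)` whose orbit never enters the hole `(0, t)`. -/
def survivorSet (β t : ℝ) : Set ℝ :=
  {x | x ∈ Set.Ico (0 : ℝ) 1 ∧ ∀ n : ℕ, (betaMap β)^[n] x ∉ Set.Ioo (0 : ℝ) t}

/-- The points of `[0, 1)` that are minimal in their own orbit. -/
def orbitMinimalSet (β : ℝ) : Set ℝ :=
  {t | t ∈ Set.Ico (0 : ℝ) 1 ∧ ∀ n : ℕ, t ≤ (betaMap β)^[n] t}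

/-- For holes `(0, t)` with `t ∈ [0, 1)`, the survivor set has positive Hausdorff dimension
exactly when `t < τ`. -/
def IsCriticalValue (β τ : ℝ) : Prop :=
  ∀ t ∈ Set.Ico (0 : ℝ) 1, 0 < dimH (survivorSet β t) ↔ t < τ

/-- A Cantor set in the line: nonempty, compact, perfect and totally disconnected. -/
structure IsCantorSet (C : Set ℝ) : Prop where
  nonempty : C.Nonempty
  isCompact : IsCompact C
  perfect : Perfect C
  isTotallyDisconnected : IsTotallyDisconnected C

/-- The quasi-greedy map on `(0, 1]`. -/
noncomputable def quasiGreedyMap (β x : ℝ) : ℝ :=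
  if x ≤ 1 / β then β * x else β * x - 1

/-- The quasi-greedy `β`-expansion of `1`, indexed from `0`
(`true` is the digit `1` and `false` is the digit `0`). -/
noncomputable def quasiGreedyOne (β : ℝ) : ℕ → Bool :=
  fun n => decide (1 / β < (quasiGreedyMap β)^[n] 1)

/-- The infinite repetition of a nonempty word. -/
def periodicSeq (w : List Bool) : ℕ → Bool :=
  fun n => w.getD (n % w.length) false

/-- The concatenation of a word and a sequence. -/
def prependWord (w : List Bool) (x : ℕ → Bool) : ℕ → Bool :=
  fun n => if n < w.length then w.getD n false else x (n - w.length)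

/-- Insert between any two neighbours of a list of words their concatenation. -/
def fareyStep : List (List Bool) → List (List Bool)
  | u :: v :: l => u :: (u ++ v) :: fareyStep (v :: l)
  | l => l

/-- The `n`-th ordered list of Farey words, starting from the words `0` and `1`. -/
def fareyList : ℕ → List (List Bool)
  | 0 => [[false], [true]]
  | n + 1 => fareyStep (fareyList n)

/-- The Farey words other than `0` and `1`. -/
def IsNondegenerateFareyWord (w : List Bool) : Prop :=
  (∃ n : ℕ, w ∈ fareyList n) ∧ w ≠ [false] ∧ w ≠ [true]

/-- The reflection of a word: every digit `d` is replaced by `1 - d`. -/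
def reflectWord (w : List Bool) : List Bool := w.map not

/-- The word with its last digit, a `0`, raised to `1`. -/
def raiseLast (w : List Bool) : List Bool := w.dropLast ++ [true]

/-- `J` is the interval `(γL, γR]` generated by a word `a` whose reflection is a nondegenerate
Farey word: the quasi-greedy expansions of `1` in the bases `γL` and `γR` are `a` repeated, and
`a` with its last digit raised followed by the repeated reversal of `a`. -/
def IsFareyInterval (J : Set ℝ) : Prop :=
  ∃ (a : List Bool) (γL γR : ℝ), IsNondegenerateFareyWord (reflectWord a) ∧
    γL ∈ Set.Ioc (1 : ℝ) 2 ∧ γR ∈ Set.Ioc (1 : ℝ) 2 ∧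
    quasiGreedyOne γL = periodicSeq a ∧
    quasiGreedyOne γR = prependWord (raiseLast a) (periodicSeq a.reverse) ∧
    J = Set.Ioc γL γR

end BetaHole

namespace BetaHole

open Filter Topology Set MeasureTheory
open scoped ENNReal NNReal

/-! ### The map `x ↦ β x (mod 1)` -/

/-! Everything hinges on whether the map has a periodic orbit inside `[1 - 1/β, 1)`
(`HasPeriodicAbove`). On that interval the map is injective and preserves the cyclic order, like a
rotation of the circle. Each of the three conditions holds exactly when there is no such orbit.

Dimension is read off from the numbers `tailCount β t n t` of pre-images of `1` that avoid the hole.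
If their generating series converges on all of `(0, 1)`, the survivors are covered by
subexponentially many intervals of length `(1/β)^n` and have dimension zero
(`dimH_forwardSet_eq_zero`). If it diverges somewhere in `(0, 1)`, a limit of its normalised partial
sums is a Hölder function that is locally constant from the right off the survivors, which forces
positive dimension (`dimH_survivorSet_pos`). The convergent series is the reciprocal of a kneading
function that is right-continuous in `t`, so dimension zero passes to limits from the right
(`exists_dimH_pos_right`); hence the supremum of the parameters with positive dimension is the
critical value. At `t = 1 - 1/β` all counts equal `1`, which bounds it from above.

Suppose there is no periodic orbit in `[1 - 1/β, 1)`. For `t` below `1 - 1/β` every point has at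
least two pre-images of some uniform order; otherwise arbitrarily long backward orbits would stay
away from `1`, and such orbits close up to a periodic one (`hasPeriodicAbove_of_backMap`). So the
counts grow exponentially and the critical value is `1 - 1/β`. The same closing argument makes
survivors accumulate at `1`, and pulling them back yields new orbit-minimal points next to any given
one, whence perfectness.

Suppose there is such an orbit. Preservation of cyclic order makes it a rotation by some `k/q`, with
smallest point `μ` and largest point `M` given by explicit series in `1/β`
(`exists_realizesRotation`). The gap identity for `M - μ` puts the left end of the branch of the
`q`-th iterate at `μ` strictly below `1 - 1/β`, and expansion away from `μ` leaves no survivors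
between that end and `μ`. The critical value is therefore smaller than `1 - 1/β`, and `μ` is
isolated among the orbit-minimal points.

Finally, rotation digits form Christoffel words, which are the Farey words. As `M` and `1/β + μ`
decrease in `β`, the conditions `M < 1` and `1 - 1/β ≤ μ` say `γL < β` and `β ≤ γR`. -/

theorem betaMap_mem_Ico (β x : ℝ) : betaMap β x ∈ Ico (0 : ℝ) 1 :=
  ⟨Int.fract_nonneg _, Int.fract_lt_one _⟩

theorem betaMap_eq_of_eq_add {β x y : ℝ} (n : ℤ) (hy : y ∈ Ico (0 : ℝ) 1) (h : β * x = n + y) :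
    betaMap β x = y := by
  rw [betaMap, h, Int.fract_intCast_add]
  exact Int.fract_eq_self.2 hy

theorem betaMap_of_lt {β x : ℝ} (hβ : 1 < β) (h0 : 0 ≤ x) (h : x < 1 / β) :
    betaMap β x = β * x := by
  have hb : 0 < β := by linarith
  refine betaMap_eq_of_eq_add 0 ⟨by positivity, ?_⟩ (by simp)
  rwa [lt_div_iff₀ hb, mul_comm] at h

theorem betaMap_of_le {β x : ℝ} (hβ : β ∈ Ioo (1 : ℝ) 2) (h : 1 / β ≤ x) (h1 : x ≤ 1) :
    betaMap β x = β * x - 1 := by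
  obtain ⟨hb, hb2⟩ := hβ
  have hb0 : 0 < β := by linarith
  refine betaMap_eq_of_eq_add 1 ⟨?_, by nlinarith⟩ (by push_cast; ring)
  rw [div_le_iff₀ hb0] at h
  linarith

theorem betaMap_one {β : ℝ} (hβ : β ∈ Ioo (1 : ℝ) 2) : betaMap β 1 = β - 1 := by
  have := betaMap_of_le hβ (x := 1) ?_ le_rfl
  · simpa using this
  · rw [div_le_iff₀ (by linarith [hβ.1])]; linarith [hβ.1]

theorem betaMap_zero (β : ℝ) : betaMap β 0 = 0 := by simp [betaMap]

theorem iterate_betaMap_zero (β : ℝ) (n : ℕ) : (betaMap β)^[n] 0 = 0 :=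
  Function.iterate_fixed (betaMap_zero β) n

theorem iterate_betaMap_mem_Ico {β x : ℝ} (hx : x ∈ Ico (0 : ℝ) 1) (n : ℕ) :
    (betaMap β)^[n] x ∈ Ico (0 : ℝ) 1 := by
  cases n with
  | zero => exact hx
  | succ n => rw [Function.iterate_succ_apply']; exact betaMap_mem_Ico _ _

theorem cut_pos {β : ℝ} (hβ : 1 < β) : 0 < 1 - 1 / β := by
  rw [sub_pos, div_lt_one (by linarith)]; exact hβ

theorem cut_lt_inv {β : ℝ} (hβ : β ∈ Ioo (1 : ℝ) 2) : 1 - 1 / β < 1 / β := by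
  have h0 : 0 < β := by linarith [hβ.1]
  have : 1 < 2 / β := by rw [lt_div_iff₀ h0]; linarith [hβ.2]
  have h2 : 2 / β = 1 / β + 1 / β := by ring
  linarith

theorem mul_cut {β : ℝ} (hβ : 1 < β) : β * (1 - 1 / β) = β - 1 := by
  have : β ≠ 0 := by linarith
  field_simp

theorem inv_lt_one_of {β : ℝ} (hβ : 1 < β) : 1 / β < 1 := by linarith [cut_pos hβ]

/-- A point slightly above `x` shadows the orbit of `x` as long as the distance, which grows by
the factor `β`, does not push it beyond `1`. -/
theorem iterate_betaMap_add {β x η : ℝ} (hβ : 1 < β) (hx : x ∈ Ico (0 : ℝ) 1) (hη : 0 ≤ η) {n : ℕ}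
    (h : ∀ j ≤ n, (betaMap β)^[j] x + β ^ j * η < 1) :
    ∀ j ≤ n, (betaMap β)^[j] (x + η) = (betaMap β)^[j] x + β ^ j * η := by
  intro j
  induction j with
  | zero => intro _; simp
  | succ j ih =>
    intro hj
    have hm := iterate_betaMap_mem_Ico (β := β) hx (j + 1)
    have hpos : 0 ≤ β ^ (j + 1) * η := by positivity
    rw [Function.iterate_succ_apply', ih (by omega)]
    refine betaMap_eq_of_eq_add ⌊β * (betaMap β)^[j] x⌋ ⟨by linarith [hm.1], h _ hj⟩ ?_
    rw [Function.iterate_succ_apply', betaMap]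
    have := Int.floor_add_fract (β * (betaMap β)^[j] x)
    rw [pow_succ]
    linarith

/-- A point slightly below `x` shadows the orbit of `x` as long as the distance, which grows by
the factor `β`, does not push it below `0`. -/
theorem iterate_betaMap_sub {β x η : ℝ} (hβ : 1 < β) (hx : x ∈ Ico (0 : ℝ) 1) (hη : 0 ≤ η) {n : ℕ}
    (h : ∀ j ≤ n, 0 ≤ (betaMap β)^[j] x - β ^ j * η) :
    ∀ j ≤ n, (betaMap β)^[j] (x - η) = (betaMap β)^[j] x - β ^ j * η := by
  intro j
  induction j with
  | zero => intro _; simp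
  | succ j ih =>
    intro hj
    have hm := iterate_betaMap_mem_Ico (β := β) hx (j + 1)
    have hpos : 0 ≤ β ^ (j + 1) * η := by positivity
    rw [Function.iterate_succ_apply', ih (by omega)]
    refine betaMap_eq_of_eq_add ⌊β * (betaMap β)^[j] x⌋ ⟨h _ hj, by linarith [hm.2]⟩ ?_
    rw [Function.iterate_succ_apply', betaMap]
    have := Int.floor_add_fract (β * (betaMap β)^[j] x)
    rw [pow_succ]
    linarith

/-- Every right neighbourhood of `x` contains a point at which a branch of an iterate that is
continuous at `x` ends. -/
theorem exists_branch_end {β x δ : ℝ} (hβ : 1 < β) (hx : x ∈ Ico (0 : ℝ) 1) (hδ : 0 < δ)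
    (hxδ : x + δ < 1) :
    ∃ (n : ℕ) (η : ℝ), 0 < η ∧ η ≤ δ ∧ (betaMap β)^[n + 1] x + β ^ (n + 1) * η = 1 ∧
      ∀ j ≤ n, (betaMap β)^[j] x + β ^ j * η < 1 := by
  have hex : ∃ n : ℕ, 1 ≤ (betaMap β)^[n] x + β ^ n * δ := by
    obtain ⟨n, hn⟩ := pow_unbounded_of_one_lt (1 / δ) hβ
    refine ⟨n, ?_⟩
    have := (iterate_betaMap_mem_Ico (β := β) hx n).1
    rw [div_lt_iff₀ hδ] at hn
    linarith
  classical
  obtain ⟨m, hm, hmin⟩ : ∃ m, (1 ≤ (betaMap β)^[m] x + β ^ m * δ) ∧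
      ∀ j < m, (betaMap β)^[j] x + β ^ j * δ < 1 :=
    ⟨Nat.find hex, Nat.find_spec hex, fun j hj => not_le.1 (Nat.find_min hex hj)⟩
  cases m with
  | zero => simp at hm; linarith
  | succ n =>
    have hb : 0 < β := by linarith
    have hlt := (iterate_betaMap_mem_Ico (β := β) hx (n + 1)).2
    have hp : 0 < β ^ (n + 1) := by positivity
    have hle : (1 - (betaMap β)^[n + 1] x) / β ^ (n + 1) ≤ δ := by
      rw [div_le_iff₀ hp]; linarith
    refine ⟨n, (1 - (betaMap β)^[n + 1] x) / β ^ (n + 1), div_pos (by linarith) hp, hle, ?_, ?_⟩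
    · field_simp; ring
    · intro j hj
      have := hmin j (by omega)
      have h2 : β ^ j * ((1 - (betaMap β)^[n + 1] x) / β ^ (n + 1)) ≤ β ^ j * δ := by gcongr
      linarith

/-- The map is continuous from the right and increasing to the right of every point. -/
theorem tendsto_betaMap {β : ℝ} (hβ : 0 < β) (x : ℝ) :
    Tendsto (betaMap β) (𝓝[≥] x) (𝓝[≥] (betaMap β x)) := by
  have h1 : Tendsto (fun y => β * y) (𝓝[≥] x) (𝓝[≥] (β * x)) := by
    refine tendsto_nhdsWithin_of_tendsto_nhds_of_eventually_within _ ?_ ?_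
    · exact ((continuous_const.mul continuous_id).tendsto x).mono_left nhdsWithin_le_nhds
    · filter_upwards [self_mem_nhdsWithin] with y hy
      exact mul_le_mul_of_nonneg_left hy hβ.le
  refine Tendsto.comp (g := Int.fract) ?_ h1
  set z := β * x
  have hev : ∀ᶠ y in 𝓝[≥] z, ⌊y⌋ = ⌊z⌋ := by
    have : Ico z (⌊z⌋ + 1) ∈ 𝓝[≥] z := Ico_mem_nhdsGE (Int.lt_floor_add_one z)
    filter_upwards [this] with y hy
    rw [Int.floor_eq_iff]
    exact ⟨(Int.floor_le z).trans hy.1, hy.2⟩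
  refine tendsto_nhdsWithin_of_tendsto_nhds_of_eventually_within _ ?_ ?_
  · have : Tendsto (fun y : ℝ => y - ⌊z⌋) (𝓝[≥] z) (𝓝 (Int.fract z)) :=
      ((continuous_id.sub continuous_const).tendsto z).mono_left nhdsWithin_le_nhds
    refine this.congr' ?_
    filter_upwards [hev] with y hy
    change y - (⌊z⌋ : ℝ) = y - (⌊y⌋ : ℝ)
    rw [hy]
  · filter_upwards [hev, self_mem_nhdsWithin] with y hy hy2
    change z - (⌊z⌋ : ℝ) ≤ y - (⌊y⌋ : ℝ)
    rw [hy]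
    exact sub_le_sub_right hy2 _

theorem tendsto_iterate_right {f : ℝ → ℝ} (hf : ∀ x, Tendsto f (𝓝[≥] x) (𝓝[≥] (f x))) (n : ℕ)
    (x : ℝ) : Tendsto f^[n] (𝓝[≥] x) (𝓝[≥] (f^[n] x)) := by
  induction n generalizing x with
  | zero => exact tendsto_id
  | succ n ih =>
    rw [Function.iterate_succ, Function.comp_apply]
    exact (ih (f x)).comp (hf x)

/-! ### Orbits that stay above a threshold -/

/-- The points whose whole orbit lies in `[t, 1)`. -/
def forwardSet (β t : ℝ) : Set ℝ := {x | ∀ n : ℕ, (betaMap β)^[n] x ∈ Ico t 1}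

theorem forwardSet_anti {β s t : ℝ} (h : s ≤ t) : forwardSet β t ⊆ forwardSet β s :=
  fun _ hx n => ⟨h.trans (hx n).1, (hx n).2⟩

theorem iterate_mem_forwardSet {β t x : ℝ} (hx : x ∈ forwardSet β t) (n : ℕ) :
    (betaMap β)^[n] x ∈ forwardSet β t := fun m => by
  rw [← Function.iterate_add_apply]; exact hx _

theorem betaMap_mem_forwardSet {β t x : ℝ} (hx : x ∈ forwardSet β t) :
    betaMap β x ∈ forwardSet β t := iterate_mem_forwardSet hx 1

theorem mem_forwardSet_of_betaMap {β t x : ℝ} (hx : x ∈ Ico t 1)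
    (h : betaMap β x ∈ forwardSet β t) : x ∈ forwardSet β t := by
  intro n
  cases n with
  | zero => exact hx
  | succ n => exact h n

theorem forwardSet_subset_survivorSet {β t : ℝ} (ht : 0 ≤ t) :
    forwardSet β t ⊆ survivorSet β t :=
  fun _ hx => ⟨⟨ht.trans (hx 0).1, (hx 0).2⟩, fun n h => absurd h.2 (not_lt.2 (hx n).1)⟩

theorem survivorSet_anti {β s t : ℝ} (h : s ≤ t) : survivorSet β t ⊆ survivorSet β s :=
  fun _ hx => ⟨hx.1, fun n hn => hx.2 n ⟨hn.1, hn.2.trans_le h⟩⟩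

/-- The points whose orbit reaches `0`. -/
def zeroSet (β : ℝ) : Set ℝ := {x | ∃ n : ℕ, (betaMap β)^[n] x = 0}

theorem countable_preimage_betaMap {β : ℝ} (hβ : β ≠ 0) {s : Set ℝ} (hs : s.Countable) :
    (betaMap β ⁻¹' s).Countable := by
  refine ((hs.prod (Set.countable_univ (α := ℤ))).image
    (fun p : ℝ × ℤ => (p.1 + p.2) / β)).mono ?_
  intro x hx
  refine ⟨(betaMap β x, ⌊β * x⌋), ⟨hx, mem_univ _⟩, ?_⟩
  simp only [betaMap, Int.fract_add_floor]
  field_simp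

theorem countable_zeroSet {β : ℝ} (hβ : β ≠ 0) : (zeroSet β).Countable := by
  have : zeroSet β = ⋃ n : ℕ, (betaMap β)^[n] ⁻¹' {0} := by ext; simp [zeroSet]
  rw [this]
  refine countable_iUnion fun n => ?_
  induction n with
  | zero => simp
  | succ n ih =>
    rw [Function.iterate_succ, preimage_comp]
    exact countable_preimage_betaMap hβ ih

/-- An orbit that avoids the hole can be below `t` only at the fixed point `0`. The points that
reach `0` are countable and do not affect dimension. -/
theorem survivorSet_subset {β t : ℝ} : survivorSet β t ⊆ forwardSet β t ∪ zeroSet β := by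
  intro x hx
  by_cases h : x ∈ zeroSet β
  · exact Or.inr h
  · refine Or.inl fun n => ?_
    have h1 := iterate_betaMap_mem_Ico (β := β) hx.1 n
    have h2 : (betaMap β)^[n] x ≠ 0 := fun h' => h ⟨n, h'⟩
    have h3 := hx.2 n
    refine ⟨?_, h1.2⟩
    by_contra h4
    exact h3 ⟨lt_of_le_of_ne h1.1 h2.symm, not_le.1 h4⟩

theorem dimH_survivorSet_eq_zero {β t : ℝ} (hβ : β ≠ 0) (h : dimH (forwardSet β t) = 0) :
    dimH (survivorSet β t) = 0 := by
  refine le_antisymm ((dimH_mono survivorSet_subset).trans ?_) zero_le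
  rw [dimH_union, h, (countable_zeroSet hβ).dimH_zero]
  simp

/-- The infimum of an orbit is minimal in its own orbit. -/
theorem sInf_orbit_mem {β x : ℝ} (hβ : 0 < β) (hx : x ∈ Ico (0 : ℝ) 1) :
    sInf (range fun n => (betaMap β)^[n] x) ∈ orbitMinimalSet β := by
  set m := sInf (range fun n => (betaMap β)^[n] x)
  have hbdd : BddBelow (range fun n => (betaMap β)^[n] x) :=
    ⟨0, by rintro _ ⟨n, rfl⟩; exact (iterate_betaMap_mem_Ico hx n).1⟩
  have hle : ∀ n, m ≤ (betaMap β)^[n] x := fun n => csInf_le hbdd ⟨n, rfl⟩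
  refine ⟨⟨le_csInf (range_nonempty _) ?_, (hle 0).trans_lt hx.2⟩, fun j => ?_⟩
  · rintro _ ⟨n, rfl⟩; exact (iterate_betaMap_mem_Ico hx n).1
  · by_contra! hlt
    -- If the `j`-th iterate sent `m` below `m`, right-continuity would do the same to points
    -- slightly above `m`, and the orbit has such points.
    have h1 := (tendsto_iterate_right (tendsto_betaMap hβ) j m).mono_right nhdsWithin_le_nhds
    have h2 := h1.eventually (gt_mem_nhds hlt)
    obtain ⟨u, hu, hsub⟩ := mem_nhdsGE_iff_exists_Ico_subset.1 h2
    obtain ⟨_, ⟨n, rfl⟩, hn⟩ := exists_lt_of_csInf_lt (range_nonempty _) (show m < u from hu)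
    have h3 : (betaMap β)^[j] ((betaMap β)^[n] x) < m := hsub ⟨hle n, hn⟩
    rw [← Function.iterate_add_apply] at h3
    exact absurd h3 (not_lt.2 (hle _))

/-- A periodic orbit in `[1 - 1/β, 1)`. -/
def HasPeriodicAbove (β : ℝ) : Prop :=
  ∃ (x : ℝ) (m : ℕ), 0 < m ∧ (betaMap β)^[m] x = x ∧ x ∈ forwardSet β (1 - 1 / β)

/-! ### Counting the pre-images of `1` along orbits that avoid the hole -/

/-- The map `x ↦ β x (mod 1)` with values below `t` raised to `t`. -/
noncomputable def clampMap (β t u : ℝ) : ℝ := max (betaMap β u) t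

/-- The action of the map with the hole `(0, t)` on tail functions `u ↦ ν [u, 1)`. -/
noncomputable def tailOp (β t : ℝ) (f : ℝ → ℝ) (u : ℝ) : ℝ :=
  f (clampMap β t u) + (if u < 1 / β then f t else 0) - f (clampMap β t 1)

/-- `tailCount β t n u` counts the points of `[u, 1)` whose orbit stays in `[t, 1)` for `n` steps
and arrives at (the left limit at) `1`. -/
noncomputable def tailCount (β t : ℝ) (n : ℕ) : ℝ → ℝ :=
  (tailOp β t)^[n] (fun u => if u < 1 then 1 else 0)

theorem tailCount_zero (β t : ℝ) : tailCount β t 0 = fun u => if u < 1 then 1 else 0 := rfl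

theorem tailCount_zero_apply (β t u : ℝ) : tailCount β t 0 u = if u < 1 then 1 else 0 := rfl

theorem tailCount_succ (β t : ℝ) (n : ℕ) :
    tailCount β t (n + 1) = tailOp β t (tailCount β t n) :=
  Function.iterate_succ_apply' _ _ _

theorem tailOp_of_lt {β t u : ℝ} (f : ℝ → ℝ) (h : u < 1 / β) :
    tailOp β t f u = f (clampMap β t u) + f t - f (clampMap β t 1) := by
  rw [tailOp, if_pos h]

theorem tailOp_of_le {β t u : ℝ} (f : ℝ → ℝ) (h : 1 / β ≤ u) :
    tailOp β t f u = f (clampMap β t u) - f (clampMap β t 1) := by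
  rw [tailOp, if_neg (not_lt.2 h), add_zero]

theorem clampMap_mem {β t : ℝ} (ht : t < 1) (u : ℝ) : clampMap β t u ∈ Ico t 1 :=
  ⟨le_max_right _ _, max_lt (betaMap_mem_Ico β u).2 ht⟩

theorem clampMap_mem_Icc {β t : ℝ} (ht : t < 1) (u : ℝ) : clampMap β t u ∈ Icc t 1 :=
  Ico_subset_Icc_self (clampMap_mem ht u)

theorem clampMap_le_of_lt {β t u v : ℝ} (hβ : 1 < β) (hu : 0 ≤ u) (huv : u ≤ v) (hv : v < 1 / β) :
    clampMap β t u ≤ clampMap β t v := by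
  rw [clampMap, clampMap, betaMap_of_lt hβ hu (huv.trans_lt hv),
    betaMap_of_lt hβ (hu.trans huv) hv]
  gcongr

theorem clampMap_le_of_le {β t u v : ℝ} (hβ : β ∈ Ioo (1 : ℝ) 2) (hu : 1 / β ≤ u) (huv : u ≤ v)
    (hv : v ≤ 1) : clampMap β t u ≤ clampMap β t v := by
  rw [clampMap, clampMap, betaMap_of_le hβ hu (huv.trans hv), betaMap_of_le hβ (hu.trans huv) hv]
  have := hβ.1
  gcongr

theorem clampMap_sub_le {β t u v : ℝ} (hb : betaMap β v - betaMap β u ≤ β * (v - u))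
    (h : 0 ≤ β * (v - u)) : clampMap β t v - clampMap β t u ≤ β * (v - u) := by
  rw [clampMap, clampMap]
  rcases le_total (betaMap β v) t with h1 | h1
  · rw [max_eq_right h1]; linarith [le_max_right (betaMap β u) t]
  · rw [max_eq_left h1]; linarith [le_max_left (betaMap β u) t]

/-- Tail functions: antitone on `[t, 1]` and zero at `1`. -/
structure IsTail (t : ℝ) (f : ℝ → ℝ) : Prop where
  anti : AntitoneOn f (Icc t 1)
  one : f 1 = 0

theorem IsTail.nonneg {t u : ℝ} {f : ℝ → ℝ} (hf : IsTail t f) (hu : u ∈ Icc t 1) : 0 ≤ f u := by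
  have := hf.anti hu ⟨hu.1.trans hu.2, le_rfl⟩ hu.2
  rwa [hf.one] at this

theorem IsTail.le {t u : ℝ} {f : ℝ → ℝ} (hf : IsTail t f) (hu : u ∈ Icc t 1) : f u ≤ f t :=
  hf.anti ⟨le_rfl, hu.1.trans hu.2⟩ hu hu.1

/-- Monotonicity can fail only across `1/β`, and there the extra term `f t` on the left dominates
every value of `f`. -/
theorem IsTail.tailOp {β t : ℝ} (hβ : β ∈ Ioo (1 : ℝ) 2) (ht : t ∈ Ico (0 : ℝ) 1) {f : ℝ → ℝ}
    (hf : IsTail t f) : IsTail t (tailOp β t f) where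
  one := by
    rw [tailOp_of_le _ (inv_lt_one_of hβ.1).le, sub_self]
  anti := by
    intro u hu v hv huv
    have hcu := clampMap_mem_Icc (β := β) ht.2 u
    have hcv := clampMap_mem_Icc (β := β) ht.2 v
    rcases lt_or_ge v (1 / β) with h | h
    · rw [tailOp_of_lt _ h, tailOp_of_lt _ (huv.trans_lt h)]
      have := hf.anti hcu hcv (clampMap_le_of_lt hβ.1 (ht.1.trans hu.1) huv h)
      linarith
    · rcases lt_or_ge u (1 / β) with h' | h'
      · rw [tailOp_of_le _ h, tailOp_of_lt _ h']
        linarith [hf.le hcv, hf.nonneg hcu]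
      · rw [tailOp_of_le _ h, tailOp_of_le _ h']
        have := hf.anti hcu hcv (clampMap_le_of_le hβ h' huv hv.2)
        linarith

theorem isTail_tailCount {β t : ℝ} (hβ : β ∈ Ioo (1 : ℝ) 2) (ht : t ∈ Ico (0 : ℝ) 1) (n : ℕ) :
    IsTail t (tailCount β t n) := by
  induction n with
  | zero =>
    rw [tailCount_zero]
    refine ⟨fun u _ v _ huv => ?_, by simp⟩
    split_ifs with h1 h2 h2
    · exact le_rfl
    · exact absurd (huv.trans_lt h1) h2
    · exact zero_le_one
    · exact le_rfl
  | succ n ih => rw [tailCount_succ]; exact ih.tailOp hβ ht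

/-- Short intervals carry few pre-images: each of the first `n` steps either expands the interval
or cuts off a part that falls into the hole. -/
theorem tailCount_sub_le {β t : ℝ} (hβ : β ∈ Ioo (1 : ℝ) 2) (ht : t ∈ Ico (0 : ℝ) 1) (m n : ℕ) :
    ∀ u ∈ Icc t 1, ∀ v ∈ Icc t 1, u ≤ v → v - u ≤ t * (1 / β) ^ n →
      tailCount β t (n + m) u - tailCount β t (n + m) v ≤ tailCount β t m t := by
  have hb0 : 0 < β := by linarith [hβ.1]
  induction n with
  | zero =>
    intro u hu v hv huv _
    have h := isTail_tailCount hβ ht (0 + m)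
    have h1 := h.nonneg hv
    have h2 := h.le hu
    rw [zero_add] at *
    linarith
  | succ n ih =>
    intro u hu v hv huv hd
    have hq := isTail_tailCount hβ ht (n + m)
    have hcu := clampMap_mem_Icc (β := β) ht.2 u
    have hcv := clampMap_mem_Icc (β := β) ht.2 v
    have hd' : β * (v - u) ≤ t * (1 / β) ^ n := by
      calc β * (v - u) ≤ β * (t * (1 / β) ^ (n + 1)) := by gcongr
        _ = t * (1 / β) ^ n := by rw [pow_succ]; field_simp
    have hnn : 0 ≤ β * (v - u) := mul_nonneg hb0.le (by linarith)
    rw [show n + 1 + m = (n + m) + 1 by ring, tailCount_succ]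
    rcases lt_or_ge v (1 / β) with h | h
    · rw [tailOp_of_lt _ h, tailOp_of_lt _ (huv.trans_lt h)]
      have hle := clampMap_le_of_lt (t := t) hβ.1 (ht.1.trans hu.1) huv h
      have hb : betaMap β v - betaMap β u ≤ β * (v - u) := by
        rw [betaMap_of_lt hβ.1 (ht.1.trans hv.1) h,
          betaMap_of_lt hβ.1 (ht.1.trans hu.1) (huv.trans_lt h)]
        linarith
      have := ih _ hcu _ hcv hle ((clampMap_sub_le hb hnn).trans hd')
      linarith
    · rcases lt_or_ge u (1 / β) with h' | h'
      · rw [tailOp_of_le _ h, tailOp_of_lt _ h']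
        have hp1 : (1 / β) ^ n ≤ 1 := pow_le_one₀ (by positivity) (inv_lt_one_of hβ.1).le
        have hone : β * (1 / β) = 1 := by field_simp
        -- The interval straddles `1/β`. The image of its right piece is shorter than the hole, so
        -- it is clamped to `t` and cancels the term `f t`; the left piece becomes an interval
        -- ending at `1`.
        have hv0 : clampMap β t v = t := by
          rw [clampMap, betaMap_of_le hβ h hv.2]
          refine max_eq_right ?_
          have : β * u ≤ 1 := by nlinarith
          nlinarith [ht.1]
        have hu1 : 1 - clampMap β t u ≤ t * (1 / β) ^ n := by
          have h1 : β * u ≤ clampMap β t u := by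
            rw [clampMap, betaMap_of_lt hβ.1 (ht.1.trans hu.1) h']; exact le_max_left _ _
          have : 1 ≤ β * v := by nlinarith
          nlinarith
        have := ih _ hcu 1 ⟨ht.2.le, le_rfl⟩ hcu.2 hu1
        rw [(hq.one)] at this
        rw [hv0]
        linarith
      · rw [tailOp_of_le _ h, tailOp_of_le _ h']
        have hle := clampMap_le_of_le (t := t) hβ h' huv hv.2
        have hb : betaMap β v - betaMap β u ≤ β * (v - u) := by
          rw [betaMap_of_le hβ h hv.2, betaMap_of_le hβ h' hu.2]; linarith
        have := ih _ hcu _ hcv hle ((clampMap_sub_le hb hnn).trans hd')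
        linarith

/-! ### Covering the survivors -/

theorem tailCount_one_sub {β t u v : ℝ} (ht : t ∈ Ico (0 : ℝ) 1) :
    tailCount β t 1 u - tailCount β t 1 v =
      (if u < 1 / β then 1 else 0) - if v < 1 / β then 1 else 0 := by
  have h (w : ℝ) : tailCount β t 1 w = if w < 1 / β then 1 else 0 := by
    rw [tailCount_succ, tailCount_zero, tailOp]
    simp [(clampMap_mem ht.2 w).2, (clampMap_mem ht.2 1).2, ht.2]
  rw [h, h]

theorem sum_tailCount_succ {β t : ℝ} (n : ℕ) (w : ℝ) :
    ∑ i ∈ Finset.range (n + 1), tailCount β t (i + 1) w =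
      (∑ i ∈ Finset.range n, tailCount β t (i + 1) (clampMap β t w)) +
      (if w < 1 / β then ∑ i ∈ Finset.range n, tailCount β t (i + 1) t else 0) -
      (∑ i ∈ Finset.range n, tailCount β t (i + 1) (clampMap β t 1)) + tailCount β t 1 w := by
  rw [Finset.sum_range_succ', add_left_inj]
  simp_rw [tailCount_succ β t (_ + 1), tailOp]
  rw [Finset.sum_sub_distrib, Finset.sum_add_distrib]
  congr 2
  split_ifs <;> simp

/-- Covers of the one-step image are pulled back. An interval needs one additional covering interval
exactly when it is cut at `1/β`; the increment of `tailCount β t 1` pays for that cut, and the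
higher counts for the later ones. -/
theorem exists_cover {β t : ℝ} (hβ : β ∈ Ioo (1 : ℝ) 2) (ht : t ∈ Ico (0 : ℝ) 1) (n : ℕ) :
    ∀ u ∈ Icc t 1, ∀ v ∈ Icc t 1, u ≤ v → ∃ S : Finset ℝ,
      (S.card : ℝ) ≤ 1 + (∑ i ∈ Finset.range n, tailCount β t (i + 1) u -
        ∑ i ∈ Finset.range n, tailCount β t (i + 1) v) ∧
      forwardSet β t ∩ Ico u v ⊆ ⋃ s ∈ S, Icc s (s + (1 / β) ^ n) := by
  have hb0 : 0 < β := by linarith [hβ.1]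
  -- The inverse branch with digit `d` contracts by `1/β`, turning a cover at scale `n` into one at
  -- scale `n + 1`.
  have hpull : ∀ (S : Finset ℝ) (d x : ℝ), β * x = d + betaMap β x → ∀ n : ℕ,
      betaMap β x ∈ ⋃ s ∈ S, Icc s (s + (1 / β) ^ n) →
      x ∈ ⋃ s ∈ S.image (fun s => (s + d) / β), Icc s (s + (1 / β) ^ (n + 1)) := by
    intro S d x hx n h
    simp only [mem_iUnion, mem_Icc, exists_prop] at h ⊢
    obtain ⟨s, hs, h1, h2⟩ := h
    have hx' : x = (betaMap β x + d) / β := by field_simp; linarith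
    refine ⟨(s + d) / β, Finset.mem_image_of_mem _ hs, ?_, ?_⟩
    · rw [hx']; gcongr
    · have : (s + d) / β + (1 / β) ^ (n + 1) = (s + (1 / β) ^ n + d) / β := by
        rw [pow_succ]; field_simp; ring
      rw [this, hx']; gcongr
  induction n with
  | zero =>
    intro u hu v hv huv
    refine ⟨{u}, by simp, ?_⟩
    rintro x ⟨_, hx⟩
    simp only [Finset.mem_singleton, iUnion_iUnion_eq_left, pow_zero, mem_Icc]
    exact ⟨hx.1, by linarith [hx.2, hv.2, hu.1, ht.1]⟩
  | succ n ih =>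
    intro u hu v hv huv
    have hcu := clampMap_mem_Icc (β := β) ht.2 u
    have hcv := clampMap_mem_Icc (β := β) ht.2 v
    have hone := tailCount_one_sub (β := β) (u := u) (v := v) ht
    have key := sum_tailCount_succ (β := β) (t := t) n
    rcases lt_or_ge v (1 / β) with h | h
    · have hu' := huv.trans_lt h
      obtain ⟨S, hS, hcov⟩ := ih _ hcu _ hcv (clampMap_le_of_lt hβ.1 (ht.1.trans hu.1) huv h)
      refine ⟨S.image (fun s => (s + 0) / β), ?_, ?_⟩
      · refine (Nat.cast_le.2 Finset.card_image_le).trans (hS.trans ?_)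
        rw [key u, key v]
        simp only [h, hu', if_true] at hone ⊢
        linarith
      · rintro x ⟨hxA, hx1, hx2⟩
        have hb := betaMap_of_lt hβ.1 (ht.1.trans (hu.1.trans hx1)) (hx2.trans h)
        refine hpull S 0 x (by rw [hb]; ring) n (hcov ⟨betaMap_mem_forwardSet hxA, ?_, ?_⟩)
        · refine max_le ?_ (betaMap_mem_forwardSet hxA 0).1
          rw [hb, betaMap_of_lt hβ.1 (ht.1.trans hu.1) hu']; gcongr
        · refine lt_of_lt_of_le ?_ (le_max_left _ _)
          rw [hb, betaMap_of_lt hβ.1 (ht.1.trans hv.1) h]; gcongr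
    · rcases lt_or_ge u (1 / β) with h' | h'
      · obtain ⟨S, hS, hcov⟩ := ih _ hcu 1 ⟨ht.2.le, le_rfl⟩ hcu.2
        obtain ⟨S', hS', hcov'⟩ := ih t ⟨le_rfl, ht.2.le⟩ _ hcv hcv.1
        refine ⟨S.image (fun s => (s + 0) / β) ∪ S'.image (fun s => (s + 1) / β), ?_, ?_⟩
        · have h1 : ((S.image (fun s => (s + 0) / β) ∪ S'.image (fun s => (s + 1) / β)).card : ℝ)
              ≤ S.card + S'.card := by
            exact_mod_cast (Finset.card_union_le _ _).trans
              (add_le_add Finset.card_image_le Finset.card_image_le)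
          refine h1.trans ((add_le_add hS hS').trans ?_)
          have hz : ∑ i ∈ Finset.range n, tailCount β t (i + 1) 1 = 0 :=
            Finset.sum_eq_zero fun i _ => (isTail_tailCount hβ ht _).one
          rw [key u, key v, hz]
          simp only [h', not_lt.2 h, if_true, if_false] at hone ⊢
          linarith
        · rintro x ⟨hxA, hx1, hx2⟩
          have hA := betaMap_mem_forwardSet hxA
          simp only [Finset.mem_union, iUnion_or, iUnion_union_distrib]
          rcases lt_or_ge x (1 / β) with hx | hx
          · have hb := betaMap_of_lt hβ.1 (ht.1.trans (hu.1.trans hx1)) hx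
            refine Or.inl (hpull S 0 x (by rw [hb]; ring) n (hcov ⟨hA, ?_, (hA 0).2⟩))
            refine max_le ?_ (hA 0).1
            rw [hb, betaMap_of_lt hβ.1 (ht.1.trans hu.1) h']; gcongr
          · have hb := betaMap_of_le hβ hx (hx2.le.trans hv.2)
            refine Or.inr (hpull S' 1 x (by rw [hb]; ring) n (hcov' ⟨hA, (hA 0).1, ?_⟩))
            refine lt_of_lt_of_le ?_ (le_max_left _ _)
            rw [hb, betaMap_of_le hβ h hv.2]; gcongr
      · obtain ⟨S, hS, hcov⟩ := ih _ hcu _ hcv (clampMap_le_of_le hβ h' huv hv.2)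
        refine ⟨S.image (fun s => (s + 1) / β), ?_, ?_⟩
        · refine (Nat.cast_le.2 Finset.card_image_le).trans (hS.trans ?_)
          rw [key u, key v]
          simp only [not_lt.2 h, not_lt.2 h', if_false] at hone ⊢
          linarith
        · rintro x ⟨hxA, hx1, hx2⟩
          have hb := betaMap_of_le hβ (h'.trans hx1) (hx2.le.trans hv.2)
          refine hpull S 1 x (by rw [hb]; ring) n (hcov ⟨betaMap_mem_forwardSet hxA, ?_, ?_⟩)
          · refine max_le ?_ (betaMap_mem_forwardSet hxA 0).1
            rw [hb, betaMap_of_le hβ h' hu.2]; gcongr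
          · refine lt_of_lt_of_le ?_ (le_max_left _ _)
            rw [hb, betaMap_of_le hβ h hv.2]; gcongr

/-! ### The dimension of the survivor set vanishes when the counts grow subexponentially -/

/-- Taking `z = b ^ d` bounds the `d`-dimensional sums of the covers by `C`, so the `d`-dimensional
Hausdorff measure is finite for every `d > 0`. -/
theorem dimH_eq_zero_of_covers {b : ℝ} (hb : b ∈ Ioo (0 : ℝ) 1) {A : Set ℝ}
    (h : ∀ z ∈ Ioo (0 : ℝ) 1, ∃ C : ℝ, ∀ n : ℕ, ∃ S : Finset ℝ,
      (S.card : ℝ) * z ^ n ≤ C ∧ A ⊆ ⋃ s ∈ S, Icc s (s + b ^ n)) :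
    dimH A = 0 := by
  have key : ∀ d : ℝ≥0, 0 < d → dimH A ≤ d := by
    intro d hd
    refine dimH_le_of_hausdorffMeasure_ne_top ?_
    have hz : b ^ (d : ℝ) ∈ Ioo (0 : ℝ) 1 :=
      ⟨Real.rpow_pos_of_pos hb.1 _, Real.rpow_lt_one hb.1.le hb.2 (by exact_mod_cast hd)⟩
    obtain ⟨C, hC⟩ := h _ hz
    choose S hS hcov using hC
    have hdiam : ∀ (n : ℕ) (s : S n), Metric.ediam (Icc (s : ℝ) (s + b ^ n)) =
        ENNReal.ofReal (b ^ n) := fun n s => by rw [Real.ediam_Icc]; congr 1; ring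
    have hlim : Tendsto (fun n : ℕ => ENNReal.ofReal (b ^ n)) atTop (𝓝 0) := by
      rw [← ENNReal.ofReal_zero]
      exact ENNReal.tendsto_ofReal (tendsto_pow_atTop_nhds_zero_of_lt_one hb.1.le hb.2)
    have hle := Measure.hausdorffMeasure_le_liminf_sum (X := ℝ) (d : ℝ) A
      (fun n : ℕ => ENNReal.ofReal (b ^ n)) hlim (fun n (s : S n) => Icc (s : ℝ) (s + b ^ n))
      (Eventually.of_forall fun n s => (hdiam n s).le)
      (Eventually.of_forall fun n => by
        refine (hcov n).trans (iUnion₂_subset fun s hs => ?_)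
        exact subset_iUnion (fun s : S n => Icc (s : ℝ) (s + b ^ n)) ⟨s, hs⟩)
    refine ne_of_lt (hle.trans_lt (lt_of_le_of_lt (b := ENNReal.ofReal C) ?_ ENNReal.ofReal_lt_top))
    refine liminf_le_of_frequently_le' (Frequently.of_forall fun n => ?_)
    simp only [hdiam, Finset.sum_const, Finset.card_univ, Fintype.card_coe, nsmul_eq_mul]
    rw [ENNReal.ofReal_rpow_of_pos (pow_pos hb.1 n), ← ENNReal.ofReal_natCast,
      ← ENNReal.ofReal_mul (Nat.cast_nonneg _)]
    refine ENNReal.ofReal_le_ofReal (le_trans (le_of_eq ?_) (hS n))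
    rw [← Real.rpow_natCast b n, ← Real.rpow_mul hb.1.le, mul_comm (n : ℝ), Real.rpow_mul hb.1.le,
      Real.rpow_natCast]
  refine le_antisymm (ENNReal.le_of_forall_pos_le_add fun ε hε _ => ?_) zero_le
  simpa using key ε hε

theorem dimH_forwardSet_eq_zero {β t : ℝ} (hβ : β ∈ Ioo (1 : ℝ) 2) (ht : t ∈ Ico (0 : ℝ) 1)
    (h : ∀ z ∈ Ioo (0 : ℝ) 1, Summable fun n => z ^ n * tailCount β t n t) :
    dimH (forwardSet β t) = 0 := by
  have hb0 : 0 < β := by linarith [hβ.1]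
  refine dimH_eq_zero_of_covers (b := 1 / β) ⟨by positivity, inv_lt_one_of hβ.1⟩ fun z hz => ?_
  have hnn : ∀ n, 0 ≤ tailCount β t n t := fun n =>
    (isTail_tailCount hβ ht n).nonneg ⟨le_rfl, ht.2.le⟩
  refine ⟨1 + (∑' n, z ^ n * tailCount β t n t) / z, fun n => ?_⟩
  obtain ⟨S, hS, hcov⟩ := exists_cover hβ ht n t ⟨le_rfl, ht.2.le⟩ 1 ⟨ht.2.le, le_rfl⟩ ht.2.le
  refine ⟨S, ?_, fun x hx => hcov ⟨hx, hx 0⟩⟩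
  have hz0 : ∑ i ∈ Finset.range n, tailCount β t (i + 1) 1 = 0 :=
    Finset.sum_eq_zero fun i _ => (isTail_tailCount hβ ht _).one
  rw [hz0, sub_zero] at hS
  -- Since `z < 1`, the power `z ^ (n + 1)` is at most each `z ^ (i + 1)`, so the covering numbers
  -- weighted by `z ^ n` stay below a multiple of the generating series.
  have h1 : (∑ i ∈ Finset.range n, tailCount β t (i + 1) t) * z ^ n * z ≤
      ∑' n, z ^ n * tailCount β t n t := by
    calc (∑ i ∈ Finset.range n, tailCount β t (i + 1) t) * z ^ n * z
        = ∑ i ∈ Finset.range n, z ^ (n + 1) * tailCount β t (i + 1) t := by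
          rw [mul_assoc, ← pow_succ, mul_comm, Finset.mul_sum]
      _ ≤ ∑ i ∈ Finset.range n, z ^ (i + 1) * tailCount β t (i + 1) t := by
          refine Finset.sum_le_sum fun i hi => mul_le_mul_of_nonneg_right ?_ (hnn _)
          exact pow_le_pow_of_le_one hz.1.le hz.2.le (by have := Finset.mem_range.1 hi; omega)
      _ ≤ ∑ i ∈ Finset.range (n + 1), z ^ i * tailCount β t i t := by
          rw [Finset.sum_range_succ']
          have := mul_nonneg (pow_nonneg hz.1.le 0) (hnn 0)
          linarith
      _ ≤ _ := (h z hz).sum_le_tsum _ fun i _ => mul_nonneg (pow_nonneg hz.1.le _) (hnn i)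
  have h2 : (∑ i ∈ Finset.range n, tailCount β t (i + 1) t) * z ^ n ≤
      (∑' n, z ^ n * tailCount β t n t) / z := by rwa [le_div_iff₀ hz.1]
  have hp0 : 0 ≤ z ^ n := pow_nonneg hz.1.le n
  calc (S.card : ℝ) * z ^ n
      ≤ (1 + ∑ i ∈ Finset.range n, tailCount β t (i + 1) t) * z ^ n := by gcongr
    _ = z ^ n + (∑ i ∈ Finset.range n, tailCount β t (i + 1) t) * z ^ n := by ring
    _ ≤ _ := add_le_add (pow_le_one₀ hz.1.le hz.2.le) h2

/-! ### The dimension of the survivor set is positive when the counts grow exponentially -/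

/-- A function on `[t, 1]` that loses at most the factor `z` for every factor `b` of closeness is
Hölder continuous. -/
theorem holderOnWith_of_geometric {t b z : ℝ} (ht : t ∈ Ioo (0 : ℝ) 1) (hb : b ∈ Ioo (0 : ℝ) 1)
    (hz : z ∈ Ioo (0 : ℝ) 1) {F : ℝ → ℝ} (hF : ∀ u ∈ Icc t 1, F u ∈ Icc (0 : ℝ) 1)
    (h : ∀ n : ℕ, ∀ u ∈ Icc t 1, ∀ v ∈ Icc t 1, u ≤ v → v - u ≤ t * b ^ n →
      |F u - F v| ≤ z ^ n) :
    ∃ C r : ℝ≥0, 0 < r ∧ HolderOnWith C r F (Icc t 1) := by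
  -- The exponent is chosen so that `b ^ r = z`.
  set r : ℝ := Real.log z / Real.log b with hr
  have hlb : Real.log b < 0 := Real.log_neg hb.1 hb.2
  have hr0 : 0 < r := div_pos_of_neg_of_neg (Real.log_neg hz.1 hz.2) hlb
  have hbr : b ^ r = z := by
    rw [Real.rpow_def_of_pos hb.1, hr, mul_div_cancel₀ _ hlb.ne, Real.exp_log hz.1]
  have hreal : ∀ u ∈ Icc t 1, ∀ v ∈ Icc t 1, u < v →
      |F u - F v| ≤ z⁻¹ * (t ^ r)⁻¹ * (v - u) ^ r := by
    intro u hu v hv huv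
    have hd : 0 < (v - u) / t := div_pos (by linarith) ht.1
    have heq : z⁻¹ * (t ^ r)⁻¹ * (v - u) ^ r = z⁻¹ * ((v - u) / t) ^ r := by
      rw [Real.div_rpow (by linarith) ht.1.le]; ring
    rw [heq]
    have hz1 : 1 ≤ z⁻¹ := (one_le_inv₀ hz.1).2 hz.2.le
    rcases le_or_gt ((v - u) / t) 1 with h1 | h1
    · obtain ⟨n, hn1, hn2⟩ := exists_nat_pow_near_of_lt_one hd h1 hb.1 hb.2
      have hn3 : v - u ≤ t * b ^ n := by rwa [div_le_iff₀ ht.1, mul_comm] at hn2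
      refine (h n u hu v hv huv.le hn3).trans ?_
      have h4 : (b ^ (n + 1)) ^ r ≤ ((v - u) / t) ^ r :=
        Real.rpow_le_rpow (pow_nonneg hb.1.le _) hn1.le hr0.le
      have h5 : (b ^ (n + 1)) ^ r = z ^ (n + 1) := by
        rw [← Real.rpow_natCast b, ← Real.rpow_mul hb.1.le, mul_comm, Real.rpow_mul hb.1.le, hbr,
          Real.rpow_natCast]
      calc z ^ n = z⁻¹ * z ^ (n + 1) := by rw [pow_succ]; field_simp [hz.1.ne']
        _ ≤ _ := by rw [← h5]; gcongr
    · have h2 : 1 ≤ ((v - u) / t) ^ r := Real.one_le_rpow h1.le hr0.le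
      have h3 : |F u - F v| ≤ 1 := by
        rw [abs_le]; constructor <;> linarith [(hF u hu).1, (hF u hu).2, (hF v hv).1, (hF v hv).2]
      nlinarith
  have hC : 0 ≤ z⁻¹ * (t ^ r)⁻¹ := by
    have := hz.1; have := ht.1; positivity
  refine ⟨Real.toNNReal (z⁻¹ * (t ^ r)⁻¹), Real.toNNReal r, Real.toNNReal_pos.2 hr0, ?_⟩
  have hsymm : ∀ u ∈ Icc t 1, ∀ v ∈ Icc t 1, |F u - F v| ≤ z⁻¹ * (t ^ r)⁻¹ * |u - v| ^ r := by
    intro u hu v hv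
    rcases lt_trichotomy u v with hlt | rfl | hlt
    · have := hreal u hu v hv hlt
      rwa [abs_sub_comm u v, abs_of_pos (sub_pos.2 hlt)]
    · simp [Real.zero_rpow hr0.ne']
    · have := hreal v hv u hu hlt
      rwa [abs_sub_comm (F u), abs_of_pos (sub_pos.2 hlt)]
  intro u hu v hv
  rw [edist_dist, edist_dist, Real.dist_eq, Real.dist_eq, Real.coe_toNNReal r hr0.le,
    ENNReal.ofReal_rpow_of_nonneg (abs_nonneg _) hr0.le]
  change _ ≤ ENNReal.ofReal _ * _
  rw [← ENNReal.ofReal_mul hC]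
  exact ENNReal.ofReal_le_ofReal (hsymm u hu v hv)

/-- A Hölder function that maps `[t, 1]` onto `[0, 1]` and is constant to the right of every point
outside `K` forces `K` to have positive dimension. -/
theorem dimH_pos_of_holder {t : ℝ} (ht : t < 1) {K : Set ℝ} {F : ℝ → ℝ} {C r : ℝ≥0}
    (hr : 0 < r) (hF : HolderOnWith C r F (Icc t 1)) (h0 : F 1 = 0) (h1 : F t = 1)
    (hloc : ∀ u ∈ Ico t 1, u ∉ K → ∀ᶠ v in 𝓝[≥] u, F v = F u) : 0 < dimH K := by
  -- A value taken outside `K` is also taken at a rational point just to the right, or at `1`, so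
  -- such values are countable.
  have hsub : Icc (0 : ℝ) 1 ⊆ F '' (K ∩ Icc t 1) ∪ F '' range ((↑) : ℚ → ℝ) := by
    intro y hy
    have hiv := intermediate_value_Icc' ht.le (hF.continuousOn hr)
    rw [h0, h1] at hiv
    obtain ⟨u, hu, rfl⟩ := hiv hy
    by_cases huK : u ∈ K
    · exact Or.inl ⟨u, ⟨huK, hu⟩, rfl⟩
    · right
      rcases hu.2.lt_or_eq with hlt | rfl
      · obtain ⟨w, hw, hsub⟩ := mem_nhdsGE_iff_exists_Ico_subset.1 (hloc u ⟨hu.1, hlt⟩ huK)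
        obtain ⟨x, hx1, hx2⟩ := exists_rat_btwn (show u < w from hw)
        exact ⟨x, ⟨x, rfl⟩, hsub ⟨hx1.le, hx2⟩⟩
      · exact ⟨1, ⟨1, by simp⟩, rfl⟩
  have hone : (1 : ℝ≥0∞) ≤ dimH (F '' (K ∩ Icc t 1)) := by
    have h2 := dimH_mono hsub
    rw [dimH_union, ((countable_range _).image F).dimH_zero,
      Real.dimH_of_nonempty_interior (by rw [interior_Icc]; exact nonempty_Ioo.2 zero_lt_one)] at h2
    simpa using h2
  have h3 := (hF.mono (inter_subset_right (s := K))).dimH_image_le hr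
  by_contra h4
  have h5 : dimH (K ∩ Icc t 1) = 0 :=
    le_antisymm ((dimH_mono inter_subset_left).trans (not_lt.1 h4)) zero_le
  rw [h5, ENNReal.zero_div] at h3
  exact absurd (hone.trans h3) (by simp)

theorem eventually_lt_iff_right {a u : ℝ} : ∀ᶠ v in 𝓝[≥] u, (v < a ↔ u < a) := by
  rcases lt_or_ge u a with h | h
  · filter_upwards [Ico_mem_nhdsGE h] with v hv
    exact iff_of_true hv.2 h
  · filter_upwards [self_mem_nhdsWithin] with v hv
    exact iff_of_false (not_lt.2 (h.trans hv)) (not_lt.2 h)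

/-- Just to the right of a point that falls into the hole all counts are eventually the same. -/
theorem tailCount_eventually_eq {β t : ℝ} (hβ : 0 < β) (n : ℕ) :
    ∀ u ∈ Ico t 1, (betaMap β)^[n] u < t →
      ∀ᶠ v in 𝓝[≥] u, ∀ m, n ≤ m → tailCount β t m v = tailCount β t m u := by
  induction n with
  | zero => intro u hu h; exact absurd h (not_lt.2 hu.1)
  | succ n ih =>
    intro u hu h
    have hdig := eventually_lt_iff_right (a := 1 / β) (u := u)
    have hstep : ∀ v, (v < 1 / β ↔ u < 1 / β) → (∀ m, n ≤ m →
        tailCount β t m (clampMap β t v) = tailCount β t m (clampMap β t u)) →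
        ∀ m, n + 1 ≤ m → tailCount β t m v = tailCount β t m u := by
      intro v hv heq m hm
      obtain ⟨k, rfl⟩ : ∃ k, m = k + 1 := ⟨m - 1, by omega⟩
      rw [tailCount_succ, tailOp, tailOp, heq k (by omega)]
      simp only [hv]
    rcases lt_or_ge (betaMap β u) t with hlt | hge
    · have hev := (tendsto_betaMap hβ u).mono_right nhdsWithin_le_nhds |>.eventually
        (gt_mem_nhds hlt)
      filter_upwards [hdig, hev] with v hv hv2
      refine hstep v hv fun m _ => ?_
      rw [clampMap, clampMap, max_eq_right hlt.le, max_eq_right (le_of_lt hv2)]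
    · have hih := (tendsto_betaMap hβ u).eventually
        (ih _ ⟨hge, (betaMap_mem_Ico β u).2⟩ (by rwa [← Function.iterate_succ_apply]))
      have hge2 := (tendsto_betaMap hβ u).eventually self_mem_nhdsWithin
      filter_upwards [hdig, hih, hge2] with v hv hv2 hv3
      refine hstep v hv fun m hm => ?_
      rw [clampMap, clampMap, max_eq_left hge, max_eq_left (hge.trans hv3)]
      exact hv2 m hm

/-- The Hölder function is the limit of `S u M / S t M`, the partial generating series normalised by
its value at `t`. Divergence of the denominator makes any finite number of terms negligible. -/
theorem dimH_survivorSet_pos {β t z : ℝ} (hβ : β ∈ Ioo (1 : ℝ) 2) (ht : t ∈ Ioo (0 : ℝ) 1)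
    (hz : z ∈ Ioo (0 : ℝ) 1) (h : ¬ Summable fun n => z ^ n * tailCount β t n t) :
    0 < dimH (survivorSet β t) := by
  have hb0 : 0 < β := by linarith [hβ.1]
  have ht' : t ∈ Ico (0 : ℝ) 1 := ⟨ht.1.le, ht.2⟩
  have htt : t ∈ Icc t 1 := ⟨le_rfl, ht.2.le⟩
  have hq := isTail_tailCount hβ ht'
  set S : ℝ → ℕ → ℝ := fun u M => ∑ m ∈ Finset.range M, z ^ m * tailCount β t m u with hS
  have hterm : ∀ m, 0 ≤ z ^ m * tailCount β t m t := fun m =>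
    mul_nonneg (pow_nonneg hz.1.le m) ((hq m).nonneg htt)
  have htop : Tendsto (S t) atTop atTop := by
    by_contra hcon
    exact h ((summable_iff_not_tendsto_nat_atTop_of_nonneg hterm).2 hcon)
  have hmono : Monotone (S t) := fun a b hab =>
    Finset.sum_le_sum_of_subset_of_nonneg (Finset.range_mono hab) fun i _ _ => hterm i
  have hbound : ∀ u ∈ Icc t 1, ∀ᶠ M in hyperfilter ℕ, S u M / S t M ∈ Icc (0 : ℝ) 1 := by
    intro u hu
    refine Nat.hyperfilter_le_atTop ?_
    filter_upwards [htop.eventually_gt_atTop 0] with M hM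
    refine ⟨div_nonneg (Finset.sum_nonneg fun m _ => ?_) hM.le, (div_le_one hM).2 ?_⟩
    · exact mul_nonneg (pow_nonneg hz.1.le m) ((hq m).nonneg hu)
    · exact Finset.sum_le_sum fun m _ =>
        mul_le_mul_of_nonneg_left ((hq m).le hu) (pow_nonneg hz.1.le m)
  -- A non-principal ultrafilter supplies the limits for all `u` at once; the ratios need not
  -- converge along the natural numbers.
  have hex : ∀ u ∈ Icc t 1, ∃ y ∈ Icc (0 : ℝ) 1,
      Tendsto (fun M => S u M / S t M) (hyperfilter ℕ) (𝓝 y) := by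
    intro u hu
    exact isCompact_Icc.ultrafilter_le_nhds ((hyperfilter ℕ).map fun M => S u M / S t M)
      (le_principal_iff.2 (hbound u hu))
  choose! F hF01 hF using hex
  have hone : F 1 = 0 := by
    refine tendsto_nhds_unique (hF 1 ⟨ht.2.le, le_rfl⟩) ?_
    have : (fun M => S 1 M / S t M) = fun _ => 0 := by
      funext M
      simp [hS, (hq _).one]
    rw [this]; exact tendsto_const_nhds
  have htone : F t = 1 := by
    refine tendsto_nhds_unique (hF t htt) (tendsto_const_nhds.congr' ?_)
    refine Nat.hyperfilter_le_atTop ?_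
    filter_upwards [htop.eventually_gt_atTop 0] with M hM
    rw [div_self hM.ne']
  have hanti : ∀ u ∈ Icc t 1, ∀ v ∈ Icc t 1, u ≤ v → F v ≤ F u := by
    intro u hu v hv huv
    refine le_of_tendsto_of_tendsto (hF v hv) (hF u hu) (Nat.hyperfilter_le_atTop ?_)
    filter_upwards [htop.eventually_gt_atTop 0] with M hM
    refine div_le_div_of_nonneg_right (Finset.sum_le_sum fun m _ => ?_) hM.le
    exact mul_le_mul_of_nonneg_left ((hq m).anti hu hv huv) (pow_nonneg hz.1.le m)
  -- For points within `t * (1 / β) ^ n`, the first `n` terms vanish in the limit, and the later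
  -- ones are bounded by `tailCount_sub_le`, shifted by `n`, which costs the factor `z ^ n`.
  have hgeo : ∀ n : ℕ, ∀ u ∈ Icc t 1, ∀ v ∈ Icc t 1, u ≤ v → v - u ≤ t * (1 / β) ^ n →
      |F u - F v| ≤ z ^ n := by
    intro n u hu v hv huv hd
    rw [abs_of_nonneg (sub_nonneg.2 (hanti u hu v hv huv))]
    have hlim : Tendsto (fun M => S t n / S t M + z ^ n) (hyperfilter ℕ) (𝓝 (0 + z ^ n)) :=
      ((tendsto_const_nhds.div_atTop htop).add_const _).mono_left Nat.hyperfilter_le_atTop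
    rw [zero_add] at hlim
    refine le_of_tendsto_of_tendsto ((hF u hu).sub (hF v hv)) hlim (Nat.hyperfilter_le_atTop ?_)
    filter_upwards [htop.eventually_gt_atTop 0, eventually_ge_atTop n] with M hM hnM
    obtain ⟨k, rfl⟩ := Nat.exists_eq_add_of_le hnM
    change S u (n + k) / S t (n + k) - S v (n + k) / S t (n + k) ≤ S t n / S t (n + k) + z ^ n
    rw [← sub_div, div_add' _ _ _ hM.ne']
    refine div_le_div_of_nonneg_right ?_ hM.le
    have h1 : S u (n + k) - S v (n + k) =
        ∑ m ∈ Finset.range (n + k), z ^ m * (tailCount β t m u - tailCount β t m v) := by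
      simp only [hS, ← Finset.sum_sub_distrib, mul_sub]
    rw [h1, Finset.sum_range_add]
    refine add_le_add (Finset.sum_le_sum fun m _ => ?_) ?_
    · refine mul_le_mul_of_nonneg_left ?_ (pow_nonneg hz.1.le m)
      linarith [(hq m).nonneg hv, (hq m).le hu]
    · calc ∑ m ∈ Finset.range k, z ^ (n + m) * (tailCount β t (n + m) u - tailCount β t (n + m) v)
          ≤ ∑ m ∈ Finset.range k, z ^ n * (z ^ m * tailCount β t m t) := by
            refine Finset.sum_le_sum fun m _ => ?_
            rw [pow_add, mul_assoc]
            have := pow_nonneg hz.1.le n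
            have := pow_nonneg hz.1.le m
            gcongr
            exact tailCount_sub_le hβ ht' m n u hu v hv huv hd
        _ = z ^ n * S t k := by rw [← Finset.mul_sum]
        _ ≤ z ^ n * S t (n + k) :=
            mul_le_mul_of_nonneg_left (hmono (by omega)) (pow_nonneg hz.1.le n)
  obtain ⟨C, r, hr, hH⟩ := holderOnWith_of_geometric ht ⟨by positivity, inv_lt_one_of hβ.1⟩ hz hF01
    hgeo
  refine dimH_pos_of_holder ht.2 hr hH hone htone fun u hu huK => ?_
  obtain ⟨n, hn⟩ : ∃ n, (betaMap β)^[n] u ∈ Ioo 0 t := by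
    by_contra hcon
    exact huK ⟨⟨ht.1.le.trans hu.1, hu.2⟩, not_exists.1 hcon⟩
  filter_upwards [tailCount_eventually_eq hb0 n u hu hn.2, Ico_mem_nhdsGE hu.2] with v hv hv2
  have hvI : v ∈ Icc t 1 := ⟨hu.1.trans hv2.1, hv2.2.le⟩
  have huI : u ∈ Icc t 1 := ⟨hu.1, hu.2.le⟩
  -- The terms from order `n` on agree at `u` and `v`, so the numerator of the difference is
  -- eventually constant while the denominator diverges.
  have hlim : Tendsto (fun M => S v M / S t M - S u M / S t M) (hyperfilter ℕ) (𝓝 0) := by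
    refine Tendsto.mono_left ?_ Nat.hyperfilter_le_atTop
    refine (tendsto_const_nhds (x := S v n - S u n)).div_atTop htop |>.congr' ?_
    filter_upwards [eventually_ge_atTop n] with M hnM
    obtain ⟨k, rfl⟩ := Nat.exists_eq_add_of_le hnM
    rw [← sub_div]
    congr 1
    simp only [hS]
    rw [Finset.sum_range_add, Finset.sum_range_add]
    have : ∑ x ∈ Finset.range k, z ^ (n + x) * tailCount β t (n + x) v =
        ∑ x ∈ Finset.range k, z ^ (n + x) * tailCount β t (n + x) u :=
      Finset.sum_congr rfl fun x _ => by rw [hv (n + x) (by omega)]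
    rw [this]; ring
  exact sub_eq_zero.1 (tendsto_nhds_unique ((hF v hvI).sub (hF u huI)) hlim)

/-! ### The kneading function -/

/-- The power series that marks the visits to `[0, 1/β)` of the orbit of `u` under `clampMap`. -/
noncomputable def visitSeries (β t u z : ℝ) : ℝ :=
  ∑' i : ℕ, (if (clampMap β t)^[i] u < 1 / β then 1 else 0) * z ^ i

/-- The kneading function of the map with the hole `(0, t)`. -/
noncomputable def kneading (β t z : ℝ) : ℝ :=
  1 - z * visitSeries β t t z + z ^ 2 * visitSeries β t (clampMap β t 1) z

theorem summable_indicator_mul_pow (p : ℕ → Prop) [DecidablePred p] {z : ℝ}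
    (hz : z ∈ Ico (0 : ℝ) 1) : Summable fun i : ℕ => (if p i then 1 else 0) * z ^ i := by
  refine Summable.of_nonneg_of_le (fun i => ?_) (fun i => ?_)
    (summable_geometric_of_lt_one hz.1 hz.2)
  · have := pow_nonneg hz.1 i
    split_ifs <;> simp [this]
  · have := pow_nonneg hz.1 i
    split_ifs <;> simp [this]

theorem visitSeries_step {β t u z : ℝ} (hz : z ∈ Ico (0 : ℝ) 1) :
    visitSeries β t u z =
      (if u < 1 / β then 1 else 0) + z * visitSeries β t (clampMap β t u) z := by
  rw [visitSeries, (summable_indicator_mul_pow _ hz).tsum_eq_zero_add, visitSeries, ← tsum_mul_left]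
  simp only [Function.iterate_zero, id, pow_zero, mul_one, Function.iterate_succ,
    Function.comp_apply, pow_succ]
  congr 2
  funext i
  rw [mul_comm (z ^ i), mul_left_comm]
  congr

theorem visitSeries_mem {β t u z : ℝ} (hz : z ∈ Ico (0 : ℝ) 1) :
    visitSeries β t u z ∈ Icc 0 (1 - z)⁻¹ := by
  have h0 : ∀ i : ℕ, 0 ≤ z ^ i := fun i => pow_nonneg hz.1 i
  constructor
  · refine tsum_nonneg fun i => ?_
    split_ifs <;> simp [h0]
  · rw [← tsum_geometric_of_lt_one hz.1 hz.2]
    refine (summable_indicator_mul_pow _ hz).tsum_le_tsum (fun i => ?_)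
      (summable_geometric_of_lt_one hz.1 hz.2)
    split_ifs <;> simp [h0]

/-- The generating function `Q` satisfies a linear functional equation along orbits of `clampMap`.
With `K` chosen to absorb the constant terms, the defect `Q u - z Q(t) A(u) - K` is multiplied by
`z` at each step and is bounded, so it vanishes. Its vanishing at `t` and at the image of `1`
determines `Q t`. -/
theorem tsum_tailCount_mul_kneading {β t z : ℝ} (hβ : β ∈ Ioo (1 : ℝ) 2) (ht : t ∈ Ico (0 : ℝ) 1)
    (hz : z ∈ Ioo (0 : ℝ) 1) (h : Summable fun n => z ^ n * tailCount β t n t) :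
    (∑' n, z ^ n * tailCount β t n t) * kneading β t z = 1 := by
  have hz' : z ∈ Ico (0 : ℝ) 1 := ⟨hz.1.le, hz.2⟩
  have hq := isTail_tailCount hβ ht
  have hsum : ∀ u ∈ Icc t 1, Summable fun n => z ^ n * tailCount β t n u := fun u hu =>
    Summable.of_nonneg_of_le (fun n => mul_nonneg (pow_nonneg hz.1.le n) ((hq n).nonneg hu))
      (fun n => mul_le_mul_of_nonneg_left ((hq n).le hu) (pow_nonneg hz.1.le n)) h
  set Q : ℝ → ℝ := fun u => ∑' n, z ^ n * tailCount β t n u with hQ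
  have hQ0 : ∀ u ∈ Icc t 1, 0 ≤ Q u := fun u hu =>
    tsum_nonneg fun n => mul_nonneg (pow_nonneg hz.1.le n) ((hq n).nonneg hu)
  have hQt : ∀ u ∈ Icc t 1, Q u ≤ Q t := fun u hu =>
    (hsum u hu).tsum_le_tsum
      (fun n => mul_le_mul_of_nonneg_left ((hq n).le hu) (pow_nonneg hz.1.le n)) h
  have hg : ∀ u, clampMap β t u ∈ Icc t 1 := clampMap_mem_Icc ht.2
  set R := Q (clampMap β t 1)
  set A := visitSeries β t
  have hstep : ∀ u ∈ Ico t 1, Q u =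
      1 + z * (Q (clampMap β t u) + (if u < 1 / β then 1 else 0) * Q t - R) := by
    intro u hu
    have h1 := hsum u ⟨hu.1, hu.2.le⟩
    have h2 : Q u = z ^ 0 * tailCount β t 0 u + ∑' n, z ^ (n + 1) * tailCount β t (n + 1) u :=
      h1.tsum_eq_zero_add
    rw [h2, pow_zero, one_mul, tailCount_zero_apply, if_pos hu.2]
    congr 1
    have h3 : ∀ n, z ^ (n + 1) * tailCount β t (n + 1) u =
        z * (z ^ n * tailCount β t n (clampMap β t u) +
          (if u < 1 / β then 1 else 0) * (z ^ n * tailCount β t n t) -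
          z ^ n * tailCount β t n (clampMap β t 1)) := by
      intro n
      rw [tailCount_succ, tailOp, pow_succ]
      split_ifs <;> ring
    simp_rw [h3]
    rw [tsum_mul_left, (((hsum _ (hg u)).add (h.mul_left _))).tsum_sub (hsum _ (hg 1)),
      (hsum _ (hg u)).tsum_add (h.mul_left _), tsum_mul_left]
  set K := (1 - z * R) / (1 - z) with hK
  have hz1 : 1 - z ≠ 0 := by linarith [hz.2]
  have hKeq : K = (1 - z * R) + z * K := by rw [hK]; field_simp; ring
  have hD : ∀ u ∈ Ico t 1, Q u - z * Q t * A u z - K =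
      z * (Q (clampMap β t u) - z * Q t * A (clampMap β t u) z - K) := by
    intro u hu
    have h1 := hstep u hu
    have h2 : A u z = _ := visitSeries_step (β := β) (t := t) (u := u) hz'
    rw [h1, h2]
    linear_combination (-1 : ℝ) * hKeq
  have hzero : ∀ u ∈ Ico t 1, Q u - z * Q t * A u z - K = 0 := by
    intro u hu
    have hit : ∀ n : ℕ, (clampMap β t)^[n] u ∈ Ico t 1 ∧ Q u - z * Q t * A u z - K =
        z ^ n * (Q ((clampMap β t)^[n] u) - z * Q t * A ((clampMap β t)^[n] u) z - K) := by
      intro n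
      induction n with
      | zero => simpa using hu
      | succ n ih =>
        rw [Function.iterate_succ_apply', ih.2, hD _ ih.1, pow_succ]
        exact ⟨clampMap_mem ht.2 _, by ring⟩
    set B := Q t + z * Q t * (1 - z)⁻¹ + |K| with hB
    have hbd : ∀ v ∈ Ico t 1, |Q v - z * Q t * A v z - K| ≤ B := by
      intro v hv
      have hvI : v ∈ Icc t 1 := ⟨hv.1, hv.2.le⟩
      have hA := visitSeries_mem (β := β) (t := t) (u := v) hz'
      have h3 : 0 ≤ z * Q t := mul_nonneg hz.1.le (hQ0 t ⟨le_rfl, ht.2.le⟩)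
      have h4 := mul_nonneg h3 hA.1
      have h5 := mul_le_mul_of_nonneg_left hA.2 h3
      have h6 := hQ0 v hvI
      have h7 := hQt v hvI
      have h8 := neg_abs_le K
      have h9 := le_abs_self K
      rw [abs_le, hB]
      constructor <;> linarith
    have hlim : Tendsto (fun n : ℕ => z ^ n * B) atTop (𝓝 (0 * B)) :=
      (tendsto_pow_atTop_nhds_zero_of_lt_one hz.1.le hz.2).mul_const B
    rw [zero_mul] at hlim
    refine abs_nonpos_iff.1 (ge_of_tendsto' hlim fun n => ?_)
    rw [(hit n).2, abs_mul, abs_of_nonneg (pow_nonneg hz.1.le n)]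
    exact mul_le_mul_of_nonneg_left (hbd _ (hit n).1) (pow_nonneg hz.1.le n)
  have e1 := hzero t ⟨le_rfl, ht.2⟩
  have e2 : R - z * Q t * A (clampMap β t 1) z - K = 0 := hzero _ (clampMap_mem ht.2 1)
  change Q t * (1 - z * A t z + z ^ 2 * A (clampMap β t 1) z) = 1
  linear_combination e1 - z * e2 + hKeq

/-- When the parameter decreases to `t`, the points of clamped orbits approach their limits from the
right, the side on which the map and its digits are continuous. Hence each count is locally constant
from the right and the kneading function is right-continuous. -/
theorem tendsto_clampMap {β t a : ℝ} (hβ : 0 < β) {x : ℝ → ℝ}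
    (hx : Tendsto x (𝓝[≥] t) (𝓝[≥] a)) :
    Tendsto (fun s => clampMap β s (x s)) (𝓝[≥] t) (𝓝[≥] (clampMap β t a)) := by
  have h1 := (tendsto_betaMap hβ a).comp hx
  refine tendsto_nhdsWithin_of_tendsto_nhds_of_eventually_within _ ?_ ?_
  · exact (h1.mono_right nhdsWithin_le_nhds).max (tendsto_id.mono_left nhdsWithin_le_nhds)
  · filter_upwards [h1.eventually self_mem_nhdsWithin, self_mem_nhdsWithin] with s h2 h3
    exact max_le_max h2 h3

theorem tendsto_iterate_clampMap {β t a : ℝ} (hβ : 0 < β) {x : ℝ → ℝ}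
    (hx : Tendsto x (𝓝[≥] t) (𝓝[≥] a)) (n : ℕ) :
    Tendsto (fun s => (clampMap β s)^[n] (x s)) (𝓝[≥] t) (𝓝[≥] ((clampMap β t)^[n] a)) := by
  induction n with
  | zero => exact hx
  | succ n ih => simp only [Function.iterate_succ_apply']; exact tendsto_clampMap hβ ih

theorem eventually_tailCount_eq {β t : ℝ} (hβ : 0 < β) (n : ℕ) {a : ℝ} {x : ℝ → ℝ}
    (hx : Tendsto x (𝓝[≥] t) (𝓝[≥] a)) :
    ∀ᶠ s in 𝓝[≥] t, tailCount β s n (x s) = tailCount β t n a := by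
  have hconst : Tendsto (fun _ : ℝ => (1 : ℝ)) (𝓝[≥] t) (𝓝[≥] 1) :=
    tendsto_nhdsWithin_of_tendsto_nhds_of_eventually_within _ tendsto_const_nhds
      (Eventually.of_forall fun _ => self_mem_Ici)
  induction n generalizing a x with
  | zero =>
    filter_upwards [hx.eventually (eventually_lt_iff_right (a := 1))] with s hs
    simp only [tailCount_zero_apply, hs]
  | succ n ih =>
    filter_upwards [hx.eventually (eventually_lt_iff_right (a := 1 / β)),
      ih (tendsto_clampMap hβ hx),
      ih tendsto_id, ih (tendsto_clampMap hβ hconst)] with s h1 h2 h3 h4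
    rw [id] at h3
    rw [tailCount_succ, tailCount_succ, tailOp, tailOp, h2, h3, h4]
    simp only [h1]

theorem tendsto_visitSeries {β t z : ℝ} (hβ : 0 < β) (hz : z ∈ Ico (0 : ℝ) 1) {a : ℝ} {x : ℝ → ℝ}
    (hx : Tendsto x (𝓝[≥] t) (𝓝[≥] a)) :
    Tendsto (fun s => visitSeries β s (x s) z) (𝓝[≥] t) (𝓝 (visitSeries β t a z)) := by
  refine tendsto_tsum_of_dominated_convergence (summable_geometric_of_lt_one hz.1 hz.2)
    (fun i => ?_) (Eventually.of_forall fun s i => ?_)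
  · refine tendsto_const_nhds.congr' ?_
    filter_upwards [(tendsto_iterate_clampMap hβ hx i).eventually
      (eventually_lt_iff_right (a := 1 / β))] with s hs
    simp only [hs]
  · have := pow_nonneg hz.1 i
    split_ifs <;> simp [abs_of_nonneg, this, hz.1]

theorem tendsto_kneading {β t z : ℝ} (hβ : 0 < β) (hz : z ∈ Ico (0 : ℝ) 1) :
    Tendsto (fun s => kneading β s z) (𝓝[≥] t) (𝓝 (kneading β t z)) := by
  have hconst : Tendsto (fun _ : ℝ => (1 : ℝ)) (𝓝[≥] t) (𝓝[≥] 1) :=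
    tendsto_nhdsWithin_of_tendsto_nhds_of_eventually_within _ tendsto_const_nhds
      (Eventually.of_forall fun _ => self_mem_Ici)
  exact (tendsto_const_nhds.sub ((tendsto_visitSeries hβ hz tendsto_id).const_mul z)).add
    ((tendsto_visitSeries hβ hz (tendsto_clampMap hβ hconst)).const_mul (z ^ 2))

theorem analyticOnNhd_tsum_mul_pow {a : ℕ → ℝ} (ha : ∀ n, |a n| ≤ 1) :
    AnalyticOnNhd ℝ (fun z => ∑' n, a n * z ^ n) (Metric.ball 0 1) := by
  set p := FormalMultilinearSeries.ofScalars ℝ a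
  have hr : 1 ≤ p.radius := by
    refine p.le_radius_of_bound (r := 1) 1 fun n => ?_
    simpa [p, FormalMultilinearSeries.ofScalars_norm] using ha n
  have h := (p.hasFPowerSeriesOnBall (zero_lt_one.trans_le hr)).analyticOnNhd
  have h2 : AnalyticOnNhd ℝ p.sum (Metric.ball 0 1) := h.mono fun z hz => by
    rw [← Metric.eball_ofReal, ENNReal.ofReal_one] at hz
    exact Metric.eball_subset_eball hr hz
  refine h2.congr Metric.isOpen_ball fun z _ => ?_
  simp [p, FormalMultilinearSeries.sum, mul_comm]

/-- The kneading function is analytic on the unit ball and equals `1` at `0`, so it cannot vanish on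
an interval. -/
theorem kneading_ne_zero_on {β t z w : ℝ} (hz : 0 ≤ z) (hzw : z < w) (hw : w ≤ 1) :
    ∃ y ∈ Ioo z w, kneading β t y ≠ 0 := by
  by_contra! hcon
  have hvis : ∀ u, AnalyticOnNhd ℝ (visitSeries β t u) (Metric.ball 0 1) := fun u =>
    analyticOnNhd_tsum_mul_pow fun n => by split_ifs <;> simp
  have han : AnalyticOnNhd ℝ (kneading β t) (Metric.ball 0 1) :=
    (analyticOnNhd_const.sub (analyticOnNhd_id.mul (hvis _))).add
      ((analyticOnNhd_id.pow 2).mul (hvis _))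
  obtain ⟨m, hm1, hm2⟩ := exists_between hzw
  have hm : m ∈ Metric.ball (0 : ℝ) 1 := by
    rw [mem_ball_zero_iff, Real.norm_eq_abs, abs_lt]; constructor <;> linarith
  have hzero := han.eqOn_zero_of_preconnected_of_eventuallyEq_zero
    (convex_ball (0 : ℝ) 1).isPreconnected hm
    (by filter_upwards [Ioo_mem_nhds hm1 hm2] with y hy using hcon y hy)
  have h0 := hzero (Metric.mem_ball_self (x := (0 : ℝ)) zero_lt_one)
  simp [kneading] at h0

/-- Subexponential growth of the counts is closed from the right in `t`. -/
theorem summable_tailCount_of_right {β t : ℝ} (hβ : β ∈ Ioo (1 : ℝ) 2) (ht : t ∈ Ico (0 : ℝ) 1)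
    (h : ∀ᶠ s in 𝓝[>] t, ∀ z ∈ Ioo (0 : ℝ) 1, Summable fun n => z ^ n * tailCount β s n s) :
    ∀ z ∈ Ioo (0 : ℝ) 1, Summable fun n => z ^ n * tailCount β t n t := by
  have hb0 : 0 < β := by linarith [hβ.1]
  set P : ℝ → ℝ → ℝ := fun s z => ∑' n, z ^ n * tailCount β s n s with hP
  have hgood : ∀ᶠ s in 𝓝[>] t, s ∈ Ico (0 : ℝ) 1 ∧
      ∀ z ∈ Ioo (0 : ℝ) 1, Summable fun n => z ^ n * tailCount β s n s := by
    filter_upwards [h, Ioo_mem_nhdsGT ht.2] with s hs hs2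
    exact ⟨⟨ht.1.trans hs2.1.le, hs2.2⟩, hs⟩
  have hlim : ∀ z ∈ Ioo (0 : ℝ) 1,
      Tendsto (fun s => kneading β s z) (𝓝[>] t) (𝓝 (kneading β t z)) := fun z hz =>
    (tendsto_kneading hb0 ⟨hz.1.le, hz.2⟩).mono_left (nhdsWithin_mono _ Ioi_subset_Ici_self)
  have hpos : ∀ s ∈ Ico (0 : ℝ) 1, ∀ n, 0 ≤ tailCount β s n s := fun s hs n =>
    (isTail_tailCount hβ hs n).nonneg ⟨le_rfl, hs.2.le⟩
  have hkpos : ∀ᶠ s in 𝓝[>] t, ∀ z ∈ Ioo (0 : ℝ) 1, 0 < kneading β s z ∧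
      P s z = (kneading β s z)⁻¹ := by
    filter_upwards [hgood] with s hs z hz
    have h1 := tsum_tailCount_mul_kneading hβ hs.1 hz (hs.2 z hz)
    have h2 : 0 ≤ P s z :=
      tsum_nonneg fun n => mul_nonneg (pow_nonneg hz.1.le n) (hpos s hs.1 n)
    refine ⟨?_, eq_inv_of_mul_eq_one_left h1⟩
    by_contra h3
    have : P s z * kneading β s z ≤ 0 := mul_nonpos_of_nonneg_of_nonpos h2 (not_lt.1 h3)
    linarith
  have hnn : ∀ z ∈ Ioo (0 : ℝ) 1, 0 ≤ kneading β t z := fun z hz =>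
    ge_of_tendsto (hlim z hz) (hkpos.mono fun s hs => (hs z hz).1.le)
  have hanti : ∀ z ∈ Ioo (0 : ℝ) 1, ∀ w ∈ Ioo (0 : ℝ) 1, z ≤ w →
      kneading β t w ≤ kneading β t z := by
    intro z hz w hw hzw
    refine le_of_tendsto_of_tendsto (hlim w hw) (hlim z hz) ?_
    filter_upwards [hgood, hkpos] with s hs hk
    have h1 : P s z ≤ P s w := (hs.2 z hz).tsum_le_tsum (fun n =>
      mul_le_mul_of_nonneg_right (pow_le_pow_left₀ hz.1.le hzw n) (hpos s hs.1 n)) (hs.2 w hw)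
    rw [(hk z hz).2, (hk w hw).2] at h1
    exact (inv_le_inv₀ (hk z hz).1 (hk w hw).1).1 h1
  -- A limit of positive decreasing functions is nonnegative and nonincreasing; a zero would make it
  -- vanish from there up to `1`.
  have hkt : ∀ z ∈ Ioo (0 : ℝ) 1, 0 < kneading β t z := by
    intro z hz
    obtain ⟨y, hy, hy0⟩ := kneading_ne_zero_on (β := β) (t := t) hz.1.le hz.2 le_rfl
    have hyI : y ∈ Ioo (0 : ℝ) 1 := ⟨hz.1.trans hy.1, hy.2⟩
    exact (lt_of_le_of_ne (hnn y hyI) hy0.symm).trans_le (hanti z hz y hyI hy.1.le)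
  intro z hz
  refine summable_of_sum_range_le (c := (kneading β t z)⁻¹)
    (fun n => mul_nonneg (pow_nonneg hz.1.le n) (hpos t ht n)) fun N => ?_
  -- A partial sum at `t` coincides with the one at nearby `s`, which is at most the reciprocal
  -- kneading function at `s`; the bound survives the limit.
  have hev : ∀ᶠ s in 𝓝[>] t, ∀ n ∈ Finset.range N, tailCount β s n s = tailCount β t n t := by
    rw [Finset.eventually_all]
    exact fun n _ => (eventually_tailCount_eq hb0 n tendsto_id).filter_mono
      (nhdsWithin_mono _ Ioi_subset_Ici_self)
  refine ge_of_tendsto ((hlim z hz).inv₀ (hkt z hz).ne') ?_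
  filter_upwards [hgood, hkpos, hev] with s hs hk heq
  rw [← (hk z hz).2]
  calc ∑ n ∈ Finset.range N, z ^ n * tailCount β t n t
      = ∑ n ∈ Finset.range N, z ^ n * tailCount β s n s :=
        Finset.sum_congr rfl fun n hn => by rw [heq n hn]
    _ ≤ P s z := (hs.2 z hz).sum_le_tsum _ fun n _ =>
        mul_nonneg (pow_nonneg hz.1.le n) (hpos s hs.1 n)

/-! ### The critical value -/

/-- Positivity of the dimension is open from the right in `t`. -/
theorem exists_dimH_pos_right {β t : ℝ} (hβ : β ∈ Ioo (1 : ℝ) 2) (ht : t ∈ Ico (0 : ℝ) 1)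
    (h : 0 < dimH (survivorSet β t)) : ∃ s ∈ Ioo t 1, 0 < dimH (survivorSet β s) := by
  by_contra! hcon
  have hs := summable_tailCount_of_right hβ ht (by
    filter_upwards [Ioo_mem_nhdsGT ht.2] with s hs z hz
    by_contra hns
    exact absurd (dimH_survivorSet_pos hβ ⟨ht.1.trans_lt hs.1, hs.2⟩ hz hns)
      (not_lt.2 (hcon s hs)))
  rw [dimH_survivorSet_eq_zero (by linarith [hβ.1]) (dimH_forwardSet_eq_zero hβ ht hs)] at h
  exact lt_irrefl _ h

/-- For `t = 1 - 1/β` the points `t` and `1` have the same image `β - 1`, so two of the three terms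
of `tailOp` cancel and the count never changes. -/
theorem tailCount_cut {β : ℝ} (hβ : β ∈ Ioo (1 : ℝ) 2) (n : ℕ) :
    tailCount β (1 - 1 / β) n (1 - 1 / β) = 1 := by
  have hinv : 0 < 1 / β := by have := hβ.1; positivity
  induction n with
  | zero => rw [tailCount_zero_apply, if_pos (by linarith)]
  | succ n ih =>
    have h1 : clampMap β (1 - 1 / β) (1 - 1 / β) = clampMap β (1 - 1 / β) 1 := by
      rw [clampMap, clampMap, betaMap_of_lt hβ.1 (cut_pos hβ.1).le (cut_lt_inv hβ),
        mul_cut hβ.1, betaMap_one hβ]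
    rw [tailCount_succ, tailOp_of_lt _ (cut_lt_inv hβ), h1, ih]
    ring

theorem dimH_survivorSet_cut {β : ℝ} (hβ : β ∈ Ioo (1 : ℝ) 2) :
    dimH (survivorSet β (1 - 1 / β)) = 0 := by
  have hinv : 0 < 1 / β := by have := hβ.1; positivity
  refine dimH_survivorSet_eq_zero (by linarith [hβ.1]) (dimH_forwardSet_eq_zero hβ
    ⟨(cut_pos hβ.1).le, by linarith⟩ fun z hz => ?_)
  simp only [tailCount_cut hβ, mul_one]
  exact summable_geometric_of_lt_one hz.1.le hz.2

theorem dimH_survivorSet_zero {β : ℝ} : dimH (survivorSet β 0) = 1 := by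
  have : survivorSet β 0 = Ico 0 1 := by ext; simp [survivorSet]
  rw [this]
  exact (Real.dimH_of_nonempty_interior ((nonempty_Ioo.2 (zero_lt_one (α := ℝ))).mono
    (interior_maximal Ioo_subset_Ico_self isOpen_Ioo))).trans (by simp)

/-- The critical value is the supremum of the parameters of positive dimension. Openness from the
right shows that it is not attained, which gives the strict inequality. -/
theorem exists_isCriticalValue {β : ℝ} (hβ : β ∈ Ioo (1 : ℝ) 2) :
    ∃ τ, τ ≤ 1 - 1 / β ∧ IsCriticalValue β τ := by
  have hinv : 0 < 1 / β := by have := hβ.1; positivity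
  set S := {t | t ∈ Ico (0 : ℝ) 1 ∧ 0 < dimH (survivorSet β t)} with hS
  have h0 : (0 : ℝ) ∈ S := ⟨⟨le_rfl, zero_lt_one⟩, by rw [dimH_survivorSet_zero]; exact zero_lt_one⟩
  have hub : ∀ t ∈ S, t ≤ 1 - 1 / β := by
    intro t ht
    by_contra! hlt
    have := dimH_mono (survivorSet_anti (β := β) hlt.le)
    rw [dimH_survivorSet_cut hβ] at this
    exact absurd ht.2 (not_lt.2 this)
  have hbdd : BddAbove S := ⟨_, hub⟩
  refine ⟨sSup S, csSup_le ⟨0, h0⟩ hub, fun t ht => ⟨fun h => ?_, fun h => ?_⟩⟩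
  · obtain ⟨s, hs, hs2⟩ := exists_dimH_pos_right hβ ht h
    exact hs.1.trans_le (le_csSup hbdd ⟨⟨ht.1.trans hs.1.le, hs.2⟩, hs2⟩)
  · obtain ⟨s, hs, hts⟩ := exists_lt_of_lt_csSup ⟨0, h0⟩ h
    exact hs.2.trans_le (dimH_mono (survivorSet_anti hts.le))

theorem IsCriticalValue.pos {β τ : ℝ} (h : IsCriticalValue β τ) : 0 < τ := by
  refine (h 0 ⟨le_rfl, zero_lt_one⟩).1 ?_
  rw [dimH_survivorSet_zero]; exact zero_lt_one

theorem IsCriticalValue.unique {β τ σ : ℝ} (hτ1 : τ < 1) (hτ : IsCriticalValue β τ)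
    (hσ : IsCriticalValue β σ) : σ = τ := by
  rcases lt_trichotomy σ τ with h | h | h
  · have h1 : σ ∈ Ico (0 : ℝ) 1 := ⟨hσ.pos.le, h.trans hτ1⟩
    exact absurd ((hσ σ h1).1 ((hτ σ h1).2 h)) (lt_irrefl _)
  · exact h
  · have h1 : τ ∈ Ico (0 : ℝ) 1 := ⟨hτ.pos.le, hτ1⟩
    exact absurd ((hτ τ h1).1 ((hσ τ h1).2 h)) (lt_irrefl _)

/-! ### Finding periodic orbits -/

/-- If an orbit of a right-continuous map decreases whenever it returns close to an earlier
position, then it accumulates on a periodic orbit. -/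
theorem exists_periodic_of_decreasing {f : ℝ → ℝ}
    (hf : ∀ x, Tendsto f (𝓝[≥] x) (𝓝[≥] (f x))) {z a b δ : ℝ} (hδ : 0 < δ)
    (hmem : ∀ n, f^[n] z ∈ Icc a b)
    (hdec : ∀ i j, i < j → |f^[i] z - f^[j] z| < δ → f^[j] z < f^[i] z) :
    ∃ (p : ℝ) (m : ℕ), 0 < m ∧ f^[m] p = p ∧ ∀ l, f^[l] p ∈ Icc a b := by
  obtain ⟨p, -, φ, hφ, hlim⟩ := isCompact_Icc.tendsto_subseq hmem
  have hclose : ∀ᶠ k in atTop, |f^[φ k] z - p| < δ / 2 := by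
    have := hlim.eventually (Metric.ball_mem_nhds p (half_pos hδ))
    filter_upwards [this] with k hk
    simpa [Metric.mem_ball, Real.dist_eq] using hk
  obtain ⟨N, hN⟩ := eventually_atTop.1 hclose
  have hanti : ∀ k k', N ≤ k → k < k' → f^[φ k'] z < f^[φ k] z := by
    intro k k' hk hkk
    refine hdec _ _ (hφ hkk) ?_
    have h1 := abs_lt.1 (hN k hk)
    have h2 := abs_lt.1 (hN k' (by omega))
    rw [abs_lt]; constructor <;> linarith
  have hge : ∀ k, N ≤ k → p ≤ f^[φ k] z := by
    intro k hk
    refine le_of_tendsto hlim ?_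
    filter_upwards [eventually_gt_atTop k] with k' hk'
    exact (hanti k k' hk hk').le
  -- The subsequence decreases to `p`, hence arrives from the right, where all iterates of `f` are
  -- continuous.
  have hright : Tendsto (fun k => f^[φ k] z) atTop (𝓝[≥] p) :=
    tendsto_nhdsWithin_of_tendsto_nhds_of_eventually_within _ hlim
      (eventually_atTop.2 ⟨N, hge⟩)
  have hshift : ∀ l, Tendsto (fun k => f^[l + φ k] z) atTop (𝓝 (f^[l] p)) := by
    intro l
    have := ((tendsto_iterate_right hf l p).comp hright).mono_right nhdsWithin_le_nhds
    refine this.congr fun k => ?_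
    rw [Function.comp_apply, Function.iterate_add_apply]
  have hin : ∀ l, f^[l] p ∈ Icc a b := fun l =>
    isClosed_Icc.mem_of_tendsto (hshift l) (Eventually.of_forall fun k => hmem _)
  -- The orbit of `p` cannot contain two distinct close points. Whichever of them is smaller can be
  -- approximated by the earlier point of the orbit of `z`, because the later index is free to be
  -- taken large; this contradicts `hdec`.
  have hno : ∀ l l', |f^[l] p - f^[l'] p| < δ → ¬ f^[l] p < f^[l'] p := by
    intro l l' hd hlt
    have h1 : Tendsto (fun k => f^[l' + φ (k + (l + 1))] z) atTop (𝓝 (f^[l'] p)) :=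
      (hshift l').comp (tendsto_add_atTop_nat (l + 1))
    have h2 := ((hshift l).sub h1).abs.eventually (gt_mem_nhds hd)
    have h3 := (hshift l).eventually_lt h1 hlt
    obtain ⟨k, hk1, hk2⟩ := (h2.and h3).exists
    refine absurd (hdec _ _ ?_ hk1) (not_lt.2 hk2.le)
    have : l + 1 + φ k ≤ φ (l + 1 + k) := hφ.add_le_nat (l + 1) k
    rw [add_comm k]
    omega
  obtain ⟨q, -, ψ, hψ, hlim2⟩ := isCompact_Icc.tendsto_subseq hin
  obtain ⟨K, hK⟩ := (Metric.cauchySeq_iff.1 hlim2.cauchySeq) δ hδ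
  have hd := hK K le_rfl (K + 1) (by omega)
  rw [Real.dist_eq] at hd
  simp only [Function.comp_apply] at hd
  have hlt : ψ K < ψ (K + 1) := hψ (by omega)
  have heq : f^[ψ K] p = f^[ψ (K + 1)] p :=
    le_antisymm (not_lt.1 (hno _ _ (by rwa [abs_sub_comm]))) (not_lt.1 (hno _ _ hd))
  refine ⟨f^[ψ K] p, ψ (K + 1) - ψ K, by omega, ?_, fun l => ?_⟩
  · rw [← Function.iterate_add_apply, Nat.sub_add_cancel hlt.le, heq]
  · rw [← Function.iterate_add_apply]; exact hin _

theorem hasPeriodicAbove_of_backward {β : ℝ} {w : ℕ → ℝ} {m : ℕ} (hm : 0 < m)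
    (hstep : ∀ l < m, betaMap β (w (l + 1)) = w l) (hmem : ∀ l ≤ m, w l ∈ Ico (1 - 1 / β) 1)
    (hw : w m = w 0) : HasPeriodicAbove β := by
  have hit : ∀ n ≤ m, (betaMap β)^[n] (w m) = w (m - n) := by
    intro n
    induction n with
    | zero => intro _; rfl
    | succ n ih =>
      intro hn
      rw [Function.iterate_succ_apply', ih (by omega), show m - n = m - (n + 1) + 1 by omega,
        hstep _ (by omega)]
  have hper : (betaMap β)^[m] (w m) = w m := by rw [hit m le_rfl, Nat.sub_self, hw]
  refine ⟨w m, m, hm, hper, fun n => ?_⟩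
  have hper' : Function.IsPeriodicPt (betaMap β) m (w m) := hper
  rw [← hper'.iterate_mod_apply, hit _ (Nat.mod_lt _ hm).le]
  exact hmem _ (by omega)

/-- The inverse of the map on `[1 - 1/β, 1)`. -/
noncomputable def backMap (β y : ℝ) : ℝ := if y < β - 1 then (y + 1) / β else y / β

theorem mul_backMap {β : ℝ} (hβ : β ≠ 0) (y : ℝ) :
    β * backMap β y = (if y < β - 1 then 1 else 0 : ℤ) + y := by
  rw [backMap]
  split_ifs
  · push_cast; field_simp; ring
  · push_cast; field_simp; ring

theorem betaMap_backMap {β y : ℝ} (hβ : β ≠ 0) (hy : y ∈ Ico (0 : ℝ) 1) :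
    betaMap β (backMap β y) = y :=
  betaMap_eq_of_eq_add _ hy (mul_backMap hβ y)

theorem backMap_mem {β y : ℝ} (hβ : β ∈ Ioo (1 : ℝ) 2) (hy : y ∈ Ico (0 : ℝ) 1) :
    backMap β y ∈ Ico (1 - 1 / β) 1 := by
  have hb := hβ.1
  have hb0 : 0 < β := by linarith
  have h1 := cut_lt_inv hβ
  rw [backMap]
  split_ifs with h
  · refine ⟨h1.le.trans ?_, by rw [div_lt_one hb0]; linarith⟩
    gcongr; linarith [hy.1]
  · refine ⟨?_, by rw [div_lt_one hb0]; linarith [hy.2]⟩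
    rw [le_div_iff₀ hb0, mul_comm, mul_cut hb]; linarith

theorem tendsto_backMap {β : ℝ} (hβ : 0 < β) (x : ℝ) :
    Tendsto (backMap β) (𝓝[≥] x) (𝓝[≥] (backMap β x)) := by
  have hlin : ∀ d : ℝ, Tendsto (fun y => (y + d) / β) (𝓝[≥] x) (𝓝[≥] ((x + d) / β)) := by
    intro d
    refine tendsto_nhdsWithin_of_tendsto_nhds_of_eventually_within _ ?_ ?_
    · exact (Continuous.tendsto (by fun_prop) x).mono_left nhdsWithin_le_nhds
    · filter_upwards [self_mem_nhdsWithin] with y hy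
      have hy' : x ≤ y := hy
      exact div_le_div_of_nonneg_right (by linarith) hβ.le
  have heq : ∀ y, backMap β y = (y + if y < β - 1 then 1 else 0) / β := by
    intro y; rw [backMap]; split_ifs <;> simp
  rw [heq x]
  refine (hlin _).congr' ?_
  filter_upwards [eventually_lt_iff_right (a := β - 1) (u := x)] with y hy
  rw [heq y]
  simp only [hy]

/-- If the backward orbit returns close by without decreasing, it is closed up by an upward shift
that contracts by `1/β` at each step and fits into the room `ε` below `1`. Otherwise all close
returns decrease and `exists_periodic_of_decreasing` applies. -/
theorem hasPeriodicAbove_of_backMap {β ε z : ℝ} (hβ : β ∈ Ioo (1 : ℝ) 2) (hε : 0 < ε)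
    (hz : ∀ n, (backMap β)^[n] z ∈ Icc (1 - 1 / β) (1 - ε)) : HasPeriodicAbove β := by
  have hb := hβ.1
  have hb0 : 0 < β := by linarith
  have hc := cut_pos hb
  set b := 1 / β with hbdef
  have hb1 : 0 < b := by positivity
  have hδ : 0 < ε / 2 * (1 - b) := by positivity
  by_cases hex : ∃ i j, i < j ∧ (backMap β)^[i] z ≤ (backMap β)^[j] z ∧
      (backMap β)^[j] z - (backMap β)^[i] z < ε / 2 * (1 - b)
  · obtain ⟨i, j, hij, hle, hlt⟩ := hex
    obtain ⟨m, rfl⟩ := Nat.exists_eq_add_of_lt hij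
    have hpow : b ^ (m + 1) ≤ b := by
      rw [pow_succ]; exact mul_le_of_le_one_left hb1.le (pow_le_one₀ hb1.le (by linarith))
    have hden : 0 < 1 - b ^ (m + 1) := by linarith
    -- The shift solves `z_i + η = z_j + η b ^ (m + 1)` with `j = i + m + 1`; the factor `1 - b` in
    -- the tolerance guarantees `η ≤ ε / 2`.
    set η := ((backMap β)^[i + m + 1] z - (backMap β)^[i] z) / (1 - b ^ (m + 1)) with hη
    have hη0 : 0 ≤ η := div_nonneg (by linarith) hden.le
    have hη1 : η ≤ ε / 2 := by
      rw [hη, div_le_iff₀ hden]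
      exact hlt.le.trans (mul_le_mul_of_nonneg_left (by linarith) (by linarith))
    have hwm : ∀ l, (backMap β)^[i + l] z + η * b ^ l ∈ Ico (1 - b) 1 := by
      intro l
      have h1 : 0 ≤ η * b ^ l := by positivity
      have h2 : η * b ^ l ≤ η := mul_le_of_le_one_right hη0 (pow_le_one₀ hb1.le (by linarith))
      exact ⟨by linarith [(hz (i + l)).1], by linarith [(hz (i + l)).2]⟩
    refine hasPeriodicAbove_of_backward (w := fun l => (backMap β)^[i + l] z + η * b ^ l)
      (m := m + 1) (Nat.succ_pos m) (fun l _ => ?_) (fun l _ => hwm l) ?_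
    · refine betaMap_eq_of_eq_add (if (backMap β)^[i + l] z < β - 1 then 1 else 0)
        ⟨hc.le.trans (hwm l).1, (hwm l).2⟩ ?_
      rw [mul_add, ← add_assoc i l 1, Function.iterate_succ_apply', mul_backMap hb0.ne', pow_succ]
      have : β * (η * (b ^ l * b)) = η * b ^ l := by rw [hbdef]; field_simp
      rw [this]; ring
    · simp only [add_zero, pow_zero, mul_one]
      have : η * (1 - b ^ (m + 1)) = (backMap β)^[i + m + 1] z - (backMap β)^[i] z :=
        div_mul_cancel₀ _ hden.ne'
      rw [← add_assoc]; linarith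
  · push Not at hex
    obtain ⟨p, m, hm, hp, hin⟩ := exists_periodic_of_decreasing (tendsto_backMap hb0) hδ hz (by
      intro i j hij hd
      by_contra! hle
      have := hex i j hij hle
      rw [abs_sub_comm] at hd
      exact absurd (lt_of_abs_lt hd) (not_lt.2 this))
    have hin' : ∀ l, (backMap β)^[l] p ∈ Ico (1 - b) 1 := fun l =>
      ⟨(hin l).1, (hin l).2.trans_lt (by linarith)⟩
    refine hasPeriodicAbove_of_backward (w := fun l => (backMap β)^[l] p) hm (fun l _ => ?_)
      (fun l _ => hin' l) hp
    rw [Function.iterate_succ_apply']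
    exact betaMap_backMap hb0.ne' ⟨hc.le.trans (hin' l).1, (hin' l).2⟩

/-- The closing argument for forward orbits: the shift now goes downwards and uses the room between
`1 - 1/β` and `t`. -/
theorem hasPeriodicAbove_of_mem_forwardSet {β t x : ℝ} (hβ : β ∈ Ioo (1 : ℝ) 2)
    (ht : 1 - 1 / β < t) (hx : x ∈ forwardSet β t) : HasPeriodicAbove β := by
  have hb := hβ.1
  have hb0 : 0 < β := by linarith
  have hc := cut_pos hb
  set ε := t - (1 - 1 / β) with hε
  have hε0 : 0 < ε := by linarith
  set b := 1 / β with hbdef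
  have hb1 : 0 < b := by positivity
  have hδ : 0 < ε * (1 - b) := by positivity
  by_cases hex : ∃ i j, i < j ∧ (betaMap β)^[i] x ≤ (betaMap β)^[j] x ∧
      (betaMap β)^[j] x - (betaMap β)^[i] x < ε * (1 - b)
  · obtain ⟨i, j, hij, hle, hlt⟩ := hex
    obtain ⟨m, rfl⟩ := Nat.exists_eq_add_of_lt hij
    have hpow : b ^ (m + 1) ≤ b := by
      rw [pow_succ]; exact mul_le_of_le_one_left hb1.le (pow_le_one₀ hb1.le (by linarith))
    have hden : 0 < 1 - b ^ (m + 1) := by linarith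
    set η := ((betaMap β)^[i + m + 1] x - (betaMap β)^[i] x) / (1 - b ^ (m + 1)) with hη
    have hη0 : 0 ≤ η := div_nonneg (by linarith) hden.le
    have hη1 : η ≤ ε := by
      rw [hη, div_le_iff₀ hden]
      exact hlt.le.trans (mul_le_mul_of_nonneg_left (by linarith) hε0.le)
    have hwm : ∀ l, (betaMap β)^[i + (m + 1 - l)] x - η * b ^ l ∈ Ico (1 - b) 1 := by
      intro l
      have h1 : 0 ≤ η * b ^ l := by positivity
      have h2 : η * b ^ l ≤ η := mul_le_of_le_one_right hη0 (pow_le_one₀ hb1.le (by linarith))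
      exact ⟨by linarith [(hx (i + (m + 1 - l))).1], by linarith [(hx (i + (m + 1 - l))).2]⟩
    refine hasPeriodicAbove_of_backward
      (w := fun l => (betaMap β)^[i + (m + 1 - l)] x - η * b ^ l)
      (m := m + 1) (Nat.succ_pos m) (fun l hl => ?_) (fun l _ => hwm l) ?_
    · set k := i + (m + 1 - (l + 1)) with hk
      have hk' : i + (m + 1 - l) = k + 1 := by omega
      have hw := hwm l
      rw [hk'] at hw ⊢
      refine betaMap_eq_of_eq_add ⌊β * (betaMap β)^[k] x⌋ ⟨hc.le.trans hw.1, hw.2⟩ ?_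
      have hfl := Int.floor_add_fract (β * (betaMap β)^[k] x)
      rw [Function.iterate_succ_apply', betaMap, mul_sub, pow_succ]
      have : β * (η * (b ^ l * b)) = η * b ^ l := by rw [hbdef]; field_simp
      rw [this]; linarith
    · simp only [Nat.sub_self, add_zero, pow_zero, mul_one, Nat.sub_zero]
      have : η * (1 - b ^ (m + 1)) = (betaMap β)^[i + m + 1] x - (betaMap β)^[i] x :=
        div_mul_cancel₀ _ hden.ne'
      rw [← add_assoc]; linarith
  · push Not at hex
    obtain ⟨p, m, hm, hp, hin⟩ := exists_periodic_of_decreasing (tendsto_betaMap hb0) hδ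
      (fun n => Ico_subset_Icc_self (hx n)) (by
      intro i j hij hd
      by_contra! hle
      have := hex i j hij hle
      rw [abs_sub_comm] at hd
      exact absurd (lt_of_abs_lt hd) (not_lt.2 this))
    refine ⟨p, m, hm, hp, fun l => ⟨ht.le.trans (hin l).1, ?_⟩⟩
    -- The limiting argument only gives values at most `1`. By periodicity every point of the orbit
    -- is an image under the map, hence below `1`.
    rw [← hp, ← Function.iterate_add_apply]
    obtain ⟨k, hk⟩ : ∃ k, l + m = k + 1 := ⟨l + m - 1, by omega⟩
    rw [hk, Function.iterate_succ_apply']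
    exact (betaMap_mem_Ico _ _).2

/-! ### Exponential growth in the absence of periodic orbits -/

/-- The number of pre-images of order `n` of (the left limit at) `y` in `[t, 1)`. -/
noncomputable def leftCount (β t : ℝ) : ℕ → ℝ → ℝ
  | 0, _ => 1
  | n + 1, y => (if β * t < y then leftCount β t n (y / β) else 0) +
      (if y ≤ β - 1 then leftCount β t n ((y + 1) / β) else 0)

/-- The operator replaces the indicator of points left of `y` by those for the pre-images of `y`.
Because left limits are counted, `y / β` must exceed `t` strictly, while `(y + 1) / β` may equal
`1`. -/
theorem tailOp_indicator {β t y u : ℝ} (hβ : β ∈ Ioo (1 : ℝ) 2) (ht : 0 ≤ t) (hy : y ∈ Ioc t 1)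
    (hu : u ∈ Icc t 1) :
    tailOp β t (fun u => if u < y then 1 else 0) u =
      (if β * t < y then 1 else 0) * (if u < y / β then 1 else 0) +
      (if y ≤ β - 1 then 1 else 0) * (if u < (y + 1) / β then 1 else 0) := by
  have hb0 : 0 < β := by linarith [hβ.1]
  have hcl : ∀ v, clampMap β t v < y ↔ betaMap β v < y := fun v => by
    rw [clampMap, max_lt_iff]; exact and_iff_left hy.1
  have htu := mul_le_mul_of_nonneg_left hu.1 hb0.le
  have hu1 := mul_le_mul_of_nonneg_left hu.2 hb0.le
  simp only [lt_div_iff₀ hb0]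
  rcases lt_or_ge u (1 / β) with h | h
  · have h' := h
    rw [lt_div_iff₀ hb0] at h'
    rw [tailOp_of_lt _ h]
    simp only [hcl, betaMap_of_lt hβ.1 (ht.trans hu.1) h, betaMap_one hβ, hy.1, if_true]
    by_cases h1 : β * u < y <;> by_cases h2 : β - 1 < y
    · simp [h1, h2, not_le.2 h2, mul_comm u, htu.trans_lt h1]
    · have h3 : u * β < y + 1 := by linarith
      simp [h1, h2, not_lt.1 h2, mul_comm u, htu.trans_lt h1]
      linarith
    · simp [h1, h2, not_le.2 h2, mul_comm u]
    · have h3 : u * β < y + 1 := by linarith [ht, hy.1]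
      simp [h1, h2, not_lt.1 h2, mul_comm u]
      linarith
  · have h' := h
    rw [div_le_iff₀ hb0] at h'
    rw [tailOp_of_le _ h]
    simp only [hcl, betaMap_of_le hβ h hu.2, betaMap_one hβ]
    have h4 : ¬ u * β < y := by linarith [hy.2]
    by_cases h2 : β - 1 < y
    · have h3 : β * u - 1 < y := by linarith
      simp [h2, not_le.2 h2, h4, h3]
    · have h3 : (β * u - 1 < y) ↔ u * β < y + 1 := by
        constructor <;> intro <;> linarith
      simp [h2, not_lt.1 h2, h4, h3]

theorem tailOp_congr {β t : ℝ} (ht : t < 1) {f g : ℝ → ℝ} (h : EqOn f g (Icc t 1)) :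
    EqOn (tailOp β t f) (tailOp β t g) (Icc t 1) := fun u _ => by
  rw [tailOp, tailOp, h (clampMap_mem_Icc ht u), h (clampMap_mem_Icc ht 1), h ⟨le_rfl, ht.le⟩]

theorem tailOp_iterate_congr {β t : ℝ} (ht : t < 1) (n : ℕ) {f g : ℝ → ℝ}
    (h : EqOn f g (Icc t 1)) : EqOn ((tailOp β t)^[n] f) ((tailOp β t)^[n] g) (Icc t 1) := by
  induction n generalizing f g with
  | zero => exact h
  | succ n ih => exact ih (tailOp_congr ht h)

theorem tailOp_iterate_linear {β t : ℝ} (n : ℕ) (a b : ℝ) (f g : ℝ → ℝ) :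
    (tailOp β t)^[n] (fun u => a * f u + b * g u) =
      fun u => a * (tailOp β t)^[n] f u + b * (tailOp β t)^[n] g u := by
  induction n generalizing f g with
  | zero => rfl
  | succ n ih =>
    have : tailOp β t (fun u => a * f u + b * g u) =
        fun u => a * tailOp β t f u + b * tailOp β t g u := by
      funext u
      simp only [tailOp]
      split_ifs <;> ring
    rw [Function.iterate_succ_apply, this, ih]
    rfl

theorem tailOp_iterate_indicator {β t : ℝ} (hβ : β ∈ Ioo (1 : ℝ) 2) (ht : t ∈ Ioo 0 (1 - 1 / β))
    (n : ℕ) : ∀ y ∈ Ioc t 1,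
      (tailOp β t)^[n] (fun u => if u < y then 1 else 0) t = leftCount β t n y := by
  have hb0 : 0 < β := by linarith [hβ.1]
  have hinv : 0 < 1 / β := by positivity
  have ht1 : t < 1 := by linarith [ht.2]
  induction n with
  | zero => intro y hy; simp [leftCount, hy.1]
  | succ n ih =>
    intro y hy
    have h1 := tailOp_iterate_congr (β := β) ht1 n
      (fun u hu => tailOp_indicator hβ ht.1.le hy hu)
    rw [Function.iterate_succ_apply, h1 ⟨le_rfl, ht1.le⟩, tailOp_iterate_linear, leftCount]
    refine congrArg₂ (· + ·) ?_ ?_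
    · split_ifs with h
      · rw [one_mul, ih]
        refine ⟨by rwa [lt_div_iff₀ hb0, mul_comm], ?_⟩
        rw [div_le_one hb0]; linarith [hy.2, hβ.1]
      · rw [zero_mul]
    · split_ifs with h
      · rw [one_mul, ih]
        refine ⟨?_, by rw [div_le_one hb0]; linarith⟩
        refine (ht.2.trans (cut_lt_inv hβ)).trans ?_
        exact div_lt_div_of_pos_right (by linarith [ht.1, hy.1]) hb0
      · rw [zero_mul]

theorem tailCount_eq_leftCount {β t : ℝ} (hβ : β ∈ Ioo (1 : ℝ) 2) (ht : t ∈ Ioo 0 (1 - 1 / β))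
    (n : ℕ) : tailCount β t n t = leftCount β t n 1 := by
  have hinv : 0 < 1 / β := by have := hβ.1; positivity
  exact tailOp_iterate_indicator hβ ht n 1 ⟨by linarith [ht.2], le_rfl⟩

/-! ### Growth of the number of pre-images -/

section LeftCount

variable {β t : ℝ}

theorem div_mem_Ioc (hβ : β ∈ Ioo (1 : ℝ) 2) {y : ℝ} (hy : y ∈ Ioc (0 : ℝ) 1) :
    y / β ∈ Ioc (0 : ℝ) 1 := by
  have hb0 : 0 < β := by linarith [hβ.1]
  exact ⟨div_pos hy.1 hb0, by rw [div_le_one hb0]; linarith [hy.2, hβ.1]⟩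

theorem add_one_div_mem_Ioc (hβ : β ∈ Ioo (1 : ℝ) 2) {y : ℝ} (hy : y ∈ Ioc (0 : ℝ) 1)
    (h : y ≤ β - 1) : (y + 1) / β ∈ Ioc (0 : ℝ) 1 := by
  have hb0 : 0 < β := by linarith [hβ.1]
  exact ⟨div_pos (by linarith [hy.1]) hb0, by rw [div_le_one hb0]; linarith⟩

/-- Every admissible pre-image of order `k` has at least `C` pre-images of order `n`; this
multiplies the growth. -/
theorem leftCount_add_ge (hβ : β ∈ Ioo (1 : ℝ) 2) {n : ℕ} {C : ℝ}
    (hC : ∀ y ∈ Ioc (0 : ℝ) 1, C ≤ leftCount β t n y) (k : ℕ) :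
    ∀ y ∈ Ioc (0 : ℝ) 1, C * leftCount β t k y ≤ leftCount β t (n + k) y := by
  induction k with
  | zero => intro y hy; simpa [leftCount] using hC y hy
  | succ k ih =>
    intro y hy
    rw [← add_assoc, leftCount, leftCount, mul_add]
    refine add_le_add ?_ ?_
    · split_ifs
      · exact ih _ (div_mem_Ioc hβ hy)
      · simp
    · split_ifs with h
      · exact ih _ (add_one_div_mem_Ioc hβ hy h)
      · simp

theorem one_le_leftCount (hβ : β ∈ Ioo (1 : ℝ) 2) (ht : β * t < β - 1) (n : ℕ) :
    ∀ y ∈ Ioc (0 : ℝ) 1, 1 ≤ leftCount β t n y := by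
  induction n with
  | zero => intro y _; exact le_rfl
  | succ n ih =>
    intro y hy
    rw [leftCount]
    by_cases h : y ≤ β - 1
    · have h1 := ih _ (add_one_div_mem_Ioc hβ hy h)
      have h2 := ih _ (div_mem_Ioc hβ hy)
      rw [if_pos h]
      split_ifs <;> linarith
    · rw [if_neg h, if_pos (by linarith), add_zero]
      exact ih _ (div_mem_Ioc hβ hy)

/-- A point with a single pre-image of each order up to `n + 1` produces a long orbit of the
inverse map that stays away from `1`. -/
theorem exists_orbit_of_leftCount_lt (hβ : β ∈ Ioo (1 : ℝ) 2) (ht0 : 0 ≤ t)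
    (ht : β * t < β - 1) {ε : ℝ} (hε : ε = 1 - 1 / β - t) (n : ℕ) :
    ∀ y ∈ Ioc (0 : ℝ) 1, leftCount β t (n + 1) y < 2 →
      ∃ z ∈ Icc (1 - 1 / β) (1 - ε),
        ((y ≤ β - 1 - β * ε ∧ z = (y + 1) / β) ∨ (β - 1 < y ∧ z = y / β)) ∧
        ∀ η ∈ Icc 0 (ε / 2), ∀ j ≤ n, (backMap β)^[j] (z + η) ∈ Icc (1 - 1 / β) (1 - ε / 2) := by
  have hb := hβ.1
  have hb0 : 0 < β := by linarith
  have hmc := mul_cut hb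
  have hcl := cut_lt_inv hβ
  have hc := cut_pos hb
  have hβε : β * ε = β - 1 - β * t := by rw [hε, mul_sub, hmc]
  have hε0 : 0 < ε := pos_of_mul_pos_right (by linarith : 0 < β * ε) hb0.le
  -- Each admissible branch contributes at least one pre-image. Fewer than two in total leaves one
  -- branch, and the excluded one keeps the surviving pre-image below `1 - ε`.
  have hstep : ∀ (k : ℕ), ∀ y ∈ Ioc (0 : ℝ) 1, leftCount β t (k + 1) y < 2 →
      ∃ z ∈ Icc (1 - 1 / β) (1 - ε),
        ((y ≤ β - 1 - β * ε ∧ z = (y + 1) / β) ∨ (β - 1 < y ∧ z = y / β)) ∧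
        leftCount β t k z < 2 := by
    intro k y hy hlt
    rw [leftCount] at hlt
    have h2 := one_le_leftCount hβ ht k _ (div_mem_Ioc hβ hy)
    by_cases h : y ≤ β - 1
    · have h1 := one_le_leftCount hβ ht k _ (add_one_div_mem_Ioc hβ hy h)
      rw [if_pos h] at hlt
      by_cases h3 : β * t < y
      · rw [if_pos h3] at hlt; linarith
      · rw [if_neg h3, zero_add] at hlt
        refine ⟨(y + 1) / β, ⟨?_, ?_⟩, Or.inl ⟨by linarith, rfl⟩, hlt⟩
        · refine hcl.le.trans ?_
          gcongr; linarith [hy.1]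
        · rw [div_le_iff₀ hb0, sub_mul, one_mul, mul_comm ε, hβε]; linarith
    · rw [if_neg h, add_zero, if_pos (by linarith)] at hlt
      refine ⟨y / β, ⟨?_, ?_⟩, Or.inr ⟨not_le.1 h, rfl⟩, hlt⟩
      · rw [le_div_iff₀ hb0, mul_comm, hmc]; linarith
      · have := mul_nonneg hb0.le ht0
        rw [div_le_iff₀ hb0, sub_mul, one_mul, mul_comm ε, hβε]; linarith [hy.2]
  induction n with
  | zero =>
    intro y hy hlt
    obtain ⟨z, hz, hrel, -⟩ := hstep 0 y hy hlt
    refine ⟨z, hz, hrel, fun η hη j hj => ?_⟩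
    rw [Nat.le_zero.1 hj]
    exact ⟨by simpa using add_le_add hz.1 hη.1, by
      have := add_le_add hz.2 hη.2
      simp only [Function.iterate_zero, id]; linarith⟩
  | succ n ih =>
    intro y hy hlt
    obtain ⟨z, hz, hrel, hz2⟩ := hstep (n + 1) y hy hlt
    have hz0 : z ∈ Ioc (0 : ℝ) 1 := ⟨hc.trans_le hz.1, by linarith [hz.2]⟩
    obtain ⟨w, hw, hrelw, hin⟩ := ih z hz0 hz2
    refine ⟨z, hz, hrel, fun η hη j hj => ?_⟩
    cases j with
    | zero => exact ⟨by simpa using add_le_add hz.1 hη.1, by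
        have := add_le_add hz.2 hη.2
        simp only [Function.iterate_zero, id]; linarith⟩
    | succ j =>
      -- The shift stays on the same branch: either `z` is at least `β ε` below the jump `β - 1`, or
      -- it is already above it.
      have hnext : backMap β (z + η) = w + η / β := by
        rw [backMap]
        rcases hrelw with ⟨h1, rfl⟩ | ⟨h1, rfl⟩
        · rw [if_pos (by nlinarith [hη.2])]; ring
        · rw [if_neg (by linarith [hη.1])]; ring
      rw [Function.iterate_succ_apply, hnext]
      refine hin _ ⟨div_nonneg hη.1 hb0.le, ?_⟩ j (by omega)
      exact (div_le_self hη.1 hb.le).trans hη.2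

/-- Failure for every `N` gives backward orbits of every length that stay away from `1`. The
tolerance `ε / 2` lets them start on a finite grid, so a single grid point works for all lengths,
and its orbit closes up to a periodic one. -/
theorem exists_two_le_leftCount (hβ : β ∈ Ioo (1 : ℝ) 2) (hP : ¬ HasPeriodicAbove β)
    (ht : t ∈ Ioo 0 (1 - 1 / β)) :
    ∃ N, 0 < N ∧ ∀ y ∈ Ioc (0 : ℝ) 1, 2 ≤ leftCount β t N y := by
  have hb0 : 0 < β := by linarith [hβ.1]
  by_contra! hcon
  set ε := 1 - 1 / β - t with hε
  have hε0 : 0 < ε := by linarith [ht.2]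
  have hδ : 0 < ε / 2 := by linarith
  have hβt : β * t < β - 1 := by
    rw [← mul_cut hβ.1]; exact mul_lt_mul_of_pos_left ht.2 hb0
  have hgrid : ∀ n : ℕ, ∃ i ∈ Finset.range (⌈1 / (ε / 2)⌉₊ + 1), ∀ j ≤ n,
      (backMap β)^[j] (i * (ε / 2)) ∈ Icc (1 - 1 / β) (1 - ε / 2) := by
    intro n
    obtain ⟨y, hy, hlt⟩ := hcon (n + 1) (Nat.succ_pos n)
    obtain ⟨z, hz, -, hin⟩ := exists_orbit_of_leftCount_lt hβ ht.1.le hβt hε n y hy hlt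
    have hz0 : 0 ≤ z / (ε / 2) := div_nonneg ((cut_pos hβ.1).le.trans hz.1) hδ.le
    refine ⟨⌈z / (ε / 2)⌉₊, ?_, ?_⟩
    · rw [Finset.mem_range, Nat.lt_succ_iff]
      refine Nat.ceil_mono ?_
      gcongr
      linarith [hz.2]
    · have h1 := Nat.le_ceil (z / (ε / 2))
      have h2 := Nat.ceil_lt_add_one hz0
      rw [div_le_iff₀ hδ] at h1
      rw [div_add_one hδ.ne', lt_div_iff₀ hδ] at h2
      have := hin ((⌈z / (ε / 2)⌉₊ : ℝ) * (ε / 2) - z) ⟨by linarith, by linarith⟩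
      simpa using this
  have hforever : ∃ i : ℕ, ∀ j, (backMap β)^[j] (i * (ε / 2)) ∈ Icc (1 - 1 / β) (1 - ε / 2) := by
    by_contra! hno
    choose J hJ using hno
    obtain ⟨i, hi, hin⟩ := hgrid ((Finset.range (⌈1 / (ε / 2)⌉₊ + 1)).sup J)
    exact hJ i (hin _ (Finset.le_sup hi))
  obtain ⟨i, hi⟩ := hforever
  exact hP (hasPeriodicAbove_of_backMap hβ hδ hi)

end LeftCount

/-- Without periodic orbits in `[1 - 1/β, 1)` all smaller holes leave a survivor set of positive
dimension. -/
theorem dimH_survivorSet_pos_of_not_hasPeriodicAbove {β t : ℝ} (hβ : β ∈ Ioo (1 : ℝ) 2)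
    (hP : ¬ HasPeriodicAbove β) (ht : t ∈ Ioo 0 (1 - 1 / β)) : 0 < dimH (survivorSet β t) := by
  have hb0 : 0 < β := by linarith [hβ.1]
  have hinv : 0 < 1 / β := by positivity
  obtain ⟨N, hN0, hN⟩ := exists_two_le_leftCount hβ hP ht
  have hpow : ∀ k : ℕ, ∀ y ∈ Ioc (0 : ℝ) 1, (2 : ℝ) ^ k ≤ leftCount β t (N * k) y := by
    intro k
    induction k with
    | zero => intro y _; simp [leftCount]
    | succ k ih =>
      intro y hy
      have h1 := leftCount_add_ge hβ ih N y hy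
      have h2 := mul_le_mul_of_nonneg_left (hN y hy) (pow_nonneg (zero_le_two (α := ℝ)) k)
      rw [Nat.mul_succ, pow_succ]
      exact h2.trans h1
  have hNr : (1 : ℝ) ≤ N := by exact_mod_cast hN0
  -- Bernoulli's inequality gives `z ^ N ≥ 1/2`, so `z ^ (N * k)` times the count `2 ^ k` does not
  -- tend to zero.
  set z : ℝ := 1 - 1 / (2 * N) with hz
  have hzN : 1 / (2 * (N : ℝ)) ≤ 1 / 2 := by
    rw [div_le_div_iff₀ (by linarith) (by norm_num)]; linarith
  have hzN0 : 0 < 1 / (2 * (N : ℝ)) := by positivity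
  have hz2 : 1 ≤ z ^ N * 2 := by
    have h1 := one_add_mul_le_pow (a := -(1 / (2 * (N : ℝ)))) (by linarith) N
    have h2 : (N : ℝ) * -(1 / (2 * N)) = -(1 / 2) := by field_simp
    rw [h2, ← sub_eq_add_neg, ← sub_eq_add_neg] at h1
    linarith
  refine dimH_survivorSet_pos hβ (z := z) ⟨ht.1, by linarith [ht.2]⟩ ⟨by linarith, by linarith⟩ ?_
  intro hs
  have hlim := hs.tendsto_atTop_zero.comp
    (tendsto_id.const_mul_atTop' hN0 : Tendsto (fun k : ℕ => N * k) atTop atTop)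
  obtain ⟨k, hk⟩ := (hlim.eventually (gt_mem_nhds (zero_lt_one (α := ℝ)))).exists
  simp only [Function.comp_apply, tailCount_eq_leftCount hβ ht] at hk
  have h1 := hpow k 1 ⟨zero_lt_one, le_rfl⟩
  have h2 : 1 ≤ z ^ (N * k) * 2 ^ k := by
    rw [pow_mul, ← mul_pow]; exact one_le_pow₀ hz2
  have h3 := mul_le_mul_of_nonneg_left h1 (pow_nonneg (by linarith : 0 ≤ z) (N * k))
  linarith

theorem IsCriticalValue.eq_cut {β τ : ℝ} (hβ : β ∈ Ioo (1 : ℝ) 2) (hP : ¬ HasPeriodicAbove β)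
    (hτ1 : τ ≤ 1 - 1 / β) (hτ : IsCriticalValue β τ) : τ = 1 - 1 / β := by
  have hinv : 0 < 1 / β := by have := hβ.1; positivity
  refine le_antisymm hτ1 (not_lt.1 fun hlt => ?_)
  have h := (hτ τ ⟨hτ.pos.le, by linarith⟩).1
    (dimH_survivorSet_pos_of_not_hasPeriodicAbove hβ hP ⟨hτ.pos, hlt⟩)
  exact lt_irrefl _ h

/-! ### The closure of the set of orbit-minimal points -/

theorem zero_mem_orbitMinimalSet (β : ℝ) : (0 : ℝ) ∈ orbitMinimalSet β :=
  ⟨⟨le_rfl, zero_lt_one⟩, fun n => by rw [iterate_betaMap_zero]⟩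

theorem mem_forwardSet_of_mem_orbitMinimalSet {β t : ℝ} (ht : t ∈ orbitMinimalSet β) :
    t ∈ forwardSet β t := fun n => ⟨ht.2 n, (iterate_betaMap_mem_Ico ht.1 n).2⟩

theorem closure_orbitMinimalSet_subset (β : ℝ) : closure (orbitMinimalSet β) ⊆ Icc 0 1 :=
  closure_minimal (fun _ ht => Ico_subset_Icc_self ht.1) isClosed_Icc

/-- Every interval contains an interior point `s > 0` that an iterate sends to `0`. Points just
right of `s` are sent below `s`, so none of them is minimal in its orbit. -/
theorem isTotallyDisconnected_closure_orbitMinimalSet {β : ℝ} (hβ : 1 < β) :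
    IsTotallyDisconnected (closure (orbitMinimalSet β)) := by
  intro S hS hpre a ha b hb
  by_contra hne
  wlog hab : a < b generalizing a b with H
  · exact H hb ha (Ne.symm hne) (lt_of_le_of_ne (not_lt.1 hab) (Ne.symm hne))
  have hsub : Icc a b ⊆ closure (orbitMinimalSet β) := (hpre.Icc_subset ha hb).trans hS
  have ha0 := (closure_orbitMinimalSet_subset β (hS ha)).1
  have hb1 := (closure_orbitMinimalSet_subset β (hS hb)).2
  obtain ⟨n, η, hη, hηle, hend, hlt⟩ := exists_branch_end (x := (a + b) / 2) (δ := (b - a) / 4) hβ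
    ⟨by linarith, by linarith⟩ (by linarith) (by linarith)
  have hx : (a + b) / 2 ∈ Ico (0 : ℝ) 1 := ⟨by linarith, by linarith⟩
  set s := (a + b) / 2 + η with hs
  have hzero : (betaMap β)^[n + 1] s = 0 := by
    rw [Function.iterate_succ_apply', iterate_betaMap_add hβ hx hη.le hlt n le_rfl]
    refine betaMap_eq_of_eq_add (⌊β * (betaMap β)^[n] ((a + b) / 2)⌋ + 1)
      ⟨le_rfl, zero_lt_one⟩ ?_
    have hfl := Int.floor_add_fract (β * (betaMap β)^[n] ((a + b) / 2))
    rw [Function.iterate_succ_apply', betaMap, pow_succ] at hend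
    push_cast
    linarith
  have hb0 : 0 < β := by linarith
  have hev := ((tendsto_iterate_right (tendsto_betaMap hb0) (n + 1) s).mono_right
    nhdsWithin_le_nhds).eventually (gt_mem_nhds (show (betaMap β)^[n + 1] s < s by
      rw [hzero]; linarith))
  obtain ⟨u, hu, husub⟩ := mem_nhdsGE_iff_exists_Ico_subset.1 hev
  have hu' : s < min u b := lt_min hu (by linarith)
  obtain ⟨y, hy1, hy2⟩ := exists_between hu'
  have hyc : y ∈ closure (orbitMinimalSet β) :=
    hsub ⟨by linarith, (hy2.trans_le (min_le_right _ _)).le⟩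
  obtain ⟨w, hw, hwE⟩ := mem_closure_iff.1 hyc (Ioo s (min u b)) isOpen_Ioo ⟨hy1, hy2⟩
  have h1 : (betaMap β)^[n + 1] w < s := husub ⟨hw.1.le, hw.2.trans_le (min_le_left _ _)⟩
  exact absurd (hwE.2 (n + 1)) (not_le.2 (h1.trans hw.1))

theorem iterate_backMap_mem_forwardSet {β t x : ℝ} (hβ : β ∈ Ioo (1 : ℝ) 2) (ht0 : 0 ≤ t)
    (ht : t ≤ 1 - 1 / β) (hx : x ∈ forwardSet β t) (n : ℕ) :
    (backMap β)^[n] x ∈ forwardSet β t := by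
  induction n with
  | zero => exact hx
  | succ n ih =>
    rw [Function.iterate_succ_apply']
    have h0 : (backMap β)^[n] x ∈ Ico (0 : ℝ) 1 := ⟨ht0.trans (ih 0).1, (ih 0).2⟩
    have h1 := backMap_mem hβ h0
    refine mem_forwardSet_of_betaMap ⟨ht.trans h1.1, h1.2⟩ ?_
    rwa [betaMap_backMap (by linarith [hβ.1]) h0]

/-- Without periodic orbits in `[1 - 1/β, 1)` the survivors accumulate at `1`. -/
theorem exists_mem_forwardSet_gt {β t x a : ℝ} (hβ : β ∈ Ioo (1 : ℝ) 2)
    (hP : ¬ HasPeriodicAbove β) (ht0 : 0 ≤ t) (ht : t ≤ 1 - 1 / β) (hx : x ∈ forwardSet β t)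
    (ha : a < 1) : ∃ y ∈ forwardSet β t, a < y := by
  by_contra! hcon
  refine hP (hasPeriodicAbove_of_backMap (z := backMap β x) (ε := 1 - a) hβ (by linarith)
    fun n => ?_)
  rw [← Function.iterate_succ_apply]
  refine ⟨?_, by simpa using hcon _ (iterate_backMap_mem_forwardSet hβ ht0 ht hx (n + 1))⟩
  have h0 := iterate_backMap_mem_forwardSet hβ ht0 ht hx n 0
  rw [Function.iterate_succ_apply']
  exact (backMap_mem hβ ⟨ht0.trans h0.1, h0.2⟩).1

theorem nonempty_forwardSet {β t : ℝ} (hβ : β ≠ 0) (h : 0 < dimH (survivorSet β t)) :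
    (forwardSet β t).Nonempty := by
  by_contra hcon
  rw [not_nonempty_iff_eq_empty] at hcon
  rw [dimH_survivorSet_eq_zero hβ (by rw [hcon, dimH_empty])] at h
  exact lt_irrefl _ h

/-- Within `δ` to the right of `t` some branch of an iterate reaches up to `1`, and survivors of a
hole ending at `t + δ` accumulate there. Choose `t + η` on this branch to land on such a survivor
`y`. Until then its orbit is at least `η` above that of `t`, and afterwards it stays above `t + δ`.
-/
theorem exists_mem_orbitMinimalSet_right {β t δ : ℝ} (hβ : β ∈ Ioo (1 : ℝ) 2)
    (hP : ¬ HasPeriodicAbove β) (ht : t ∈ orbitMinimalSet β) (hδ : 0 < δ)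
    (htδ : t + δ < 1 - 1 / β) : ∃ x ∈ orbitMinimalSet β, x ∈ Ioc t (t + δ) := by
  have hb := hβ.1
  have hb0 : 0 < β := by linarith
  have hinv : 0 < 1 / β := by positivity
  have ht0 := ht.1.1
  obtain ⟨n, η₀, hη₀, hη₀δ, hend, hlt⟩ := exists_branch_end hb ht.1 hδ (by linarith)
  obtain ⟨y₀, hy₀⟩ := nonempty_forwardSet (t := t + δ) hb0.ne'
    (dimH_survivorSet_pos_of_not_hasPeriodicAbove hβ hP ⟨by linarith, htδ⟩)
  obtain ⟨y, hy, hyt⟩ := exists_mem_forwardSet_gt hβ hP (by linarith) htδ.le hy₀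
    (iterate_betaMap_mem_Ico (β := β) ht.1 (n + 1)).2
  have hpow : 0 < β ^ (n + 1) := by positivity
  set η := (y - (betaMap β)^[n + 1] t) / β ^ (n + 1) with hη
  have hηmul : β ^ (n + 1) * η = y - (betaMap β)^[n + 1] t := mul_div_cancel₀ _ hpow.ne'
  have hη0 : 0 < η := div_pos (by linarith) hpow
  have hηlt : η < η₀ := by
    have : β ^ (n + 1) * η < β ^ (n + 1) * η₀ := by linarith [(hy 0).2, show y < 1 from (hy 0).2]
    exact lt_of_mul_lt_mul_left this hpow.le
  have hshadow := iterate_betaMap_add (n := n + 1) hb ht.1 hη0.le (by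
    intro j hj
    rcases Nat.lt_or_ge j (n + 1) with h | h
    · have h1 := hlt j (by omega)
      have h2 : β ^ j * η ≤ β ^ j * η₀ := by gcongr
      linarith
    · rw [show j = n + 1 by omega, hηmul]
      linarith [show y < 1 from (hy 0).2])
  refine ⟨t + η, ⟨⟨by linarith, by linarith⟩, fun j => ?_⟩, by linarith, by linarith⟩
  rcases Nat.lt_or_ge (n + 1) j with h | h
  · obtain ⟨k, rfl⟩ := Nat.exists_eq_add_of_lt h
    rw [show n + 1 + k + 1 = (k + 1) + (n + 1) by ring, Function.iterate_add_apply,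
      hshadow _ le_rfl, hηmul]
    have h1 := (hy (k + 1)).1
    rw [show (betaMap β)^[n + 1] t + (y - (betaMap β)^[n + 1] t) = y by ring]
    linarith
  · rw [hshadow j h]
    have h1 := ht.2 j
    have h2 : η ≤ β ^ j * η := le_mul_of_one_le_left hη0.le (one_le_pow₀ hb.le)
    linarith

/-- A survivor `y` near `1` has the same image as `y - 1/β`, which lies just below `1 - 1/β`. The
infimum of the orbit of the latter is the required point. -/
theorem exists_mem_orbitMinimalSet_left {β s : ℝ} (hβ : β ∈ Ioo (1 : ℝ) 2)
    (hP : ¬ HasPeriodicAbove β) (hc : 1 - 1 / β ∈ orbitMinimalSet β)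
    (hs : s ∈ Ioo 0 (1 - 1 / β)) : ∃ x ∈ orbitMinimalSet β, x ∈ Ico s (1 - 1 / β) := by
  have hb := hβ.1
  have hb0 : 0 < β := by linarith
  have hinv : 0 < 1 / β := by positivity
  obtain ⟨y, hy, hys⟩ := exists_mem_forwardSet_gt (a := s + 1 / β) hβ hP (cut_pos hb).le le_rfl
    (mem_forwardSet_of_mem_orbitMinimalSet hc) (by linarith [hs.2])
  have hy1 : y < 1 := (hy 0).2
  have hmap : betaMap β (y - 1 / β) = betaMap β y := by
    rw [betaMap_of_le hβ (by linarith [hs.1]) hy1.le, betaMap_of_lt hb (by linarith [hs.1])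
      (by linarith [cut_lt_inv hβ])]
    field_simp
  have hx : y - 1 / β ∈ forwardSet β s := by
    refine mem_forwardSet_of_betaMap ⟨by linarith, by linarith⟩ ?_
    rw [hmap]
    exact forwardSet_anti hs.2.le (betaMap_mem_forwardSet hy)
  refine ⟨_, sInf_orbit_mem hb0 ⟨hs.1.le.trans (hx 0).1, (hx 0).2⟩, ?_, ?_⟩
  · refine le_csInf (range_nonempty _) ?_
    rintro _ ⟨n, rfl⟩
    exact (hx n).1
  · refine lt_of_le_of_lt (csInf_le ⟨s, ?_⟩ ⟨0, rfl⟩) (by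
      simp only [Function.iterate_zero, id]; linarith)
    rintro _ ⟨n, rfl⟩
    exact (hx n).1

theorem preperfect_orbitMinimalSet {β : ℝ} (hβ : β ∈ Ioo (1 : ℝ) 2) (hP : ¬ HasPeriodicAbove β) :
    Preperfect (orbitMinimalSet β) := by
  intro t ht
  rw [accPt_iff_nhds]
  intro U hU
  obtain ⟨δ, hδ, hsub⟩ := Metric.mem_nhds_iff.1 hU
  have hc := cut_pos hβ.1
  rcases lt_trichotomy t (1 - 1 / β) with h | rfl | h
  · have hm : 0 < min (δ / 2) ((1 - 1 / β - t) / 2) := lt_min (by linarith) (by linarith)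
    have h1 := min_le_left (δ / 2) ((1 - 1 / β - t) / 2)
    have h2 := min_le_right (δ / 2) ((1 - 1 / β - t) / 2)
    obtain ⟨x, hxE, hx1, hx2⟩ := exists_mem_orbitMinimalSet_right hβ hP ht hm (by linarith)
    refine ⟨x, ⟨hsub ?_, hxE⟩, hx1.ne'⟩
    rw [Metric.mem_ball, Real.dist_eq, abs_lt]
    constructor <;> linarith
  · have h1 := le_max_left (1 - 1 / β - δ / 2) ((1 - 1 / β) / 2)
    have h2 := le_max_right (1 - 1 / β - δ / 2) ((1 - 1 / β) / 2)
    obtain ⟨x, hxE, hx1, hx2⟩ := exists_mem_orbitMinimalSet_left hβ hP ht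
      (s := max (1 - 1 / β - δ / 2) ((1 - 1 / β) / 2))
      ⟨by linarith, max_lt (by linarith) (by linarith)⟩
    refine ⟨x, ⟨hsub ?_, hxE⟩, hx2.ne⟩
    rw [Metric.mem_ball, Real.dist_eq, abs_lt]
    constructor <;> linarith
  · exact absurd (hasPeriodicAbove_of_mem_forwardSet hβ h
      (mem_forwardSet_of_mem_orbitMinimalSet ht)) hP

theorem isCantorSet_of_not_hasPeriodicAbove {β : ℝ} (hβ : β ∈ Ioo (1 : ℝ) 2)
    (hP : ¬ HasPeriodicAbove β) : IsCantorSet (closure (orbitMinimalSet β)) where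
  nonempty := ⟨0, subset_closure (zero_mem_orbitMinimalSet β)⟩
  isCompact := isCompact_Icc.of_isClosed_subset isClosed_closure (closure_orbitMinimalSet_subset β)
  perfect := (preperfect_orbitMinimalSet hβ hP).perfect_closure
  isTotallyDisconnected := isTotallyDisconnected_closure_orbitMinimalSet hβ.1

/-! ### Series with binary digits -/

/-- The number `∑ s n x ^ (n + 1)` with binary digits `s n`. -/
noncomputable def digitSeries (s : ℕ → Bool) (x : ℝ) : ℝ := ∑' n, ((s n).toNat : ℝ) * x ^ (n + 1)

/-- The number of digits `1` among the first `n` digits. -/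
def prefixCount (s : ℕ → Bool) (n : ℕ) : ℕ := ∑ i ∈ Finset.range n, (s i).toNat

theorem prefixCount_succ (s : ℕ → Bool) (n : ℕ) :
    prefixCount s (n + 1) = prefixCount s n + (s n).toNat := Finset.sum_range_succ _ _

theorem prefixCount_add (s : ℕ → Bool) (m n : ℕ) :
    prefixCount s (m + n) = prefixCount s m + prefixCount (fun i => s (m + i)) n :=
  Finset.sum_range_add _ _ _

theorem eq_of_prefixCount_eq {s s' : ℕ → Bool} (h : ∀ n, prefixCount s n = prefixCount s' n) :
    s = s' := by
  funext n
  have h1 := h (n + 1)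
  rw [prefixCount_succ, prefixCount_succ, h n] at h1
  cases h2 : s n <;> cases h3 : s' n <;> simp [h2, h3] at h1 ⊢

theorem toNat_cast_mem (b : Bool) : ((b.toNat : ℕ) : ℝ) ∈ Icc (0 : ℝ) 1 := by
  cases b <;> simp

theorem summable_digitSeries (s : ℕ → Bool) {x : ℝ} (hx : x ∈ Ico (0 : ℝ) 1) :
    Summable fun n => ((s n).toNat : ℝ) * x ^ (n + 1) := by
  refine Summable.of_nonneg_of_le (fun n => ?_) (fun n => ?_)
    ((summable_geometric_of_lt_one hx.1 hx.2).comp_injective (add_left_injective 1))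
  · exact mul_nonneg (toNat_cast_mem _).1 (pow_nonneg hx.1 _)
  · exact mul_le_of_le_one_left (pow_nonneg hx.1 _) (toNat_cast_mem _).2

theorem digitSeries_eq (s : ℕ → Bool) {x : ℝ} (hx : x ∈ Ico (0 : ℝ) 1) :
    digitSeries s x = x * ((s 0).toNat + digitSeries (fun n => s (n + 1)) x) := by
  rw [digitSeries, (summable_digitSeries s hx).tsum_eq_zero_add, digitSeries, mul_add,
    ← tsum_mul_left]
  congr 1
  · ring
  · congr 1
    funext n
    ring

theorem digitSeries_nonneg (s : ℕ → Bool) {x : ℝ} (hx : 0 ≤ x) : 0 ≤ digitSeries s x :=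
  tsum_nonneg fun _ => mul_nonneg (toNat_cast_mem _).1 (pow_nonneg hx _)

theorem digitSeries_le (s : ℕ → Bool) {x : ℝ} (hx : x ∈ Ico (0 : ℝ) 1) :
    digitSeries s x ≤ x / (1 - x) := by
  have hgeo : ∑' n : ℕ, x ^ (n + 1) = x / (1 - x) := by
    simp_rw [pow_succ]
    rw [tsum_mul_right, tsum_geometric_of_lt_one hx.1 hx.2]
    ring
  rw [← hgeo]
  refine (summable_digitSeries s hx).tsum_le_tsum (fun n => ?_)
    ((summable_geometric_of_lt_one hx.1 hx.2).comp_injective (add_left_injective 1))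
  exact mul_le_of_le_one_left (pow_nonneg hx.1 _) (toNat_cast_mem _).2

/-- The recursion determines its bounded solution: after `n` steps the difference of two solutions
carries the factor `x ^ n`. -/
theorem eq_digitSeries {s : ℕ → Bool} {x : ℝ} (hx : x ∈ Ico (0 : ℝ) 1) {y : ℕ → ℝ}
    (hy : ∀ n, y n ∈ Icc (0 : ℝ) 1) (h : ∀ n, y n = x * ((s n).toNat + y (n + 1))) :
    y 0 = digitSeries s x := by
  have hit : ∀ n, y 0 - digitSeries s x = x ^ n * (y n - digitSeries (fun i => s (n + i)) x) := by
    intro n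
    induction n with
    | zero => simp
    | succ n ih =>
      rw [ih, h n, digitSeries_eq _ hx]
      simp only [add_zero, pow_succ]
      have : (fun i => s (n + (i + 1))) = fun i => s (n + 1 + i) := by
        funext i; congr 1; ring
      rw [this]; ring
  have hlim : Tendsto (fun n : ℕ => x ^ n * (1 + x / (1 - x))) atTop (𝓝 0) := by
    simpa using (tendsto_pow_atTop_nhds_zero_of_lt_one hx.1 hx.2).mul_const (1 + x / (1 - x))
  rw [← sub_eq_zero]
  refine abs_nonpos_iff.1 (ge_of_tendsto' hlim fun n => ?_)
  rw [hit n, abs_mul, abs_of_nonneg (pow_nonneg hx.1 n)]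
  refine mul_le_mul_of_nonneg_left ?_ (pow_nonneg hx.1 n)
  have h1 := digitSeries_nonneg (fun i => s (n + i)) hx.1
  have h2 := digitSeries_le (fun i => s (n + i)) hx
  rw [abs_le]
  constructor <;> linarith [(hy n).1, (hy n).2]

theorem digitSeries_le_of_prefixCount_le {s s' : ℕ → Bool} {x : ℝ} (hx : x ∈ Ico (0 : ℝ) 1)
    (h : ∀ n, prefixCount s n ≤ prefixCount s' n) : digitSeries s x ≤ digitSeries s' x := by
  -- Summation by parts: the weights `x ^ n` decrease, so earlier digits `1` only help. The surplus
  -- of digits is kept with the current weight to make the induction work.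
  have hfin : ∀ n, x ^ n * ((prefixCount s' n : ℝ) - prefixCount s n) ≤
      ∑ i ∈ Finset.range n, ((s' i).toNat : ℝ) * x ^ (i + 1) -
        ∑ i ∈ Finset.range n, ((s i).toNat : ℝ) * x ^ (i + 1) := by
    intro n
    induction n with
    | zero => simp [prefixCount]
    | succ n ih =>
      rw [Finset.sum_range_succ, Finset.sum_range_succ, prefixCount_succ, prefixCount_succ]
      push_cast
      have h1 : 0 ≤ (prefixCount s' n : ℝ) - prefixCount s n := by
        rw [sub_nonneg]; exact_mod_cast h n
      have h2 : x ^ (n + 1) * ((prefixCount s' n : ℝ) - prefixCount s n) ≤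
          x ^ n * ((prefixCount s' n : ℝ) - prefixCount s n) := by
        refine mul_le_mul_of_nonneg_right ?_ h1
        exact pow_le_pow_of_le_one hx.1 hx.2.le (by omega)
      nlinarith
  refine le_of_tendsto_of_tendsto' (summable_digitSeries s hx).hasSum.tendsto_sum_nat
    (summable_digitSeries s' hx).hasSum.tendsto_sum_nat fun n => ?_
  have h1 := hfin n
  have h2 : 0 ≤ x ^ n * ((prefixCount s' n : ℝ) - prefixCount s n) := by
    refine mul_nonneg (pow_nonneg hx.1 n) ?_
    rw [sub_nonneg]; exact_mod_cast h n
  linarith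

theorem digitSeries_mono (s : ℕ → Bool) {x y : ℝ} (hx : 0 ≤ x) (hxy : x ≤ y) (hy : y < 1) :
    digitSeries s x ≤ digitSeries s y := by
  refine (summable_digitSeries s ⟨hx, hxy.trans_lt hy⟩).tsum_le_tsum (fun n => ?_)
    (summable_digitSeries s ⟨hx.trans hxy, hy⟩)
  exact mul_le_mul_of_nonneg_left (pow_le_pow_left₀ hx hxy _) (toNat_cast_mem _).1

theorem digitSeries_strictMono {s : ℕ → Bool} {m : ℕ} (hs : s m = true) {x y : ℝ} (hx : 0 ≤ x)
    (hxy : x < y) (hy : y < 1) : digitSeries s x < digitSeries s y := by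
  refine Summable.tsum_lt_tsum (i := m) (fun n => ?_) ?_
    (summable_digitSeries s ⟨hx, hxy.trans hy⟩) (summable_digitSeries s ⟨hx.trans hxy.le, hy⟩)
  · exact mul_le_mul_of_nonneg_left (pow_le_pow_left₀ hx hxy.le _) (toNat_cast_mem _).1
  · rw [hs]
    simpa using pow_lt_pow_left₀ hxy hx (Nat.succ_ne_zero m)

theorem one_div_mem_Ico {β : ℝ} (hβ : 1 < β) : 1 / β ∈ Ico (0 : ℝ) 1 :=
  ⟨by positivity, inv_lt_one_of hβ⟩

/-! ### Itineraries -/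

/-- The digits of `x` under the map `x ↦ β x (mod 1)`. -/
noncomputable def itinerary (β x : ℝ) : ℕ → Bool := fun n => decide (1 / β ≤ (betaMap β)^[n] x)

theorem itinerary_add (β x : ℝ) (m : ℕ) :
    (fun i => itinerary β x (m + i)) = itinerary β ((betaMap β)^[m] x) := by
  funext i
  rw [itinerary, itinerary, ← Function.iterate_add_apply, add_comm]

theorem eq_digitSeries_itinerary {β x : ℝ} (hβ : β ∈ Ioo (1 : ℝ) 2) (hx : x ∈ Ico (0 : ℝ) 1) :
    x = digitSeries (itinerary β x) (1 / β) := by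
  have hb0 : 0 < β := by linarith [hβ.1]
  refine eq_digitSeries (one_div_mem_Ico hβ.1) (y := fun n => (betaMap β)^[n] x)
    (fun n => Ico_subset_Icc_self (iterate_betaMap_mem_Ico hx n)) fun n => ?_
  have hn := iterate_betaMap_mem_Ico (β := β) hx n
  simp only [Function.iterate_succ_apply', itinerary]
  rcases lt_or_ge ((betaMap β)^[n] x) (1 / β) with h | h
  · rw [betaMap_of_lt hβ.1 hn.1 h, decide_eq_false (not_le.2 h)]
    simp only [Bool.toNat_false, Nat.cast_zero]
    field_simp
    ring
  · rw [betaMap_of_le hβ h hn.2.le, decide_eq_true h]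
    simp only [Bool.toNat_true, Nat.cast_one]
    field_simp
    ring

/-- The map preserves the cyclic order on orbits that stay in `[1 - 1/β, 1)`. -/
theorem prefixCount_itinerary_or {β x y : ℝ} (hβ : β ∈ Ioo (1 : ℝ) 2)
    (hx : x ∈ forwardSet β (1 - 1 / β)) (hy : y ∈ forwardSet β (1 - 1 / β)) (hxy : x ≤ y) (n : ℕ) :
    (prefixCount (itinerary β y) n = prefixCount (itinerary β x) n ∧
      (betaMap β)^[n] x ≤ (betaMap β)^[n] y) ∨
    (prefixCount (itinerary β y) n = prefixCount (itinerary β x) n + 1 ∧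
      (betaMap β)^[n] y < (betaMap β)^[n] x) := by
  have hc := cut_pos hβ.1
  have hb0 : 0 < β := by linarith [hβ.1]
  -- Points below `1/β` map into `[β - 1, 1)` and the others below `β - 1`. The order therefore
  -- flips exactly when the two digits differ, and the count difference switches between `0` and
  -- `1`.
  have hlow : ∀ z ∈ Ico (1 - 1 / β) 1, z < 1 / β → betaMap β z = β * z ∧ β - 1 ≤ β * z := by
    intro z hz h
    refine ⟨betaMap_of_lt hβ.1 (hc.le.trans hz.1) h, ?_⟩
    rw [← mul_cut hβ.1]
    exact mul_le_mul_of_nonneg_left hz.1 hb0.le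
  have hhigh : ∀ z ∈ Ico (1 - 1 / β) 1, 1 / β ≤ z →
      betaMap β z = β * z - 1 ∧ β * z - 1 < β - 1 := by
    intro z hz h
    refine ⟨betaMap_of_le hβ h hz.2.le, ?_⟩
    have := mul_lt_mul_of_pos_left hz.2 hb0
    linarith
  induction n with
  | zero => exact Or.inl ⟨rfl, hxy⟩
  | succ n ih =>
    have hxn := hx n
    have hyn := hy n
    simp only [prefixCount_succ, Function.iterate_succ_apply']
    set u := (betaMap β)^[n] x with hu
    set v := (betaMap β)^[n] y with hv
    have hiu : itinerary β x n = decide (1 / β ≤ u) := rfl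
    have hiv : itinerary β y n = decide (1 / β ≤ v) := rfl
    rw [hiu, hiv]
    rcases lt_or_ge u (1 / β) with h1 | h1 <;> rcases lt_or_ge v (1 / β) with h2 | h2
    · rw [(hlow u hxn h1).1, (hlow v hyn h2).1, decide_eq_false (not_le.2 h1),
        decide_eq_false (not_le.2 h2)]
      rcases ih with ⟨h3, h4⟩ | ⟨h3, h4⟩
      · exact Or.inl ⟨by simp [h3], by gcongr⟩
      · exact Or.inr ⟨by simp [h3], by gcongr⟩
    · have h5 := (hlow u hxn h1).2
      have h6 := (hhigh v hyn h2).2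
      rw [(hlow u hxn h1).1, (hhigh v hyn h2).1, decide_eq_false (not_le.2 h1), decide_eq_true h2]
      rcases ih with ⟨h3, -⟩ | ⟨-, h4⟩
      · exact Or.inr ⟨by simp [h3], by linarith⟩
      · linarith
    · have h5 := (hhigh u hxn h1).2
      have h6 := (hlow v hyn h2).2
      rw [(hhigh u hxn h1).1, (hlow v hyn h2).1, decide_eq_true h1, decide_eq_false (not_le.2 h2)]
      rcases ih with ⟨-, h4⟩ | ⟨h3, -⟩
      · linarith
      · exact Or.inl ⟨by simp [h3], by linarith⟩
    · rw [(hhigh u hxn h1).1, (hhigh v hyn h2).1, decide_eq_true h1, decide_eq_true h2]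
      rcases ih with ⟨h3, h4⟩ | ⟨h3, h4⟩
      · exact Or.inl ⟨by simp [h3], by gcongr⟩
      · exact Or.inr ⟨by simp [h3], by gcongr⟩

theorem prefixCount_itinerary_add {β x : ℝ} (m n : ℕ) :
    prefixCount (itinerary β x) (m + n) =
      prefixCount (itinerary β x) m + prefixCount (itinerary β ((betaMap β)^[m] x)) n := by
  rw [prefixCount_add, itinerary_add]

section Minimal

variable {β x : ℝ}

theorem mem_forwardSet_cut_of_le (hxE : x ∈ orbitMinimalSet β) (hx : 1 - 1 / β ≤ x) :
    x ∈ forwardSet β (1 - 1 / β) :=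
  forwardSet_anti hx (mem_forwardSet_of_mem_orbitMinimalSet hxE)

/-- The minimum `x` is compared with the later point `T^m x ≥ x`: over the same time their digit
counts differ by at most one. -/
theorem prefixCount_add_bounds (hβ : β ∈ Ioo (1 : ℝ) 2) (hxE : x ∈ orbitMinimalSet β)
    (hx : 1 - 1 / β ≤ x) (m n : ℕ) :
    prefixCount (itinerary β x) m + prefixCount (itinerary β x) n ≤
      prefixCount (itinerary β x) (m + n) ∧
    prefixCount (itinerary β x) (m + n) ≤
      prefixCount (itinerary β x) m + prefixCount (itinerary β x) n + 1 := by
  have hf := mem_forwardSet_cut_of_le hxE hx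
  have := prefixCount_itinerary_or hβ hf (iterate_mem_forwardSet hf m) (hxE.2 m) n
  rw [prefixCount_itinerary_add]
  omega

theorem prefixCount_mul_bounds (hβ : β ∈ Ioo (1 : ℝ) 2) (hxE : x ∈ orbitMinimalSet β)
    (hx : 1 - 1 / β ≤ x) (j n : ℕ) :
    (n + 1) * prefixCount (itinerary β x) j ≤ prefixCount (itinerary β x) ((n + 1) * j) ∧
    prefixCount (itinerary β x) ((n + 1) * j) ≤ (n + 1) * prefixCount (itinerary β x) j + n := by
  induction n with
  | zero => simp
  | succ n ih =>
    have h := prefixCount_add_bounds hβ hxE hx ((n + 1) * j) j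
    rw [show (n + 1 + 1) * j = (n + 1) * j + j by ring,
      show (n + 1 + 1) * prefixCount (itinerary β x) j =
        (n + 1) * prefixCount (itinerary β x) j + prefixCount (itinerary β x) j by ring]
    omega

end Minimal

/-! ### The digits of a rotation -/

/-- The digits of the rotation `r ↦ r + k (mod q)`: a digit is `1` when the rotation wraps. -/
def rankSeq (k q r : ℕ) : ℕ → Bool := fun j => decide (q ≤ (r + j * k) % q + k)

/-- The number in base `β` whose digits are those of the rotation by `k (mod q)` started at `r`. -/
noncomputable def rankValue (β : ℝ) (k q r : ℕ) : ℝ := digitSeries (rankSeq k q r) (1 / β)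

theorem rankSeq_add (k q r n : ℕ) :
    (fun i => rankSeq k q r (n + i)) = rankSeq k q (r + n * k) := by
  funext i
  simp only [rankSeq]
  congr 3
  ring_nf

theorem rankSeq_mod (k q r : ℕ) : rankSeq k q (r % q) = rankSeq k q r := by
  funext i
  simp only [rankSeq, Nat.mod_add_mod]

theorem rankValue_mod (β : ℝ) (k q r : ℕ) : rankValue β k q (r % q) = rankValue β k q r := by
  rw [rankValue, rankSeq_mod, rankValue]

/-- The digits mark the wraps of the rotation, and the number of wraps is a quotient by `q`. -/
theorem prefixCount_rankSeq {k q r : ℕ} (hk : k < q) (n : ℕ) :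
    r / q + prefixCount (rankSeq k q r) n = (r + n * k) / q := by
  induction n with
  | zero => simp [prefixCount]
  | succ n ih =>
    rw [prefixCount_succ, ← add_assoc, ih, show r + (n + 1) * k = r + n * k + k by ring,
      Nat.add_div (a := r + n * k) (b := k) (by omega), Nat.div_eq_of_lt hk, Nat.mod_eq_of_lt hk,
      rankSeq, add_zero]
    by_cases h : q ≤ (r + n * k) % q + k <;> simp [h]

theorem prefixCount_rankSeq_zero {k q : ℕ} (hk : k < q) (n : ℕ) :
    prefixCount (rankSeq k q 0) n = n * k / q := by
  have := prefixCount_rankSeq (r := 0) hk n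
  simpa using this

theorem rankValue_mono {β : ℝ} (hβ : 1 < β) {k q r r' : ℕ} (hk : k < q) (hr : r ≤ r')
    (hr' : r' < q) : rankValue β k q r ≤ rankValue β k q r' := by
  refine digitSeries_le_of_prefixCount_le (one_div_mem_Ico hβ) fun n => ?_
  have h1 := prefixCount_rankSeq (r := r) hk n
  have h2 := prefixCount_rankSeq (r := r') hk n
  rw [Nat.div_eq_of_lt (hr.trans_lt hr'), zero_add] at h1
  rw [Nat.div_eq_of_lt hr', zero_add] at h2
  rw [h1, h2]
  gcongr

theorem rankValue_bounds {β : ℝ} (hβ : 1 < β) {k q : ℕ} (hk : k < q) (r : ℕ) :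
    rankValue β k q 0 ≤ rankValue β k q r ∧ rankValue β k q r ≤ rankValue β k q (q - 1) := by
  have hr := Nat.mod_lt r (by omega : 0 < q)
  rw [← rankValue_mod β k q r]
  exact ⟨rankValue_mono hβ hk (Nat.zero_le _) hr, rankValue_mono hβ hk (by omega) (by omega)⟩

theorem mul_rankValue {β : ℝ} (hβ : 1 < β) (k q r : ℕ) :
    β * rankValue β k q r = (rankSeq k q r 0).toNat + rankValue β k q (r + k) := by
  rw [rankValue, digitSeries_eq _ (one_div_mem_Ico hβ), rankValue, ← mul_assoc]
  have h1 : β * (1 / β) = 1 := by field_simp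
  have h2 := rankSeq_add k q r 1
  rw [one_mul] at h2
  rw [h1, one_mul, ← h2]
  simp only [add_comm]

theorem rankSeq_zero_iff (k q r : ℕ) : rankSeq k q r 0 = decide (q ≤ r % q + k) := by
  simp [rankSeq]

theorem mul_mod_pos {k q j : ℕ} (hcop : k.Coprime q) (hj : 0 < j) (hjq : j < q) :
    0 < j * k % q := by
  rw [Nat.pos_iff_ne_zero]
  intro h0
  have := Nat.Coprime.dvd_of_dvd_mul_right hcop.symm (Nat.dvd_of_mod_eq_zero h0)
  exact absurd (Nat.le_of_dvd hj this) (not_le.2 hjq)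

theorem pred_add_mul_mod {k q j : ℕ} (hcop : k.Coprime q) (hj : 0 < j) (hjq : j < q) :
    (q - 1 + j * k) % q = j * k % q - 1 := by
  have h0 := mul_mod_pos hcop hj hjq
  have h1 : j * k = q * (j * k / q) + j * k % q := (Nat.div_add_mod _ _).symm
  have h2 := Nat.mod_lt (j * k) (by omega : 0 < q)
  have h3 : q - 1 + j * k = (j * k % q - 1) + q * (j * k / q + 1) := by
    rw [mul_add, mul_one]; omega
  rw [h3, Nat.add_mul_mod_self_left, Nat.mod_eq_of_lt (by omega)]

theorem pred_mul_mod {k q : ℕ} (hk0 : 0 < k) (hk : k < q) : (q - 1) * k % q = q - k := by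
  have h5 : (q - 1) * k = (q - k) + q * (k - 1) := by
    zify [show 1 ≤ q by omega, hk.le, show 1 ≤ k by omega]
    ring
  rw [h5, Nat.add_mul_mod_self_left, Nat.mod_eq_of_lt (by omega)]

/-- Apart from the first and the last digit of the period, the digits of the largest and of the
smallest point of the orbit agree. -/
theorem rankSeq_pred_eq {k q j : ℕ} (hk : k < q) (hcop : k.Coprime q) (hj : 0 < j)
    (hjq : j + 1 < q) : rankSeq k q (q - 1) j = rankSeq k q 0 j := by
  have h1 := mul_mod_pos hcop hj (by omega)
  have h2 : j * k % q + k ≠ q := by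
    intro h2
    have h3 := mul_mod_pos hcop (Nat.succ_pos j) hjq
    rw [Nat.succ_mul, Nat.add_mod, Nat.mod_eq_of_lt hk, h2, Nat.mod_self] at h3
    omega
  rw [rankSeq, rankSeq, pred_add_mul_mod hcop hj (by omega), zero_add]
  exact decide_eq_decide.2 (by omega)

/-- The rotation by `k (mod q)` is realized in base `β` inside `[1 - 1/β, 1)`. -/
structure RealizesRotation (β : ℝ) (k q : ℕ) : Prop where
  pos : 0 < k
  lt : k < q
  coprime : k.Coprime q
  cut_le : 1 - 1 / β ≤ rankValue β k q 0
  lt_one : rankValue β k q (q - 1) < 1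

/-! ### Consequences of a realized rotation: an empty gap and an isolated point -/

namespace RealizesRotation

variable {β : ℝ} {k q : ℕ}

theorem mem (h : RealizesRotation β k q) (hβ : 1 < β) (r : ℕ) :
    rankValue β k q r ∈ Ico (1 - 1 / β) 1 :=
  ⟨h.cut_le.trans (rankValue_bounds hβ h.lt r).1,
    (rankValue_bounds hβ h.lt r).2.trans_lt h.lt_one⟩

theorem betaMap_rankValue (h : RealizesRotation β k q) (hβ : 1 < β) (r : ℕ) :
    betaMap β (rankValue β k q r) = rankValue β k q (r + k) := by
  have hm := h.mem hβ (r + k)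
  refine betaMap_eq_of_eq_add (rankSeq k q r 0).toNat ⟨(cut_pos hβ).le.trans hm.1, hm.2⟩ ?_
  rw [mul_rankValue hβ]
  simp

theorem iterate_rankValue (h : RealizesRotation β k q) (hβ : 1 < β) (r n : ℕ) :
    (betaMap β)^[n] (rankValue β k q r) = rankValue β k q (r + n * k) := by
  induction n with
  | zero => simp
  | succ n ih => rw [Function.iterate_succ_apply', ih, h.betaMap_rankValue hβ]; congr 1; ring

theorem iterate_period (h : RealizesRotation β k q) (hβ : 1 < β) :
    (betaMap β)^[q] (rankValue β k q 0) = rankValue β k q 0 := by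
  rw [h.iterate_rankValue hβ, zero_add, ← rankValue_mod, Nat.mul_mod_right]

theorem mem_forwardSet (h : RealizesRotation β k q) (hβ : 1 < β) (r : ℕ) :
    rankValue β k q r ∈ forwardSet β (1 - 1 / β) := fun n => by
  rw [h.iterate_rankValue hβ]; exact h.mem hβ _

theorem hasPeriodicAbove (h : RealizesRotation β k q) (hβ : 1 < β) : HasPeriodicAbove β :=
  ⟨_, q, h.pos.trans h.lt, h.iterate_period hβ, h.mem_forwardSet hβ 0⟩

theorem mem_orbitMinimalSet (h : RealizesRotation β k q) (hβ : 1 < β) :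
    rankValue β k q 0 ∈ orbitMinimalSet β := by
  have hm := h.mem hβ 0
  refine ⟨⟨(cut_pos hβ).le.trans hm.1, hm.2⟩, fun n => ?_⟩
  rw [h.iterate_rankValue hβ]
  exact (rankValue_bounds hβ h.lt _).1

theorem itinerary_rankValue (h : RealizesRotation β k q) (hβ : 1 < β) :
    itinerary β (rankValue β k q 0) = rankSeq k q 0 := by
  have hb0 : 0 < β := by linarith
  funext n
  rw [itinerary, h.iterate_rankValue hβ]
  have h1 := mul_rankValue hβ k q (0 + n * k)
  have hm := h.mem hβ (0 + n * k + k)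
  have h2 : rankSeq k q 0 n = rankSeq k q (0 + n * k) 0 := by simp [rankSeq]
  rw [h2]
  cases hd : rankSeq k q (0 + n * k) 0
  · rw [hd, Bool.toNat_false, Nat.cast_zero] at h1
    rw [decide_eq_false_iff_not, not_le, lt_div_iff₀ hb0, mul_comm, h1]
    linarith [hm.2]
  · rw [hd, Bool.toNat_true, Nat.cast_one] at h1
    rw [decide_eq_true_iff, div_le_iff₀ hb0, mul_comm, h1]
    linarith [cut_pos hβ, hm.1]

/-- The distance between the two extreme points of the orbit. -/
theorem rankValue_gap {β : ℝ} (hβ : 1 < β) {k q : ℕ} (hk0 : 0 < k) (hk : k < q)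
    (hcop : k.Coprime q) :
    (rankValue β k q (q - 1) - rankValue β k q 0) * (1 - (1 / β) ^ q) = 1 / β - (1 / β) ^ q := by
  have hb0 : 0 < β := by linarith
  set b := 1 / β with hb
  have hbβ : b * β = 1 := by rw [hb]; field_simp
  -- The gap between the orbits of the largest and the smallest point, followed around one period.
  -- The digits differ as `1, 0` at the start and as `0, 1` at the end and agree in between, so the
  -- recursion closes up to a linear equation for `G 0`.
  set G : ℕ → ℝ := fun j => rankValue β k q (q - 1 + j * k) - rankValue β k q (j * k) with hG
  have hstep : ∀ j, G j = b * (((rankSeq k q (q - 1 + j * k) 0).toNat : ℝ) -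
      (rankSeq k q (j * k) 0).toNat + G (j + 1)) := by
    intro j
    have h1 := mul_rankValue hβ k q (q - 1 + j * k)
    have h2 := mul_rankValue hβ k q (j * k)
    rw [show q - 1 + j * k + k = q - 1 + (j + 1) * k by ring] at h1
    rw [show j * k + k = (j + 1) * k by ring] at h2
    simp only [hG]
    linear_combination b * h1 - b * h2 - (rankValue β k q (q - 1 + j * k) -
      rankValue β k q (j * k)) * hbβ
  have h0 : G 0 = b * (1 + G 1) := by
    rw [hstep 0, rankSeq_zero_iff, rankSeq_zero_iff, zero_mul, add_zero, Nat.zero_mod,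
      Nat.mod_eq_of_lt (by omega : q - 1 < q), decide_eq_true (by omega),
      decide_eq_false (by omega)]
    simp
  have hmid : ∀ j, 0 < j → j + 1 < q → G j = b * G (j + 1) := by
    intro j hj hjq
    have h3 : rankSeq k q (q - 1 + j * k) 0 = rankSeq k q (j * k) 0 := by
      simpa [rankSeq] using rankSeq_pred_eq hk hcop hj hjq
    rw [hstep j, h3, sub_self, zero_add]
  have hlast : G (q - 1) = b * (-1 + G 0) := by
    have h1 := pred_add_mul_mod hcop (by omega : 0 < q - 1) (by omega)
    have h4 := pred_mul_mod hk0 hk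
    have h6 : G (q - 1 + 1) = G 0 := by
      simp only [hG]
      rw [show q - 1 + 1 = q by omega, ← rankValue_mod β k q (q - 1 + q * k),
        Nat.add_mul_mod_self_left, rankValue_mod, ← rankValue_mod β k q (q * k),
        Nat.mul_mod_right, zero_mul, add_zero]
    rw [hstep (q - 1), rankSeq_zero_iff, rankSeq_zero_iff, h1, h4, h6,
      decide_eq_false (by omega), decide_eq_true (by omega)]
    simp
  have hchain : ∀ i, i + 2 ≤ q → G 1 = b ^ i * G (i + 1) := by
    intro i
    induction i with
    | zero => intro _; simp
    | succ i ih =>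
      intro hi
      rw [ih (by omega), hmid (i + 1) (by omega) (by omega), pow_succ]
      ring
  have h7 := hchain (q - 2) (by omega)
  rw [show q - 2 + 1 = q - 1 by omega, hlast] at h7
  have h8 : b ^ q = b ^ (q - 2) * b * b := by
    rw [← pow_succ, ← pow_succ]; congr 1; omega
  have h9 : rankValue β k q (q - 1) - rankValue β k q 0 = G 0 := by simp [hG]
  rw [h9]
  linear_combination h0 + b * h7 + (1 - G 0) * h8

/-- The left end point of the branch of the `q`-th iterate that contains the orbit minimum. -/
noncomputable def lowerEnd (β : ℝ) (k q : ℕ) : ℝ := rankValue β k q 0 * (1 - (1 / β) ^ q)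

/-- By the gap identity `μ (1 - b ^ q) = M (1 - b ^ q) - b + b ^ q` with `b = 1/β`, and `M < 1`
makes this less than `1 - b`. -/
theorem lowerEnd_lt_cut (h : RealizesRotation β k q) (hβ : 1 < β) :
    lowerEnd β k q < 1 - 1 / β := by
  have hgap := rankValue_gap hβ h.pos h.lt h.coprime
  have hpow : (1 / β) ^ q < 1 :=
    pow_lt_one₀ (by positivity) (inv_lt_one_of hβ) (by have := h.lt; omega)
  have := mul_lt_mul_of_pos_right h.lt_one (sub_pos.2 hpow)
  rw [lowerEnd]
  linarith

theorem lowerEnd_pos (h : RealizesRotation β k q) (hβ : 1 < β) : 0 < lowerEnd β k q := by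
  have hpow : (1 / β) ^ q < 1 :=
    pow_lt_one₀ (by positivity) (inv_lt_one_of hβ) (by have := h.lt; omega)
  exact mul_pos ((cut_pos hβ).trans_le h.cut_le) (sub_pos.2 hpow)

/-- Between `lowerEnd` and `μ` the `q`-th iterate is affine with slope `β ^ q` and fixes `μ`. A
point there is driven down geometrically until it leaves, so it is no survivor. -/
theorem rankValue_le_of_mem (h : RealizesRotation β k q) (hβ : 1 < β) {x : ℝ}
    (hx : x ∈ forwardSet β (lowerEnd β k q)) : rankValue β k q 0 ≤ x := by
  by_contra! hlt
  have hb0 : 0 < β := by linarith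
  set μ := rankValue β k q 0 with hμ
  have hμm := h.mem hβ 0
  have hμI : μ ∈ Ico (0 : ℝ) 1 := ⟨(cut_pos hβ).le.trans hμm.1, hμm.2⟩
  have hstep : ∀ y, lowerEnd β k q ≤ y → y ≤ μ → (betaMap β)^[q] y = μ - β ^ q * (μ - y) := by
    intro y hy1 hy2
    have hη : μ - y ≤ μ * (1 / β) ^ q := by rw [lowerEnd] at hy1; linarith
    have key := iterate_betaMap_sub (n := q) hβ hμI (sub_nonneg.2 hy2) (by
      intro j hj
      have h1 : μ ≤ (betaMap β)^[j] μ := (h.mem_orbitMinimalSet hβ).2 j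
      have h2 : β ^ j * (μ - y) ≤ β ^ q * (μ * (1 / β) ^ q) := by
        have : β ^ j ≤ β ^ q := pow_le_pow_right₀ hβ.le hj
        have h0 : 0 ≤ μ - y := sub_nonneg.2 hy2
        gcongr
      have h3 : β ^ q * (μ * (1 / β) ^ q) = μ := by
        rw [mul_left_comm, ← mul_pow, mul_one_div_cancel hb0.ne', one_pow, mul_one]
      linarith) q le_rfl
    rw [sub_sub_cancel, h.iterate_period hβ] at key
    exact key
  have hall : ∀ n : ℕ, (betaMap β)^[n * q] x = μ - (β ^ q) ^ n * (μ - x) := by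
    intro n
    induction n with
    | zero => simp
    | succ n ih =>
      rw [show (n + 1) * q = q + n * q by ring, Function.iterate_add_apply,
        hstep _ (hx (n * q)).1 (by
          rw [ih]
          have : 0 ≤ (β ^ q) ^ n * (μ - x) := mul_nonneg (by positivity) (by linarith)
          linarith), ih, pow_succ]
      ring
  have hq : 1 < β ^ q := one_lt_pow₀ hβ (by have := h.lt; omega)
  obtain ⟨n, hn⟩ := pow_unbounded_of_one_lt (1 / (μ - x)) hq
  rw [div_lt_iff₀ (by linarith)] at hn
  have h1 := (hx (n * q)).1
  rw [hall n] at h1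
  linarith [h.lowerEnd_pos hβ, hμm.2]

/-- Lowering the hole to `lowerEnd` adds no orbits to `forwardSet`, because there are none in the
gap; the dimension remains that at `1 - 1/β`. -/
theorem dimH_survivorSet_lowerEnd (h : RealizesRotation β k q) (hβ : β ∈ Ioo (1 : ℝ) 2) :
    dimH (survivorSet β (lowerEnd β k q)) = 0 := by
  refine dimH_survivorSet_eq_zero (by linarith [hβ.1]) (le_antisymm ?_ zero_le)
  rw [← dimH_survivorSet_cut hβ]
  refine dimH_mono fun x hx => forwardSet_subset_survivorSet (cut_pos hβ.1).le fun n => ?_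
  exact ⟨h.cut_le.trans (h.rankValue_le_of_mem hβ.1 (iterate_mem_forwardSet hx n)), (hx n).2⟩

theorem criticalValue_lt (h : RealizesRotation β k q) (hβ : β ∈ Ioo (1 : ℝ) 2) {τ : ℝ}
    (hτ : IsCriticalValue β τ) : τ < 1 - 1 / β := by
  have hlt := h.lowerEnd_lt_cut hβ.1
  have hinv : 0 < 1 / β := by have := hβ.1; positivity
  refine lt_of_le_of_lt (not_lt.1 fun h2 => ?_) hlt
  have := (hτ _ ⟨(h.lowerEnd_pos hβ.1).le, by linarith⟩).2 h2
  rw [h.dimH_survivorSet_lowerEnd hβ] at this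
  exact lt_irrefl _ this

theorem eq_rankValue_of_prefixCount {β x : ℝ} (hβ : β ∈ Ioo (1 : ℝ) 2) {k q : ℕ} (hk : k < q)
    (hx : x ∈ Ico (0 : ℝ) 1) (h : ∀ n, prefixCount (itinerary β x) n = n * k / q) :
    itinerary β x = rankSeq k q 0 ∧ x = rankValue β k q 0 := by
  have h1 : itinerary β x = rankSeq k q 0 :=
    eq_of_prefixCount_eq fun n => by rw [h n, prefixCount_rankSeq_zero hk]
  refine ⟨h1, ?_⟩
  rw [rankValue, ← h1]
  exact eq_digitSeries_itinerary hβ hx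

theorem eq_of_mem_orbitMinimalSet (h : RealizesRotation β k q) (hβ : β ∈ Ioo (1 : ℝ) 2) {x : ℝ}
    (hx : x ∈ orbitMinimalSet β) (hlt : lowerEnd β k q ≤ x) : x = rankValue β k q 0 := by
  have hμx := h.rankValue_le_of_mem hβ.1
    (forwardSet_anti hlt (mem_forwardSet_of_mem_orbitMinimalSet hx))
  have hcx := h.cut_le.trans hμx
  have hcmp := prefixCount_itinerary_or hβ (h.mem_forwardSet hβ.1 0)
    (mem_forwardSet_cut_of_le hx hcx) hμx
  rw [h.itinerary_rankValue hβ.1] at hcmp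
  simp only [prefixCount_rankSeq_zero h.lt] at hcmp
  refine (eq_rankValue_of_prefixCount hβ h.lt hx.1 fun j => ?_).2
  have hlow : j * k / q ≤ prefixCount (itinerary β x) j := by
    have := hcmp j
    omega
  refine le_antisymm (not_lt.1 fun hgt => ?_) hlow
  have hq : 0 < q := h.pos.trans h.lt
  -- A surplus digit at time `j` means an excess of at least `1/q` over the slope `k/q`.
  -- Superadditivity multiplies it by `q + 1`, more than the comparison with `μ` allows.
  have h1 := (prefixCount_mul_bounds hβ hx hcx j q).1
  have h2 : prefixCount (itinerary β x) ((q + 1) * j) ≤ (q + 1) * j * k / q + 1 := by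
    have := hcmp ((q + 1) * j)
    omega
  have h3 : (q + 1) * (j * k / q + 1) ≤ (q + 1) * j * k / q + 1 :=
    (Nat.mul_le_mul_left _ hgt).trans (h1.trans h2)
  have h4 : (q + 1) * j * k / q * q ≤ (q + 1) * j * k := Nat.div_mul_le_self _ _
  have h5 : j * k < (j * k / q + 1) * q := by
    rw [mul_comm _ q]; exact Nat.lt_mul_div_succ _ hq
  nlinarith

theorem not_isCantorSet (h : RealizesRotation β k q) (hβ : β ∈ Ioo (1 : ℝ) 2) :
    ¬ IsCantorSet (closure (orbitMinimalSet β)) := by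
  intro hC
  set μ := rankValue β k q 0
  have hμ := h.mem_orbitMinimalSet hβ.1
  have hlt : lowerEnd β k q < μ := (h.lowerEnd_lt_cut hβ.1).trans_le h.cut_le
  have hacc := hC.perfect.acc μ (subset_closure hμ)
  rw [accPt_iff_nhds] at hacc
  obtain ⟨y, ⟨hy1, hy2⟩, hne⟩ := hacc _ (Ioi_mem_nhds hlt)
  refine hne ?_
  by_contra hne'
  obtain ⟨w, ⟨hw1, hw2⟩, hwE⟩ := mem_closure_iff.1 hy2 (Ioi (lowerEnd β k q) ∩ {μ}ᶜ)
    (isOpen_Ioi.inter isOpen_compl_singleton) ⟨hy1, hne'⟩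
  exact hw2 (h.eq_of_mem_orbitMinimalSet hβ hwE (le_of_lt hw1))

end RealizesRotation

/-- Every periodic orbit in `[1 - 1/β, 1)` is a rotation. -/
theorem exists_realizesRotation {β : ℝ} (hβ : β ∈ Ioo (1 : ℝ) 2) (hP : HasPeriodicAbove β) :
    ∃ k q, RealizesRotation β k q := by
  obtain ⟨x₀, m, hm, hper, hx₀⟩ := hP
  obtain ⟨i, -, himin⟩ := Finset.exists_min_image (Finset.range m) (fun i => (betaMap β)^[i] x₀)
    ⟨0, Finset.mem_range.2 hm⟩
  set x := (betaMap β)^[i] x₀ with hx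
  have hc := cut_pos hβ.1
  have hb0 : 0 < β := by linarith [hβ.1]
  have hxf : x ∈ forwardSet β (1 - 1 / β) := iterate_mem_forwardSet hx₀ i
  have hxI : x ∈ Ico (0 : ℝ) 1 := ⟨hc.le.trans (hxf 0).1, (hxf 0).2⟩
  have hP₀ : Function.IsPeriodicPt (betaMap β) m x₀ := hper
  have hxE : x ∈ orbitMinimalSet β := by
    refine ⟨hxI, fun n => ?_⟩
    rw [hx, ← Function.iterate_add_apply, ← hP₀.iterate_mod_apply (n + i)]
    exact himin _ (Finset.mem_range.2 (Nat.mod_lt _ hm))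
  have hPx : Function.IsPeriodicPt (betaMap β) m x := hP₀.apply_iterate i
  set A := prefixCount (itinerary β x) with hA
  have hAmul : ∀ n, A (n * m) = n * A m := by
    intro n
    induction n with
    | zero => simp [hA, prefixCount]
    | succ n ih =>
      have hfix : (betaMap β)^[n * m] x = x := by
        rw [mul_comm]; exact (hPx.mul_const n)
      rw [show (n + 1) * m = n * m + m by ring, hA, prefixCount_itinerary_add, hfix]
      change A (n * m) + A m = _
      rw [ih]; ring
  -- The bounds for `m` blocks of length `j` meet the exact count over `j` periods, so `j * A m`
  -- lies between `m * A j` and `m * A j + m - 1`.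
  have hAdiv : ∀ j, A j = j * A m / m := by
    intro j
    have h1 := prefixCount_mul_bounds hβ hxE (hxf 0).1 j (m - 1)
    rw [Nat.sub_add_cancel hm, mul_comm m j] at h1
    change m * A j ≤ A (j * m) ∧ A (j * m) ≤ m * A j + (m - 1) at h1
    rw [hAmul j] at h1
    refine (Nat.div_eq_of_lt_le ?_ ?_).symm
    · rw [mul_comm]; exact h1.1
    · rw [Nat.succ_mul, mul_comm (A j)]; omega
  have hK0 : 0 < A m := by
    by_contra h0
    have hz : A m = 0 := by omega
    have hs : itinerary β x = fun _ => false :=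
      eq_of_prefixCount_eq fun n => by
        change A n = _
        rw [hAdiv n, hz]; simp [prefixCount]
    have := eq_digitSeries_itinerary hβ hxI
    rw [hs] at this
    simp only [digitSeries, Bool.toNat_false, Nat.cast_zero, zero_mul, tsum_zero] at this
    linarith [(hxf 0).1, show x = 0 from this, show 1 - 1 / β ≤ x from (hxf 0).1]
  -- If all digits were `1`, the value would be at least the one in base `2`, namely `1`.
  have hKm : A m < m := by
    by_contra hge
    have hle : ∀ n, prefixCount (fun _ => true) n ≤ A n := by
      intro n
      rw [hAdiv n, Nat.le_div_iff_mul_le hm]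
      simp only [prefixCount, Bool.toNat_true, Finset.sum_const, Finset.card_range, smul_eq_mul,
        mul_one]
      exact Nat.mul_le_mul_left _ (not_lt.1 hge)
    have h1 := digitSeries_le_of_prefixCount_le (one_div_mem_Ico hβ.1) hle
    rw [← eq_digitSeries_itinerary hβ hxI] at h1
    have h2 : 1 = digitSeries (fun _ => true) (1 / 2) :=
      eq_digitSeries (y := fun _ => 1) (by norm_num) (by norm_num) (by norm_num)
    have h3 : digitSeries (fun _ => true) (1 / 2) ≤ digitSeries (fun _ => true) (1 / β) :=
      digitSeries_mono _ (by norm_num) (one_div_le_one_div_of_le hb0 hβ.2.le)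
        (inv_lt_one_of hβ.1)
    linarith [hxI.2]
  set g := Nat.gcd (A m) m with hg
  have hg0 : 0 < g := Nat.gcd_pos_of_pos_right _ hm
  obtain ⟨k, hk⟩ := Nat.gcd_dvd_left (A m) m
  obtain ⟨q, hq⟩ := Nat.gcd_dvd_right (A m) m
  rw [← hg] at hk hq
  have hkq : k < q := by
    rw [hk, hq] at hKm; exact Nat.lt_of_mul_lt_mul_left hKm
  have hk0 : 0 < k := by
    rcases Nat.eq_zero_or_pos k with h | h
    · rw [h, mul_zero] at hk; omega
    · exact h
  have hcop : k.Coprime q := by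
    have h1 : g * Nat.gcd k q = g := by
      rw [← Nat.gcd_mul_left, ← hk, ← hq]
    exact Nat.eq_of_mul_eq_mul_left hg0 (by rw [mul_one]; exact h1)
  have hAk : ∀ n, A n = n * k / q := by
    intro n
    rw [hAdiv n, hk]
    conv_lhs => rw [hq]
    rw [mul_left_comm, Nat.mul_div_mul_left _ _ hg0]
  obtain ⟨hit, hval⟩ := RealizesRotation.eq_rankValue_of_prefixCount hβ hkq hxI hAk
  have hq1 : 1 < q := by omega
  -- An inverse of `k` modulo `q` gives a time at which the orbit visits rank `q - 1`, so its
  -- largest point is below `1`.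
  obtain ⟨j, -, hj⟩ := Nat.exists_mul_mod_eq_one_of_coprime hcop hq1
  have hrank : (q - 1) * j * k % q = q - 1 := by
    rw [mul_assoc, mul_comm j k, Nat.mul_mod, hj, mul_one, Nat.mod_mod,
      Nat.mod_eq_of_lt (by omega)]
  refine ⟨k, q, hk0, hkq, hcop, hval ▸ (hxf 0).1, ?_⟩
  have h1 : (betaMap β)^[(q - 1) * j] x = rankValue β k q (q - 1) := by
    rw [eq_digitSeries_itinerary hβ (iterate_betaMap_mem_Ico hxI _), ← itinerary_add, hit,
      rankSeq_add, zero_add]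
    change rankValue β k q ((q - 1) * j * k) = _
    rw [← rankValue_mod, hrank]
  rw [← h1]
  exact (hxf _).2

/-! ### Christoffel words -/

/-- The Christoffel word of slope `k / q`. -/
def christoffel (k q : ℕ) : List Bool := (List.range q).map (rankSeq k q 0)

theorem rankSeq_zero_eq_true_iff {k q : ℕ} (hq : 0 < q) (j : ℕ) :
    rankSeq k q 0 j = true ↔ j * k / q < (j + 1) * k / q := by
  rw [rankSeq, decide_eq_true_iff, zero_add, Nat.lt_iff_add_one_le, Nat.le_div_iff_mul_le hq,
    add_mul, add_mul, one_mul, one_mul]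
  have := Nat.div_add_mod' (j * k) q
  omega

/-- The slopes differ by `1 / (q₁ (q₁ + q₂))`. Over at most `q₁` steps this is less than `1 / q₁`,
too little to carry a multiple of `1 / q₁` to the next integer. -/
theorem mediant_div_left {k₁ q₁ k₂ q₂ j : ℕ} (h₁ : 0 < q₁) (h₂ : 0 < q₂)
    (hdet : k₂ * q₁ = k₁ * q₂ + 1) (hj : j ≤ q₁) :
    j * (k₁ + k₂) / (q₁ + q₂) = j * k₁ / q₁ := by
  have ha := Nat.div_mul_le_self (j * k₁) q₁
  have hb := Nat.lt_div_mul_add (a := j * k₁) h₁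
  set a := j * k₁ / q₁
  refine Nat.div_eq_of_lt_le ?_ ?_
  · refine Nat.le_of_mul_le_mul_right ?_ h₁
    nlinarith [Nat.mul_le_mul_right (q₁ + q₂) ha]
  · refine Nat.lt_of_mul_lt_mul_right (a := q₁) ?_
    have h3 : (j * k₁ + 1) * (q₁ + q₂) ≤ (a * q₁ + q₁) * (q₁ + q₂) := Nat.mul_le_mul_right _ hb
    nlinarith

theorem mediant_div_right {k₁ q₁ k₂ q₂ j : ℕ} (h₁ : 0 < q₁) (h₂ : 0 < q₂)
    (hdet : k₂ * q₁ = k₁ * q₂ + 1) (hj : j ≤ q₂) :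
    (q₁ + j) * (k₁ + k₂) / (q₁ + q₂) = k₁ + j * k₂ / q₂ := by
  have ha := Nat.div_mul_le_self (j * k₂) q₂
  have hb := Nat.lt_div_mul_add (a := j * k₂) h₂
  set a := j * k₂ / q₂
  have hid : (q₁ + j) * (k₁ + k₂) * q₂ + j = k₁ * (q₁ + q₂) * q₂ + j * k₂ * (q₁ + q₂) + q₂ := by
    zify at hdet ⊢
    linear_combination ((q₂ : ℤ) - j) * hdet
  refine Nat.div_eq_of_lt_le ?_ ?_
  · refine Nat.le_of_mul_le_mul_right ?_ h₂
    nlinarith [Nat.mul_le_mul_right (q₁ + q₂) ha]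
  · refine Nat.lt_of_mul_lt_mul_right (a := q₂) ?_
    have h3 : (j * k₂ + 1) * (q₁ + q₂) ≤ (a * q₂ + q₂) * (q₁ + q₂) := Nat.mul_le_mul_right _ hb
    nlinarith

/-- The concatenation of neighbouring Christoffel words is the Christoffel word of the mediant. -/
theorem christoffel_append {k₁ q₁ k₂ q₂ : ℕ} (h₁ : 0 < q₁) (h₂ : 0 < q₂)
    (hdet : k₂ * q₁ = k₁ * q₂ + 1) :
    christoffel k₁ q₁ ++ christoffel k₂ q₂ = christoffel (k₁ + k₂) (q₁ + q₂) := by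
  have hQ : 0 < q₁ + q₂ := by omega
  rw [christoffel, christoffel, christoffel, List.range_add, List.map_append, List.map_map]
  congr 1
  · refine List.map_congr_left fun j hj => ?_
    rw [List.mem_range] at hj
    rw [Bool.eq_iff_iff, rankSeq_zero_eq_true_iff h₁, rankSeq_zero_eq_true_iff hQ,
      mediant_div_left h₁ h₂ hdet hj.le, mediant_div_left h₁ h₂ hdet hj]
  · refine List.map_congr_left fun j hj => ?_
    rw [List.mem_range] at hj
    rw [Function.comp_apply, Bool.eq_iff_iff, rankSeq_zero_eq_true_iff h₂,
      rankSeq_zero_eq_true_iff hQ, mediant_div_right h₁ h₂ hdet hj.le, add_assoc,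
      mediant_div_right (j := j + 1) h₁ h₂ hdet hj]
    omega

/-! ### Farey words are Christoffel words -/

/-- Neighbouring fractions, written as pairs of a numerator and a denominator. -/
structure FareyNeighbours (p p' : ℕ × ℕ) : Prop where
  left_pos : 0 < p.2
  right_pos : 0 < p'.2
  det : p'.1 * p.2 = p.1 * p'.2 + 1

theorem FareyNeighbours.left {p p' : ℕ × ℕ} (h : FareyNeighbours p p') :
    FareyNeighbours p (p + p') :=
  ⟨h.left_pos, Nat.add_pos_left h.left_pos _, by
    have := h.det
    simp only [Prod.fst_add, Prod.snd_add]
    linarith⟩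

theorem FareyNeighbours.right {p p' : ℕ × ℕ} (h : FareyNeighbours p p') :
    FareyNeighbours (p + p') p' :=
  ⟨Nat.add_pos_left h.left_pos _, h.right_pos, by
    have := h.det
    simp only [Prod.fst_add, Prod.snd_add]
    linarith⟩

theorem FareyNeighbours.coprime_add {p p' : ℕ × ℕ} (h : FareyNeighbours p p') :
    (p + p').1.Coprime (p + p').2 := by
  rw [← Nat.isCoprime_iff_coprime]
  refine ⟨p.2, -p.1, ?_⟩
  have := h.left.det
  zify at this
  linarith

/-- Insert between any two neighbours of a list of fractions their mediant. -/
def mediantStep : List (ℕ × ℕ) → List (ℕ × ℕ)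
  | p :: p' :: l => p :: (p + p') :: mediantStep (p' :: l)
  | l => l

/-- The `n`-th Stern–Brocot list of fractions in `[0, 1]`. -/
def mediantList : ℕ → List (ℕ × ℕ)
  | 0 => [(0, 1), (1, 1)]
  | n + 1 => mediantStep (mediantList n)

theorem mediantStep_cons (p : ℕ × ℕ) (l : List (ℕ × ℕ)) :
    ∃ l', mediantStep (p :: l) = p :: l' := by
  cases l with
  | nil => exact ⟨[], rfl⟩
  | cons p' l => exact ⟨_, rfl⟩

theorem isChain_mediantStep {L : List (ℕ × ℕ)} (h : L.IsChain FareyNeighbours) :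
    (mediantStep L).IsChain FareyNeighbours := by
  induction L using mediantStep.induct with
  | case1 p p' l ih =>
    rw [List.isChain_cons_cons] at h
    have h2 := ih h.2
    obtain ⟨l', hl'⟩ := mediantStep_cons p' l
    rw [mediantStep, hl', List.isChain_cons_cons, List.isChain_cons_cons, ← hl']
    exact ⟨h.1.left, h.1.right, h2⟩
  | case2 l hl =>
    rwa [mediantStep]
    exact hl

theorem isChain_mediantList (n : ℕ) : (mediantList n).IsChain FareyNeighbours := by
  induction n with
  | zero => exact .cons_cons ⟨by norm_num, by norm_num, by norm_num⟩ (.singleton _)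
  | succ n ih => exact isChain_mediantStep ih

theorem fareyStep_map {L : List (ℕ × ℕ)} (h : L.IsChain FareyNeighbours) :
    fareyStep (L.map fun p => christoffel p.1 p.2) =
      (mediantStep L).map fun p => christoffel p.1 p.2 := by
  induction L using mediantStep.induct with
  | case1 p p' l ih =>
    rw [List.isChain_cons_cons] at h
    have h2 := ih h.2
    rw [List.map_cons] at h2
    rw [mediantStep, List.map_cons, List.map_cons, List.map_cons, List.map_cons, fareyStep, h2,
      christoffel_append h.1.left_pos h.1.right_pos h.1.det]
    rfl
  | case2 l hl =>
    match l, hl with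
    | [], _ => rfl
    | [p], _ => rfl
    | p :: p' :: l, hl => exact absurd rfl (hl p p' l)

theorem fareyList_eq (n : ℕ) :
    fareyList n = (mediantList n).map fun p => christoffel p.1 p.2 := by
  induction n with
  | zero => rfl
  | succ n ih => rw [fareyList, mediantList, ih, fareyStep_map (isChain_mediantList n)]

theorem mem_mediantStep_or {L : List (ℕ × ℕ)} {p : ℕ × ℕ} (h : p ∈ mediantStep L) :
    p ∈ L ∨ ∃ u v, [u, v] <:+: L ∧ p = u + v := by
  induction L using mediantStep.induct with
  | case1 u v l ih =>
    rw [mediantStep, List.mem_cons, List.mem_cons] at h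
    rcases h with rfl | rfl | h
    · exact Or.inl List.mem_cons_self
    · exact Or.inr ⟨u, v, ⟨[], l, rfl⟩, rfl⟩
    · rcases ih h with h | ⟨x, y, hxy, rfl⟩
      · exact Or.inl (List.mem_cons_of_mem _ h)
      · exact Or.inr ⟨x, y, hxy.trans (List.suffix_cons _ _).isInfix, rfl⟩
  | case2 l hl =>
    rw [mediantStep] at h
    · exact Or.inl h
    · exact hl

theorem subset_mediantStep {L : List (ℕ × ℕ)} {p : ℕ × ℕ} (h : p ∈ L) : p ∈ mediantStep L := by
  induction L using mediantStep.induct with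
  | case1 u v l ih =>
    rw [mediantStep, List.mem_cons, List.mem_cons]
    rcases List.mem_cons.1 h with rfl | h
    · exact Or.inl rfl
    · exact Or.inr (Or.inr (ih h))
  | case2 l hl => rwa [mediantStep]; exact hl

theorem adjacent_mediantStep {L : List (ℕ × ℕ)} {u v : ℕ × ℕ} (h : [u, v] <:+: L) :
    [u, u + v] <:+: mediantStep L ∧ [u + v, v] <:+: mediantStep L := by
  induction L using mediantStep.induct with
  | case1 x y l ih =>
    obtain ⟨l', hl'⟩ := mediantStep_cons y l
    rw [mediantStep]
    rcases List.infix_cons_iff.1 h with h | h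
    · rw [List.cons_prefix_cons, List.cons_prefix_cons] at h
      obtain ⟨rfl, rfl, -⟩ := h
      rw [hl']
      exact ⟨⟨[], v :: l', rfl⟩, ⟨[u], l', rfl⟩⟩
    · have hsuf : mediantStep (y :: l) <:+: x :: (x + y) :: mediantStep (y :: l) :=
        ⟨[x, x + y], [], by simp⟩
      exact ⟨(ih h).1.trans hsuf, (ih h).2.trans hsuf⟩
  | case2 l hl =>
    match l, hl with
    | [], _ => simpa using h.length_le
    | [p], _ => simpa using h.length_le
    | p :: p' :: l, hl => exact absurd rfl (hl p p' l)

theorem FareyNeighbours.of_adjacent {L : List (ℕ × ℕ)} (hL : L.IsChain FareyNeighbours)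
    {u v : ℕ × ℕ} (h : [u, v] <:+: L) : FareyNeighbours u v := by
  obtain ⟨s, t, rfl⟩ := h
  exact (List.isChain_cons_cons.1 hL.left_of_append.right_of_append).1

theorem mem_mediantList_props {n : ℕ} {p : ℕ × ℕ} (h : p ∈ mediantList n) :
    0 < p.2 ∧ p.1 ≤ p.2 ∧ p.1.Coprime p.2 := by
  induction n generalizing p with
  | zero =>
    simp only [mediantList, List.mem_cons, List.not_mem_nil, or_false] at h
    rcases h with rfl | rfl <;> simp
  | succ n ih =>
    rcases mem_mediantStep_or h with h | ⟨u, v, huv, rfl⟩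
    · exact ih h
    · have hN := FareyNeighbours.of_adjacent (isChain_mediantList n) huv
      have h1 := ih (huv.subset (List.mem_cons_self (a := u)))
      have h2 := ih (huv.subset (List.mem_cons_of_mem u (List.mem_singleton_self v)))
      exact ⟨Nat.add_pos_left h1.1 _, Nat.add_le_add h1.2.1 h2.2.1, hN.coprime_add⟩

theorem mem_mediantList_or {k q : ℕ} (hk0 : 0 < k) (hk : k < q) (hcop : k.Coprime q) (n : ℕ) :
    (k, q) ∈ mediantList n ∨ ∃ u v : ℕ × ℕ, [u, v] <:+: mediantList n ∧
      u.1 * q < k * u.2 ∧ k * v.2 < v.1 * q ∧ n + 2 ≤ u.2 + v.2 := by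
  induction n with
  | zero =>
    refine Or.inr ⟨(0, 1), (1, 1), ⟨[], [], rfl⟩, ?_, ?_, ?_⟩ <;> simp [hk0, hk]
  | succ n ih =>
    rcases ih with h | ⟨u, v, huv, h1, h2, h3⟩
    · exact Or.inl (subset_mediantStep h)
    · have hN := FareyNeighbours.of_adjacent (isChain_mediantList n) huv
      have hu := hN.left_pos
      have hv := hN.right_pos
      obtain ⟨hl, hr⟩ := adjacent_mediantStep huv
      rcases lt_trichotomy (k * (u + v).2) ((u + v).1 * q) with h | h | h
      · exact Or.inr ⟨u, u + v, hl, h1, h, by rw [Prod.snd_add]; omega⟩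
      · refine Or.inl ?_
        have hc := hN.coprime_add
        have e1 : k = (u + v).1 := Nat.dvd_antisymm
          (hcop.dvd_of_dvd_mul_right (h ▸ Dvd.intro _ rfl))
          (hc.dvd_of_dvd_mul_right (h.symm ▸ Dvd.intro _ rfl))
        have e2 : q = (u + v).2 := by
          rw [← e1] at h
          exact (Nat.eq_of_mul_eq_mul_left hk0 h).symm
        rw [show (k, q) = u + v from Prod.ext e1 e2]
        exact hl.subset (List.mem_cons_of_mem _ (List.mem_singleton_self _))
      · exact Or.inr ⟨u + v, v, hr, h, h2, by rw [Prod.snd_add]; omega⟩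

/-- A fraction strictly between neighbours has denominator at least the sum of theirs, as
determinant one makes it a positive integral combination. At stage `q` this sum is at least `q + 2`,
so `k / q` has already been inserted. -/
theorem mem_mediantList {k q : ℕ} (hk0 : 0 < k) (hk : k < q) (hcop : k.Coprime q) :
    (k, q) ∈ mediantList q := by
  rcases mem_mediantList_or hk0 hk hcop q with h | ⟨u, v, huv, h1, h2, h3⟩
  · exact h
  · exfalso
    have hdet := (FareyNeighbours.of_adjacent (isChain_mediantList q) huv).det
    obtain ⟨d, hd⟩ := Nat.exists_eq_add_of_lt h1
    obtain ⟨e, he⟩ := Nat.exists_eq_add_of_lt h2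
    have h4 : q = u.2 * (e + 1) + v.2 * (d + 1) := by
      zify at hdet hd he ⊢
      linear_combination (-(q : ℤ)) * hdet + (u.2 : ℤ) * he + (v.2 : ℤ) * hd
    nlinarith [Nat.zero_le (u.2 * e), Nat.zero_le (v.2 * d)]

theorem isNondegenerateFareyWord_iff {w : List Bool} :
    IsNondegenerateFareyWord w ↔
      ∃ k q : ℕ, 0 < k ∧ k < q ∧ k.Coprime q ∧ w = christoffel k q := by
  constructor
  · rintro ⟨⟨n, hn⟩, h0, h1⟩
    rw [fareyList_eq, List.mem_map] at hn
    obtain ⟨⟨k, q⟩, hp, rfl⟩ := hn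
    obtain ⟨hq, hkq, hcop⟩ := mem_mediantList_props hp
    dsimp only at hq hkq hcop h0 h1
    refine ⟨k, q, ?_, ?_, hcop, rfl⟩
    · refine Nat.pos_of_ne_zero fun hk => h0 ?_
      rw [hk, Nat.coprime_zero_left] at hcop
      rw [hk, hcop]
      rfl
    · refine lt_of_le_of_ne hkq fun hk => h1 ?_
      rw [hk, Nat.coprime_self] at hcop
      rw [hk, hcop]
      rfl
  · rintro ⟨k, q, hk0, hk, hcop, rfl⟩
    refine ⟨⟨q, ?_⟩, ?_, ?_⟩
    · rw [fareyList_eq, List.mem_map]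
      exact ⟨(k, q), mem_mediantList hk0 hk hcop, rfl⟩
    all_goals
      intro h
      have := congrArg List.length h
      simp only [christoffel, List.length_map, List.length_range, List.length_singleton] at this
      omega

/-! ### The digits of Farey intervals -/

/-- The period of the digits of the largest point of a rotation. -/
def upperWord (k q : ℕ) : List Bool := (List.range q).map (rankSeq k q (q - 1))

theorem rankSeq_periodic (k q r n : ℕ) : rankSeq k q r (n % q) = rankSeq k q r n := by
  rw [rankSeq, rankSeq, decide_eq_decide, Nat.add_mod, Nat.mod_mul_mod, ← Nat.add_mod]

theorem periodicSeq_map_rankSeq {q : ℕ} (hq : 0 < q) (k r : ℕ) :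
    periodicSeq ((List.range q).map (rankSeq k q r)) = rankSeq k q r := by
  funext n
  have hn := Nat.mod_lt n hq
  rw [periodicSeq, List.length_map, List.length_range, List.getD_eq_getElem _ _ (by simpa using hn),
    List.getElem_map, List.getElem_range, rankSeq_periodic]

/-- Replacing each rank `r` by `q - 1 - r` turns the rotation by `k` into that by `q - k`, exchanges
the largest and smallest points, and flips all digits. -/
theorem rankSeq_sub {k q : ℕ} (hk : k ≤ q) (hq : 0 < q) (j : ℕ) :
    rankSeq (q - k) q 0 j = !rankSeq k q (q - 1) j := by
  have hm := Nat.mod_lt (j * (q - k)) hq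
  have h1 := Nat.div_add_mod (j * (q - k)) q
  have h2 : j * (q - k) + j * k = q * j := by rw [← mul_add, Nat.sub_add_cancel hk, mul_comm]
  have hle : j * (q - k) / q ≤ j := by
    refine Nat.div_le_of_le_mul ?_
    omega
  have h3 : q * (j - j * (q - k) / q) + q * (j * (q - k) / q) = q * j := by
    rw [← mul_add, Nat.sub_add_cancel hle]
  have h4 : (q - 1 + j * k) % q = q - 1 - j * (q - k) % q := by
    rw [show q - 1 + j * k = (q - 1 - j * (q - k) % q) + q * (j - j * (q - k) / q) by omega,
      Nat.add_mul_mod_self_left, Nat.mod_eq_of_lt (by omega)]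
  rw [rankSeq, rankSeq, h4, zero_add, ← decide_not, decide_eq_decide]
  omega

theorem reflectWord_upperWord {k q : ℕ} (hk : k ≤ q) (hq : 0 < q) :
    reflectWord (upperWord k q) = christoffel (q - k) q := by
  rw [reflectWord, upperWord, christoffel, List.map_map]
  exact List.map_congr_left fun j _ => (rankSeq_sub hk hq j).symm

theorem eq_upperWord_of_reflectWord {a : List Bool} {k q : ℕ} (hk : k ≤ q) (hq : 0 < q)
    (h : reflectWord a = christoffel k q) : a = upperWord (q - k) q := by
  have hinj : Function.Injective (List.map not) := List.map_injective_iff.2 Bool.not_injective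
  refine hinj (h.trans ?_)
  change _ = reflectWord _
  rw [reflectWord_upperWord (Nat.sub_le _ _) hq, Nat.sub_sub_self hk]

/-- Reversing time and reflecting ranks preserves the rotation, so the period of the largest point
read backwards is that of the smallest. -/
theorem rankSeq_reverse {k q i : ℕ} (hk : k < q) (hi : i < q) :
    rankSeq k q (q - 1) (q - 1 - i) = rankSeq k q 0 i := by
  have hq : 0 < q := by omega
  have hm := Nat.mod_lt (i * k) hq
  have h1 := Nat.div_add_mod (i * k) q
  have h2 : (q - 1 - i) * k + i * k + k = q * k := by
    rw [← add_mul, ← Nat.succ_mul]; congr 1; omega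
  have hle : i * k / q ≤ k := Nat.div_le_of_le_mul (by omega)
  obtain ⟨e, he⟩ := Nat.exists_eq_add_of_le hle
  have h3 : q * k = q * (i * k / q) + q * e := by rw [← mul_add, ← he]
  have hmod : (q - 1 + (q - 1 - i) * k) % q =
      if q ≤ i * k % q + k then 2 * q - 1 - (i * k % q + k) else q - 1 - (i * k % q + k) := by
    split_ifs with h
    · have he0 : e ≠ 0 := by
        rintro rfl
        omega
      obtain ⟨f, rfl⟩ := Nat.exists_eq_succ_of_ne_zero he0
      rw [Nat.mul_succ] at h3
      rw [show q - 1 + (q - 1 - i) * k = 2 * q - 1 - (i * k % q + k) + q * f by omega,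
        Nat.add_mul_mod_self_left, Nat.mod_eq_of_lt (by omega)]
    · rw [show q - 1 + (q - 1 - i) * k = q - 1 - (i * k % q + k) + q * e by omega,
        Nat.add_mul_mod_self_left, Nat.mod_eq_of_lt (by omega)]
  rw [rankSeq, rankSeq, hmod, zero_add, decide_eq_decide]
  split_ifs with h <;> omega

theorem reverse_upperWord {k q : ℕ} (hk : k < q) :
    (upperWord k q).reverse = (List.range q).map (rankSeq k q 0) := by
  refine List.ext_getElem (by simp [upperWord]) fun i h1 h2 => ?_
  have hi : i < q := by simpa using h2
  simp only [upperWord, List.getElem_reverse, List.getElem_map, List.getElem_range,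
    List.length_map, List.length_range]
  exact rankSeq_reverse hk hi

/-- The digits of the largest point of a rotation with the last digit of the first period raised
continue as the digits of the smallest point. -/
theorem prependWord_raiseLast {k q : ℕ} (hk0 : 0 < k) (hk : k < q) (hcop : k.Coprime q) :
    prependWord (raiseLast (upperWord k q)) (rankSeq k q 0) =
      fun n => decide (n = 0) || rankSeq k q 0 n := by
  obtain ⟨p, rfl⟩ : ∃ p, q = p + 1 := ⟨q - 1, by omega⟩
  have hword : raiseLast (upperWord k (p + 1)) =
      (List.range p).map (rankSeq k (p + 1) p) ++ [true] := by
    simp [raiseLast, upperWord, List.range_succ]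
  have hfirst : rankSeq k (p + 1) p 0 = true := by
    rw [rankSeq, decide_eq_true_iff, zero_mul, add_zero, Nat.mod_eq_of_lt (by omega)]
    omega
  have hlast : rankSeq k (p + 1) 0 p = true := by
    have := pred_mul_mod hk0 hk
    rw [Nat.add_sub_cancel] at this
    rw [rankSeq, decide_eq_true_iff, zero_add, this]
    omega
  funext n
  rw [prependWord, hword]
  simp only [List.length_append, List.length_map, List.length_range, List.length_singleton]
  split_ifs with h
  · rcases Nat.lt_or_ge n p with hn | hn
    · rw [List.getD_append _ _ _ _ (by simpa using hn),
        List.getD_eq_getElem _ _ (by simpa using hn), List.getElem_map, List.getElem_range]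
      rcases Nat.eq_zero_or_pos n with rfl | hn0
      · simp [hfirst]
      · have := rankSeq_pred_eq hk hcop hn0 (by omega)
        rw [Nat.add_sub_cancel] at this
        rw [this, decide_eq_false (by omega), Bool.false_or]
    · obtain rfl : n = p := by omega
      rw [List.getD_append_right _ _ _ _ (by simp), hlast]
      simp
  · rw [← rankSeq_periodic k _ _ n, Nat.mod_eq_sub_mod (by omega), rankSeq_periodic,
      decide_eq_false (by omega), Bool.false_or]

/-! ### Quasi-greedy expansions of `1` -/

theorem quasiGreedyMap_mem {γ x : ℝ} (hγ : γ ∈ Ioc (1 : ℝ) 2) (hx : x ∈ Ioc (0 : ℝ) 1) :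
    quasiGreedyMap γ x ∈ Ioc (0 : ℝ) 1 := by
  have h0 : 0 < γ := by linarith [hγ.1]
  rw [quasiGreedyMap]
  split_ifs with h
  · rw [le_div_iff₀ h0] at h
    exact ⟨mul_pos h0 hx.1, by linarith⟩
  · rw [not_le, div_lt_iff₀ h0] at h
    have := mul_le_mul_of_nonneg_left hx.2 h0.le
    exact ⟨by linarith, by linarith [hγ.2]⟩

theorem iterate_quasiGreedyMap_mem {γ : ℝ} (hγ : γ ∈ Ioc (1 : ℝ) 2) (n : ℕ) :
    (quasiGreedyMap γ)^[n] 1 ∈ Ioc (0 : ℝ) 1 := by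
  induction n with
  | zero => simp
  | succ n ih => rw [Function.iterate_succ_apply']; exact quasiGreedyMap_mem hγ ih

theorem digitSeries_quasiGreedyOne {γ : ℝ} (hγ : γ ∈ Ioc (1 : ℝ) 2) :
    digitSeries (quasiGreedyOne γ) (1 / γ) = 1 := by
  have h0 : 0 < γ := by linarith [hγ.1]
  refine (eq_digitSeries (one_div_mem_Ico hγ.1) (y := fun n => (quasiGreedyMap γ)^[n] 1)
    (fun n => Ioc_subset_Icc_self (iterate_quasiGreedyMap_mem hγ n)) fun n => ?_).symm
  simp only [Function.iterate_succ_apply', quasiGreedyOne]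
  generalize (quasiGreedyMap γ)^[n] 1 = z
  rw [quasiGreedyMap]
  split_ifs with h
  · rw [decide_eq_false (not_lt.2 h)]
    simp only [Bool.toNat_false, Nat.cast_zero]
    field_simp
    ring
  · rw [decide_eq_true (not_le.1 h)]
    simp only [Bool.toNat_true, Nat.cast_one]
    field_simp
    ring

/-- Tail values in the half-open interval `(0, 1]` force exactly the digit choice of the
quasi-greedy map, so the tails are its orbit. -/
theorem quasiGreedyOne_eq {γ : ℝ} (hγ : 1 < γ) {s : ℕ → Bool}
    (h1 : digitSeries s (1 / γ) = 1)
    (hs : ∀ n, digitSeries (fun i => s (n + i)) (1 / γ) ∈ Ioc (0 : ℝ) 1) :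
    quasiGreedyOne γ = s := by
  have h0 : 0 < γ := by linarith
  have hrec : ∀ n, γ * digitSeries (fun i => s (n + i)) (1 / γ) =
      (s n).toNat + digitSeries (fun i => s (n + 1 + i)) (1 / γ) := by
    intro n
    rw [digitSeries_eq _ (one_div_mem_Ico hγ), ← mul_assoc, mul_one_div_cancel h0.ne', one_mul]
    simp only [add_zero, add_assoc, add_comm 1]
  have hdig : ∀ n, s n = decide (1 / γ < digitSeries (fun i => s (n + i)) (1 / γ)) ∧
      quasiGreedyMap γ (digitSeries (fun i => s (n + i)) (1 / γ)) =
        digitSeries (fun i => s (n + 1 + i)) (1 / γ) := by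
    intro n
    have hr := hrec n
    have hm := hs (n + 1)
    rw [quasiGreedyMap]
    cases hsn : s n
    · rw [hsn, Bool.toNat_false, Nat.cast_zero, zero_add] at hr
      have hle : digitSeries (fun i => s (n + i)) (1 / γ) ≤ 1 / γ := by
        rw [le_div_iff₀ h0, mul_comm, hr]; exact hm.2
      exact ⟨(decide_eq_false (not_lt.2 hle)).symm, by rw [if_pos hle, hr]⟩
    · rw [hsn, Bool.toNat_true, Nat.cast_one] at hr
      have hlt : 1 / γ < digitSeries (fun i => s (n + i)) (1 / γ) := by
        rw [div_lt_iff₀ h0, mul_comm, hr]; linarith [hm.1]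
      exact ⟨(decide_eq_true hlt).symm, by rw [if_neg (not_le.2 hlt), hr]; ring⟩
  have hit : ∀ n, (quasiGreedyMap γ)^[n] 1 = digitSeries (fun i => s (n + i)) (1 / γ) := by
    intro n
    induction n with
    | zero => simpa using h1.symm
    | succ n ih => rw [Function.iterate_succ_apply', ih, (hdig n).2]
  funext n
  rw [quasiGreedyOne, hit n]
  exact (hdig n).1.symm

/-! ### Farey intervals -/

theorem rankSeq_zero_zero {k q : ℕ} (hk : k < q) : rankSeq k q 0 0 = false := by
  simp [rankSeq, hk]

theorem digitSeries_prepend_true {s : ℕ → Bool} (hs : s 0 = false) {x : ℝ}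
    (hx : x ∈ Ico (0 : ℝ) 1) :
    digitSeries (fun n => decide (n = 0) || s n) x = x + digitSeries s x := by
  rw [digitSeries_eq _ hx, digitSeries_eq s hx, hs]
  simp [mul_add]

/-- Clearing the denominator turns a periodic series into a polynomial, to which the intermediate
value theorem applies up to `x = 1`. -/
theorem digitSeries_mul_one_sub_pow {s : ℕ → Bool} {q : ℕ} (hs : ∀ n, s (q + n) = s n) {x : ℝ}
    (hx : x ∈ Ico (0 : ℝ) 1) :
    digitSeries s x * (1 - x ^ q) = ∑ i ∈ Finset.range q, ((s i).toNat : ℝ) * x ^ (i + 1) := by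
  have h := (summable_digitSeries s hx).sum_add_tsum_nat_add q
  have h2 : ∑' n, ((s (n + q)).toNat : ℝ) * x ^ (n + q + 1) = x ^ q * digitSeries s x := by
    rw [digitSeries, ← tsum_mul_left]
    congr 1
    funext n
    rw [add_comm n q, hs]
    ring
  rw [h2] at h
  change _ = digitSeries s x at h
  linarith

theorem rankSeq_period_add (k q r n : ℕ) : rankSeq k q r (q + n) = rankSeq k q r n := by
  rw [← rankSeq_periodic, Nat.add_mod_left, rankSeq_periodic]

theorem rankSeq_pred_zero {k q : ℕ} (hk0 : 0 < k) (hk : k < q) : rankSeq k q (q - 1) 0 = true := by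
  rw [rankSeq_zero_iff, decide_eq_true_iff, Nat.mod_eq_of_lt (by omega)]
  omega

theorem rankSeq_zero_pred {k q : ℕ} (hk0 : 0 < k) (hk : k < q) : rankSeq k q 0 (q - 1) = true := by
  rw [rankSeq, decide_eq_true_iff, zero_add, pred_mul_mod hk0 hk]
  omega

theorem rankValue_pos {γ : ℝ} (hγ : 1 < γ) {k q : ℕ} (hk0 : 0 < k) (hk : k < q) (r : ℕ) :
    0 < rankValue γ k q r := by
  have hx := one_div_mem_Ico hγ
  have hx0 : 0 < 1 / γ := by positivity
  refine lt_of_lt_of_le ?_ (rankValue_bounds hγ hk r).1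
  refine (digitSeries_nonneg (rankSeq k q 0) le_rfl).trans_lt ?_
  exact digitSeries_strictMono (rankSeq_zero_pred hk0 hk) le_rfl hx0 hx.2

/-- The two expansions say that `M = 1` in base `γL` and `1/γR + μ = 1` in base `γR`. Both series
increase with `1/β`; the strict and weak inequalities at the ends of the interval match those of
`RealizesRotation`. -/
theorem realizesRotation_of_mem_fareyInterval {β : ℝ} (hβ : β ∈ Ioo (1 : ℝ) 2) {J : Set ℝ}
    (hJ : IsFareyInterval J) (hmem : β ∈ J) : ∃ k q, RealizesRotation β k q := by
  obtain ⟨a, γL, γR, hw, hL, hR, hLs, hRs, rfl⟩ := hJ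
  obtain ⟨k', q, hk0', hk', hcop', hw⟩ := isNondegenerateFareyWord_iff.1 hw
  have ha := eq_upperWord_of_reflectWord hk'.le (by omega) hw
  obtain ⟨k, hk⟩ : ∃ k, k = q - k' := ⟨_, rfl⟩
  rw [← hk] at ha
  have hk0 : 0 < k := by omega
  have hkq : k < q := by omega
  have hcop : k.Coprime q := by
    rw [hk]; exact (Nat.coprime_self_sub_left hk'.le).2 hcop'
  rw [ha, upperWord, periodicSeq_map_rankSeq (by omega)] at hLs
  rw [ha, reverse_upperWord hkq, periodicSeq_map_rankSeq (by omega),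
    prependWord_raiseLast hk0 hkq hcop] at hRs
  have h1 := digitSeries_quasiGreedyOne hL
  have h2 := digitSeries_quasiGreedyOne hR
  rw [hLs] at h1
  rw [hRs, digitSeries_prepend_true (rankSeq_zero_zero hkq) (one_div_mem_Ico hR.1)] at h2
  have hinv : 1 / γR ≤ 1 / β := one_div_le_one_div_of_le (by linarith [hβ.1]) hmem.2
  refine ⟨k, q, hk0, hkq, hcop, ?_, ?_⟩
  · have := digitSeries_mono (rankSeq k q 0) (one_div_mem_Ico hR.1).1 hinv (inv_lt_one_of hβ.1)
    rw [rankValue]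
    linarith
  · rw [← h1]
    exact digitSeries_strictMono (rankSeq_pred_zero hk0 hkq) (one_div_mem_Ico hβ.1).1
      (one_div_lt_one_div_of_lt (by linarith [hL.1]) hmem.1) (inv_lt_one_of hL.1)

namespace RealizesRotation

variable {β : ℝ} {k q : ℕ}

theorem exists_left (h : RealizesRotation β k q) (hβ : β ∈ Ioo (1 : ℝ) 2) :
    ∃ γ ∈ Ioo 1 β, rankValue γ k q (q - 1) = 1 := by
  have hk0 := h.pos
  have hk := h.lt
  set s := rankSeq k q (q - 1) with hs
  have hper : ∀ n, s (q + n) = s n := rankSeq_period_add k q (q - 1)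
  set f : ℝ → ℝ := fun x => ∑ i ∈ Finset.range q, ((s i).toNat : ℝ) * x ^ (i + 1) - (1 - x ^ q)
    with hf
  have hfs : ∀ x ∈ Ico (0 : ℝ) 1, f x = (digitSeries s x - 1) * (1 - x ^ q) := by
    intro x hx
    simp only [hf]
    rw [← digitSeries_mul_one_sub_pow hper hx]
    ring
  have hpow : ∀ x ∈ Ico (0 : ℝ) 1, 0 < 1 - x ^ q := fun x hx =>
    sub_pos.2 (pow_lt_one₀ hx.1 hx.2 (by omega))
  have hb := one_div_mem_Ico hβ.1
  have hneg : f (1 / β) < 0 := by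
    rw [hfs _ hb]
    exact mul_neg_of_neg_of_pos (sub_neg.2 h.lt_one) (hpow _ hb)
  have hpos : 0 < f 1 := by
    simp only [hf, one_pow, mul_one, sub_self, sub_zero]
    refine lt_of_lt_of_le one_pos ?_
    have := Finset.single_le_sum (f := fun i => ((s i).toNat : ℝ))
      (fun i _ => (toNat_cast_mem _).1) (Finset.mem_range.2 (by omega : 0 < q))
    simpa [hs, rankSeq_pred_zero hk0 hk] using this
  have hcont : ContinuousOn f (Icc (1 / β) 1) := by
    simp only [hf]
    fun_prop
  obtain ⟨x, hx, hfx⟩ := intermediate_value_Ioo hb.2.le hcont ⟨hneg, hpos⟩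
  have hb0 : 0 < 1 / β := one_div_pos.2 (by linarith [hβ.1])
  have hx0 : 0 < x := hb0.trans hx.1
  have hxI : x ∈ Ico (0 : ℝ) 1 := ⟨hx0.le, hx.2⟩
  refine ⟨1 / x, ⟨?_, ?_⟩, ?_⟩
  · exact (one_lt_div hx0).2 hx.2
  · have := one_div_lt_one_div_of_lt hb0 hx.1
    rwa [one_div_one_div] at this
  · rw [rankValue, one_div_one_div]
    rw [hfs x hxI] at hfx
    have := (mul_eq_zero.1 hfx).resolve_right (hpow x hxI).ne'
    linarith

theorem exists_right (h : RealizesRotation β k q) (hβ : β ∈ Ioo (1 : ℝ) 2) :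
    ∃ γ ∈ Icc β 2, 1 / γ + rankValue γ k q 0 = 1 := by
  have hk := h.lt
  have hb0 : 0 < β := by linarith [hβ.1]
  set s := rankSeq k q 0 with hs
  have hper : ∀ n, s (q + n) = s n := rankSeq_period_add k q 0
  set f : ℝ → ℝ := fun x => ∑ i ∈ Finset.range q, ((s i).toNat : ℝ) * x ^ (i + 1) -
    (1 - x) * (1 - x ^ q) with hf
  have hfs : ∀ x ∈ Ico (0 : ℝ) 1, f x = (x + digitSeries s x - 1) * (1 - x ^ q) := by
    intro x hx
    simp only [hf]
    rw [← digitSeries_mul_one_sub_pow hper hx]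
    ring
  have hpow : ∀ x ∈ Ico (0 : ℝ) 1, 0 < 1 - x ^ q := fun x hx =>
    sub_pos.2 (pow_lt_one₀ hx.1 hx.2 (by omega))
  have hb := one_div_mem_Ico hβ.1
  have hhalf : (1 / 2 : ℝ) ∈ Ico (0 : ℝ) 1 := by norm_num
  have hpos : 0 ≤ f (1 / β) := by
    rw [hfs _ hb]
    refine mul_nonneg ?_ (hpow _ hb).le
    have : 1 - 1 / β ≤ digitSeries s (1 / β) := h.cut_le
    linarith
  -- In base `2` the smallest point is at most `1/2`, because its first digit is `0`.
  have hneg : f (1 / 2) ≤ 0 := by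
    rw [hfs _ hhalf]
    refine mul_nonpos_of_nonpos_of_nonneg ?_ (hpow _ hhalf).le
    have h1 := digitSeries_eq s hhalf
    rw [hs, rankSeq_zero_zero hk, Bool.toNat_false, Nat.cast_zero, zero_add, ← hs] at h1
    have h2 := digitSeries_le (fun n => s (n + 1)) hhalf
    norm_num at h2
    linarith
  have hcont : ContinuousOn f (Icc (1 / 2) (1 / β)) := by
    simp only [hf]
    fun_prop
  have hle : 1 / 2 ≤ 1 / β := one_div_le_one_div_of_le hb0 hβ.2.le
  obtain ⟨x, hx, hfx⟩ := intermediate_value_Icc hle hcont ⟨hneg, hpos⟩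
  have hx0 : 0 < x := by linarith [hx.1]
  have hxI : x ∈ Ico (0 : ℝ) 1 := ⟨hx0.le, hx.2.trans_lt hb.2⟩
  refine ⟨1 / x, ⟨?_, ?_⟩, ?_⟩
  · have := one_div_le_one_div_of_le hx0 hx.2
    rwa [one_div_one_div] at this
  · have := one_div_le_one_div_of_le (by norm_num) hx.1
    rwa [one_div_one_div] at this
  · rw [rankValue, one_div_one_div]
    rw [hfs x hxI] at hfx
    have := (mul_eq_zero.1 hfx).resolve_right (hpow x hxI).ne'
    linarith

theorem exists_isFareyInterval (h : RealizesRotation β k q) (hβ : β ∈ Ioo (1 : ℝ) 2) :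
    ∃ J, IsFareyInterval J ∧ β ∈ J := by
  have hk0 := h.pos
  have hk := h.lt
  obtain ⟨γL, hL, hLv⟩ := h.exists_left hβ
  obtain ⟨γR, hR, hRv⟩ := h.exists_right hβ
  have hR1 : 1 < γR := hβ.1.trans_le hR.1
  -- The largest point equals `1` in base `γL` and is no larger in base `γR`, so all tails there
  -- have values in `(0, 1]`, as the quasi-greedy criterion demands.
  have hmaxR : rankValue γR k q (q - 1) ≤ 1 := by
    rw [← hLv]
    exact digitSeries_mono _ (one_div_mem_Ico hR1).1
      (one_div_le_one_div_of_le (by linarith [hL.1]) (hL.2.le.trans hR.1)) (inv_lt_one_of hL.1)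
  refine ⟨Ioc γL γR, ⟨upperWord k q, γL, γR, ?_, ⟨hL.1, by linarith [hL.2, hβ.2]⟩, ⟨hR1, hR.2⟩,
    ?_, ?_, rfl⟩, hL.2, hR.1⟩
  · rw [reflectWord_upperWord hk.le (by omega), isNondegenerateFareyWord_iff]
    exact ⟨q - k, q, by omega, by omega, (Nat.coprime_self_sub_left hk.le).2 h.coprime, rfl⟩
  · rw [upperWord, periodicSeq_map_rankSeq (by omega)]
    refine quasiGreedyOne_eq hL.1 hLv fun n => ?_
    rw [rankSeq_add]
    exact ⟨rankValue_pos hL.1 hk0 hk _, (rankValue_bounds hL.1 hk _).2.trans hLv.le⟩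
  · rw [reverse_upperWord hk, periodicSeq_map_rankSeq (by omega),
      prependWord_raiseLast hk0 hk h.coprime]
    have hone : digitSeries (fun n => decide (n = 0) || rankSeq k q 0 n) (1 / γR) = 1 := by
      rw [digitSeries_prepend_true (rankSeq_zero_zero hk) (one_div_mem_Ico hR1)]
      exact hRv
    refine quasiGreedyOne_eq hR1 hone fun n => ?_
    rcases Nat.eq_zero_or_pos n with rfl | hn
    · simp only [zero_add]
      rw [hone]
      norm_num
    · have htail : (fun i => decide (n + i = 0) || rankSeq k q 0 (n + i)) =
          fun i => rankSeq k q 0 (n + i) := by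
        funext i
        rw [decide_eq_false (by omega), Bool.false_or]
      rw [htail, rankSeq_add]
      exact ⟨rankValue_pos hR1 hk0 hk _, (rankValue_bounds hR1 hk _).2.trans hmaxR⟩

end RealizesRotation

end BetaHole

theorem theorem4 (β : ℝ) (hβ : β ∈ Set.Ioo (1 : ℝ) 2) :
    (∃! τ : ℝ, BetaHole.IsCriticalValue β τ) ∧
    ∀ τ : ℝ, BetaHole.IsCriticalValue β τ →
      τ ≤ 1 - 1 / β ∧
      (τ = 1 - 1 / β ↔ BetaHole.IsCantorSet (closure (BetaHole.orbitMinimalSet β))) ∧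
      (τ = 1 - 1 / β ↔ ∀ J : Set ℝ, BetaHole.IsFareyInterval J → β ∉ J) := by
  obtain ⟨σ, hσ1, hσ⟩ := BetaHole.exists_isCriticalValue hβ
  have hinv : 0 < 1 / β := by have := hβ.1; positivity
  have huniq : ∀ τ, BetaHole.IsCriticalValue β τ → τ = σ := fun τ hτ =>
    BetaHole.IsCriticalValue.unique (by linarith) hσ hτ
  refine ⟨⟨σ, hσ, huniq⟩, fun τ hτ => ?_⟩
  obtain rfl := huniq τ hτ
  refine ⟨hσ1, ?_⟩
  -- A periodic orbit in `[1 - 1/β, 1)` refutes all three conditions, and its absence proves all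
  -- three.
  by_cases hP : BetaHole.HasPeriodicAbove β
  · obtain ⟨k, q, h⟩ := BetaHole.exists_realizesRotation hβ hP
    have hne : τ ≠ 1 - 1 / β := (h.criticalValue_lt hβ hτ).ne
    obtain ⟨J, hJ, hmem⟩ := h.exists_isFareyInterval hβ
    exact ⟨iff_of_false hne (h.not_isCantorSet hβ), iff_of_false hne fun hall => hall J hJ hmem⟩
  · have heq : τ = 1 - 1 / β := hτ.eq_cut hβ hP hσ1
    refine ⟨iff_of_true heq (BetaHole.isCantorSet_of_not_hasPeriodicAbove hβ hP),
      iff_of_true heq fun J hJ hmem => hP ?_⟩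
    obtain ⟨k, q, h⟩ := BetaHole.realizesRotation_of_mem_fareyInterval hβ hJ hmem
    exact h.hasPeriodicAbove hβ.1
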